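/- Let $M$ be a smooth manifold of dimension $n\ge 3$, let $\alpha=\sqrt{a_{ij}(x)y^iy^j}$ and $\bar\alpha=\sqrt{\bar a_{ij}(x)y^iy^j}$ be two smooth Riemannian metrics on $M$, and let $\beta=b_i(x)y^i$ and $\bar\beta=\bar b_i(x)y^i$ be two non-zero collinear smooth 1-forms on $M$: $\bar\beta$ vanishes at no point, $\beta$ is not identically zero, and $\beta_x=\mu(x)\bar\beta_x$ at each point $x$, with $\mu(x)\in\mathbb R$. Let $q\ne 1$ be a real number such that $F=\frac{(\alpha+\beta)^q}{\alpha^{q-1}}$ is a $(q,\alpha,\beta)$-metric, that is, $\|\beta\|_\alpha<1$ at each point and $F$ is a Finsler metric on $M$ (positive, positively homogeneous of degree one, smooth and with positive definite $g_{ij}=\frac12\frac{\partial^2F^2}{\partial y^i\partial y^j}$ on the slit tangent bundle $TM_0$). Let $\bar F=\frac{\bar\alpha^2}{\bar\beta}$ be the Kropina metric, defined on the cone $\{\bar\beta>0\}\subset TM_0$. For a metric $F$ let $G^i=\frac14 g^{il}\big(\frac{\partial^2F^2}{\partial x^k\partial y^l}y^k-\frac{\partial F^2}{\partial x^l}\big)$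 be its spray coefficients in a local coordinate system; $\bar G^i$ are those of $\bar F$, and $G^i_\alpha$, $\bar G^i_{\bar\alpha}$ those of $\alpha$, $\bar\alpha$. $F$ and $\bar F$ are projectively related if there is a scalar function $P=P(x,y)$ with $G^i=\bar G^i+Py^i$ on $\{\bar\beta>0\}$ in every local coordinate system. A metric is a Douglas metric if $\frac{\partial^3}{\partial y^j\partial y^k\partial y^l}\big(G^i-\frac1{n+1}\frac{\partial G^m}{\partial y^m}y^i\big)=0$ on its domain ($TM_0$ for $F$, $\{\bar\beta>0\}$ for $\bar F$). Let $b_{i|j}=\frac{\partial b_i}{\partial x^j}-b_k\Gamma^k_{ij}$ with the Christoffel symbols of $\alpha$, $r_{ij}=\frac12(b_{i|j}+b_{j|i})$, $s_{ij}=\frac12(b_{i|j}-b_{j|i})$, $r_{00}=r_{ij}y^iy^j$, $b^i=a^{ij}b_j$, $b^2=\|\beta\|_\alpha^2=b^ib_i$, $s_j=b^is_{ij}$, $s^i=a^{ij}s_j$, and define $\bar r_{00},\bar b^i,\bar b^2=\|\bar\beta\|^2_{\bar\alpha},\bar s^i$ in the same way from $\bar\alpha,\bar\beta$. Then $F$ is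 projectively related to $\bar F$ if and only if $F$ and $\bar F$ are both Douglas metrics and there is a smooth 1-form $\theta=\theta_i(x)y^i$ on $M$ such that, in every local coordinate system and for all $y\ne0$, $$G^i_\alpha-\bar G^i_{\bar\alpha}=-\frac12\,\frac{q(q-1)\,\alpha^2\,r_{00}}{(1-q^2)\beta^2+(2-q)\alpha\beta+[1+(q^2-q)b^2]\alpha^2}\,b^i+\frac1{2\bar b^2}\big(\bar\alpha^2\bar s^i+\bar r_{00}\bar b^i\big)+\theta\,y^i .$$ -/

import Mathlib

open scoped Manifold ContDiff Matrix

noncomputable section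

namespace FinslerProj

variable {n : ℕ} {M : Type*} [TopologicalSpace M] [ChartedSpace (EuclideanSpace ℝ (Fin n)) M]

/-- The coordinate space `ℝⁿ`. -/
abbrev Coord (n : ℕ) : Type := EuclideanSpace ℝ (Fin n)

/-- Smooth Riemannian metrics on the manifold `M`. -/
abbrev RiemMetric (n : ℕ) (M : Type*) [TopologicalSpace M]
    [ChartedSpace (EuclideanSpace ℝ (Fin n)) M] [IsManifold (𝓡 n) ∞ M] : Type _ :=
  Bundle.ContMDiffRiemannianMetric (𝓡 n) ∞ (Coord n) (fun x : M => TangentSpace (𝓡 n) x)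

/-- Smooth 1-forms on `M`: smooth sections of the cotangent bundle. -/
abbrev OneForm (n : ℕ) (M : Type*) [TopologicalSpace M]
    [ChartedSpace (EuclideanSpace ℝ (Fin n)) M] [IsManifold (𝓡 n) ∞ M] : Type _ :=
  ContMDiffSection (𝓡 n) (Coord n →L[ℝ] ℝ) ∞ (fun x : M => TangentSpace (𝓡 n) x →L[ℝ] ℝ)

/-- The local coordinate systems: the charts of the maximal smooth atlas of `M`. -/
abbrev charts (n : ℕ) (M : Type*) [TopologicalSpace M]
    [ChartedSpace (EuclideanSpace ℝ (Fin n)) M] [IsManifold (𝓡 n) ∞ M] :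
    Set (OpenPartialHomeomorph M (Coord n)) :=
  IsManifold.maximalAtlas (𝓡 n) ∞ M

/-- The tangent vector `yⁱ ∂/∂xⁱ` at the point with coordinates `u` in the chart `e`. -/
def tvec (e : OpenPartialHomeomorph M (Coord n)) (u y : Coord n) :
    TangentSpace (𝓡 n) (e.symm u) :=
  mfderiv (𝓡 n) (𝓡 n) e.symm u y

/-- The `k`-th standard basis vector of `ℝⁿ`. -/
def stdVec (k : Fin n) : Coord n := EuclideanSpace.single k (1 : ℝ)

/-- The partial derivative `∂f/∂xᵏ` of a function on `ℝⁿ`. -/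
def pd (k : Fin n) (f : Coord n → ℝ) (u : Coord n) : ℝ := fderiv ℝ f u (stdVec k)

/-- A function on the tangent bundle, written in the coordinates `(x, y)` given by the chart. -/
def inChart (F : ∀ x : M, TangentSpace (𝓡 n) x → ℝ) (e : OpenPartialHomeomorph M (Coord n))
    (u y : Coord n) : ℝ :=
  F (e.symm u) (tvec e u y)

/-! ### Finsler metrics, spray coefficients, Douglas tensor -/

/-- The fundamental tensor `g_ij = ½ ∂²F²/∂yⁱ∂yʲ`. -/
def fundTensor (F : ∀ x : M, TangentSpace (𝓡 n) x → ℝ) (e : OpenPartialHomeomorph M (Coord n))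
    (u y : Coord n) : Matrix (Fin n) (Fin n) ℝ :=
  Matrix.of fun i j => (1 / 2) * pd i (fun z => pd j (fun w => inChart F e u w ^ 2) z) y

/-- The spray coefficients `Gⁱ = ¼ gⁱˡ (∂²F²/∂xᵏ∂yˡ yᵏ - ∂F²/∂xˡ)`. -/
def spray (F : ∀ x : M, TangentSpace (𝓡 n) x → ℝ) (e : OpenPartialHomeomorph M (Coord n))
    (u y : Coord n) (i : Fin n) : ℝ :=
  (1 / 4) * ∑ l, (fundTensor F e u y)⁻¹ i l *
    ((∑ k, pd k (fun v => pd l (fun w => inChart F e v w ^ 2) y) u * y k)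
      - pd l (fun v => inChart F e v y ^ 2) u)

/-- `F` is a (regular) Finsler metric on `M`: positive, positively homogeneous of degree one,
smooth and strongly convex on the slit tangent bundle. -/
structure IsFinslerMetric [IsManifold (𝓡 n) ∞ M]
    (F : ∀ x : M, TangentSpace (𝓡 n) x → ℝ) : Prop where
  pos : ∀ (x : M) (v : TangentSpace (𝓡 n) x), v ≠ 0 → 0 < F x v
  homog : ∀ (x : M) (v : TangentSpace (𝓡 n) x) (t : ℝ), 0 < t → F x (t • v) = t * F x v
  smooth : ∀ e ∈ charts n M,
    ContDiffOn ℝ ∞ (fun p : Coord n × Coord n => inChart F e p.1 p.2) (e.target ×ˢ {0}ᶜ)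
  convex : ∀ e ∈ charts n M, ∀ u ∈ e.target, ∀ y : Coord n, y ≠ 0 → (fundTensor F e u y).PosDef

/-- The slit tangent bundle, as a family of subsets of the tangent spaces. -/
def slit (x : M) : Set (TangentSpace (𝓡 n) x) := {v | v ≠ 0}

/-- `F` and `F'` are projectively related on the part `A` of the tangent bundle:
`Gⁱ = G'ⁱ + P yⁱ` for a scalar function `P` of `(x, y)`. -/
def ProjectivelyRelated [IsManifold (𝓡 n) ∞ M] (F F' : ∀ x : M, TangentSpace (𝓡 n) x → ℝ)
    (A : ∀ x : M, Set (TangentSpace (𝓡 n) x)) : Prop :=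
  ∃ P : ∀ x : M, TangentSpace (𝓡 n) x → ℝ,
    ∀ e ∈ charts n M, ∀ u ∈ e.target, ∀ y : Coord n, tvec e u y ∈ A (e.symm u) →
      ∀ i, spray F e u y i = spray F' e u y i + P (e.symm u) (tvec e u y) * y i

/-- The Douglas tensor `D^i_{jkl} = ∂³/∂yʲ∂yᵏ∂yˡ (Gⁱ - (1/(n+1)) (∂Gᵐ/∂yᵐ) yⁱ)`. -/
def douglas (F : ∀ x : M, TangentSpace (𝓡 n) x → ℝ) (e : OpenPartialHomeomorph M (Coord n))
    (u y : Coord n) (i j k l : Fin n) : ℝ :=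
  pd j (fun y₁ => pd k (fun y₂ => pd l (fun y₃ => spray F e u y₃ i
    - (1 / ((n : ℝ) + 1)) * (∑ m, pd m (fun w => spray F e u w m) y₃) * y₃ i) y₂) y₁) y

/-- `F`, a metric on the part `A` of the tangent bundle, is a Douglas metric. -/
def IsDouglas [IsManifold (𝓡 n) ∞ M] (F : ∀ x : M, TangentSpace (𝓡 n) x → ℝ)
    (A : ∀ x : M, Set (TangentSpace (𝓡 n) x)) : Prop :=
  ∀ e ∈ charts n M, ∀ u ∈ e.target, ∀ y : Coord n, tvec e u y ∈ A (e.symm u) →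
    ∀ i j k l, douglas F e u y i j k l = 0

/-! ### Riemannian metrics and 1-forms in coordinates -/

section coordinates

variable [IsManifold (𝓡 n) ∞ M]

/-- The norm function `α(x, y) = √(a_ij yⁱ yʲ)`. -/
def rnorm (a : RiemMetric n M) (x : M) (v : TangentSpace (𝓡 n) x) : ℝ := √(a.inner x v v)

/-- The components `a_ij`. -/
def aComp (a : RiemMetric n M) (e : OpenPartialHomeomorph M (Coord n)) (u : Coord n) :
    Matrix (Fin n) (Fin n) ℝ :=
  Matrix.of fun i j => a.inner (e.symm u) (tvec e u (stdVec i)) (tvec e u (stdVec j))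

/-- The components `b_i`. -/
def bComp (β : OneForm n M) (e : OpenPartialHomeomorph M (Coord n)) (u : Coord n)
    (i : Fin n) : ℝ :=
  β (e.symm u) (tvec e u (stdVec i))

/-- The Christoffel symbols `Γⁱ_jk` of the Levi-Civita connection. -/
def christoffel (a : RiemMetric n M) (e : OpenPartialHomeomorph M (Coord n)) (u : Coord n)
    (i j k : Fin n) : ℝ :=
  (1 / 2) * ∑ l, (aComp a e u)⁻¹ i l *
    (pd j (fun v => aComp a e v l k) u + pd k (fun v => aComp a e v l j) u
      - pd l (fun v => aComp a e v j k) u)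

/-- The covariant derivative `b_{i|j} = ∂b_i/∂xʲ - b_k Γᵏ_ij`. -/
def covDeriv (a : RiemMetric n M) (β : OneForm n M) (e : OpenPartialHomeomorph M (Coord n))
    (u : Coord n) (i j : Fin n) : ℝ :=
  pd j (fun v => bComp β e v i) u - ∑ k, bComp β e u k * christoffel a e u k i j

/-- `r_ij = ½ (b_{i|j} + b_{j|i})`. -/
def rTen (a : RiemMetric n M) (β : OneForm n M) (e : OpenPartialHomeomorph M (Coord n))
    (u : Coord n) (i j : Fin n) : ℝ :=
  (1 / 2) * (covDeriv a β e u i j + covDeriv a β e u j i)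

/-- `s_ij = ½ (b_{i|j} - b_{j|i})`. -/
def sTen (a : RiemMetric n M) (β : OneForm n M) (e : OpenPartialHomeomorph M (Coord n))
    (u : Coord n) (i j : Fin n) : ℝ :=
  (1 / 2) * (covDeriv a β e u i j - covDeriv a β e u j i)

/-- `bⁱ = aⁱʲ b_j`. -/
def bUp (a : RiemMetric n M) (β : OneForm n M) (e : OpenPartialHomeomorph M (Coord n))
    (u : Coord n) (i : Fin n) : ℝ :=
  ∑ j, (aComp a e u)⁻¹ i j * bComp β e u j

/-- `b² = ‖β‖²_α = aⁱʲ b_i b_j`. -/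
def bSq (a : RiemMetric n M) (β : OneForm n M) (e : OpenPartialHomeomorph M (Coord n))
    (u : Coord n) : ℝ :=
  ∑ i, bUp a β e u i * bComp β e u i

/-- `r₀₀ = r_ij yⁱ yʲ`. -/
def r00 (a : RiemMetric n M) (β : OneForm n M) (e : OpenPartialHomeomorph M (Coord n))
    (u y : Coord n) : ℝ :=
  ∑ i, ∑ j, rTen a β e u i j * y i * y j

/-- `s_j = bⁱ s_ij`. -/
def sDown (a : RiemMetric n M) (β : OneForm n M) (e : OpenPartialHomeomorph M (Coord n))
    (u : Coord n) (j : Fin n) : ℝ :=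
  ∑ i, bUp a β e u i * sTen a β e u i j

/-- `sⁱ = aⁱʲ s_j`. -/
def sUp (a : RiemMetric n M) (β : OneForm n M) (e : OpenPartialHomeomorph M (Coord n))
    (u : Coord n) (i : Fin n) : ℝ :=
  ∑ j, (aComp a e u)⁻¹ i j * sDown a β e u j

/-! ### The two classes of metrics -/

/-- The function `F = (α + β)^q / α^(q-1)`. -/
def qMetric (q : ℝ) (a : RiemMetric n M) (β : OneForm n M) (x : M)
    (v : TangentSpace (𝓡 n) x) : ℝ :=
  (rnorm a x v + β x v) ^ q / rnorm a x v ^ (q - 1)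

/-- `F = (α + β)^q / α^(q-1)` is a `(q, α, β)`-metric: `‖β‖_α < 1` everywhere, and `F` is a
Finsler metric. -/
structure IsQMetric (q : ℝ) (a : RiemMetric n M) (β : OneForm n M) : Prop where
  norm_lt_one : ∀ e ∈ charts n M, ∀ u ∈ e.target, bSq a β e u < 1
  finsler : IsFinslerMetric (qMetric q a β)

/-- The Kropina metric `F = α² / β`; it lives on the cone `kropinaCone β`. -/
def kropina (a : RiemMetric n M) (β : OneForm n M) (x : M) (v : TangentSpace (𝓡 n) x) : ℝ :=
  rnorm a x v ^ 2 / β x v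

/-- The domain `β > 0` of the Kropina metric (on which it is positive). -/
def kropinaCone (β : OneForm n M) (x : M) : Set (TangentSpace (𝓡 n) x) := {v | 0 < β x v}

end coordinates

end FinslerProj

end

noncomputable section

set_option linter.unusedSectionVars false

/-! ### The Euler-Lagrange form of the spray equations -/

namespace FinslerProj

section EulerLagrange

variable {V : Type*} [NormedAddCommGroup V] [NormedSpace ℝ V]

/-! The spray of a metric is determined by the Euler–Lagrange equation of its energy
(`spray_eq_iff`). For an energy that is a function of `α²` and `β`, the solution has the form `G_α +
σ sⁱ₀ + t bⁱ + p yⁱ` (`IsTwoJet.sprayVec_eq`), which gives explicit sprays for both metrics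
(`IsQMetric.sprayVec_eq`, `sprayVec_kropina`). Projective relatedness says that the difference of
the two sprays is parallel to `y` (`Par`), so everything may be computed modulo `y`.

Suppose the metrics are projectively related. Near the hyperplane `β̄ = 0` the Kropina spray has a
simple pole in `β̄`, while the spray of `F` stays continuous. The residue is therefore parallel to
`y`; being also orthogonal to `y`, it vanishes, which forces `s̄_ij = (b̄_i s̄_j - b̄_j s̄_i)/b̄²`
(`sMap_eq_of_boundary`). Modulo `y` the Kropina spray is then quadratic in `y`, hence even. By
continuity the spray of `F` is even modulo `y` on `β̄ = 0`. Collinearity gives `β = 0` there too, so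
the explicit formula has an easily isolated odd part, and its vanishing yields `s_ij = 0` unless `q
= 0` (`IsQMetric.sForm_eq_zero`).

What remains is that a quadratic map plus a multiple of `r₀₀ α² bⁱ / E` is parallel to `y`, where
`E` is the denominator in the formula of the theorem. On lines `b + t w` with `w ⟂ b` this is a
polynomial identity involving `√(|b|² + |w|² t²)` (`quadratic_of_line`). For `q` other than `0`,
`1`, `2` irrationality of the root gives `r₀₀ = 0`; for `q = 2` the root drops out and `E` divides
`r₀₀`. In every case the `bⁱ` term equals `c α² bⁱ` with `c` depending only on the point
(`IsQMetric.exists_quadratic`). Both sprays are thus quadratic modulo `y`, so both metrics are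
Douglas (`douglas_eq_zero_of_eventually`). A quadratic map parallel to `y` is a linear form times
`y`, the form being a multiple of its trace (`bilinear_eq_trace_of_par`). This form is `θ`. It is
smooth and global because the trace is the differential of a chart-independent function built from
`log det a`, `log det ā`, `log b̄²` and, if `q = 2`, `log (1 - b²)` (`fderiv_potential`,
`potential_transition`).

Conversely, the Douglas condition makes the projective part of a spray quadratic along lines. For
the Kropina metric this bounds it at `β̄ = 0`, so the residue argument applies again
(`kropinaCondition_of_douglas`). For `F`, comparing the two ends of a line in direction `w` shows
evenness modulo `w` (`IsQMetric.par_sub_neg_of_douglas`), hence `s_ij = 0`. The formula for `G_α -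
Ḡ_ᾱ` then makes the difference of the sprays a multiple of `y`, and the transformation law of sprays
shows that the factor does not depend on the chart (`IsQMetric.projectivelyRelated_of_chart`). -/

/-- The Euler–Lagrange expression of `L` at position `u`, velocity `y` and acceleration `ξ`,
evaluated on `z`. -/
def eulerLagrange (L : V × V → ℝ) (u y ξ z : V) : ℝ :=
  fderiv ℝ (fderiv ℝ L) (u, y) (y, ξ) (0, z) - fderiv ℝ L (u, y) (z, 0)

theorem fderiv_fderiv_apply {W : Type*} [NormedAddCommGroup W] [NormedSpace ℝ W] {L : W → ℝ}
    {p : W} (hL : ContDiffAt ℝ 2 L p) (v w : W) :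
    fderiv ℝ (fderiv ℝ L) p v w = fderiv ℝ (fun x => fderiv ℝ L x w) p v := by
  have h : DifferentiableAt ℝ (fderiv ℝ L) p :=
    (hL.fderiv_right (m := 1) (by norm_num)).differentiableAt (by simp)
  have := h.hasFDerivAt.clm_apply (hasFDerivAt_const w p)
  rw [this.fderiv]
  simp

theorem eventually_differentiableAt {W : Type*} [NormedAddCommGroup W] [NormedSpace ℝ W]
    {L : W → ℝ} {p : W} (hL : ContDiffAt ℝ 2 L p) : ∀ᶠ x in nhds p, DifferentiableAt ℝ L x := by
  filter_upwards [hL.eventually (by simp)] with x hx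
  exact hx.differentiableAt (by simp)

/-- The chain rule, with the acceleration transformed as that of the image curve. The terms
containing the second derivative of `Φ` contracted with `z` appear once from each summand of the
Euler–Lagrange expression and cancel by symmetry of that derivative. -/
theorem eulerLagrange_transform {L L' : V × V → ℝ} {Φ : V → V} {u y : V}
    (hΦ : ContDiffAt ℝ 3 Φ u) (hL' : ContDiffAt ℝ 2 L' (Φ u, fderiv ℝ Φ u y))
    (h : L =ᶠ[nhds (u, y)] fun p => L' (Φ p.1, fderiv ℝ Φ p.1 p.2)) (ξ z : V) :
    eulerLagrange L u y ξ z = eulerLagrange L' (Φ u) (fderiv ℝ Φ u y)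
      (fderiv ℝ Φ u ξ + fderiv ℝ (fderiv ℝ Φ) u y y) (fderiv ℝ Φ u z) := by
  have hΦ' : ContDiffAt ℝ 2 (fderiv ℝ Φ) u := hΦ.fderiv_right (by norm_num)
  have hΦe : ∀ᶠ x in nhds u, DifferentiableAt ℝ Φ x ∧ DifferentiableAt ℝ (fderiv ℝ Φ) x := by
    filter_upwards [hΦ.eventually (by simp), hΦ'.eventually (by simp)] with x h1 h2
    exact ⟨h1.differentiableAt (by simp), h2.differentiableAt (by simp)⟩
  have hfst : Filter.Tendsto (fun p : V × V => p.1) (nhds (u, y)) (nhds u) :=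
    continuous_fst.tendsto (u, y)
  let Ψ : V × V → V × V := fun p => (Φ p.1, fderiv ℝ Φ p.1 p.2)
  have hΨ1 : ∀ p : V × V, DifferentiableAt ℝ Φ p.1 → DifferentiableAt ℝ (fderiv ℝ Φ) p.1 →
      HasFDerivAt Ψ (((fderiv ℝ Φ p.1).comp (ContinuousLinearMap.fst ℝ V V)).prod
        ((fderiv ℝ Φ p.1).comp (ContinuousLinearMap.snd ℝ V V) +
          ((fderiv ℝ (fderiv ℝ Φ) p.1).comp (ContinuousLinearMap.fst ℝ V V)).flip p.2)) p := by
    intro p h1 h2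
    exact (h1.hasFDerivAt.comp p hasFDerivAt_fst).prodMk
      ((h2.hasFDerivAt.comp p hasFDerivAt_fst).clm_apply hasFDerivAt_snd)
  have hΨu := hΨ1 (u, y) hΦe.self_of_nhds.1 hΦe.self_of_nhds.2
  have hΨc : Filter.Tendsto Ψ (nhds (u, y)) (nhds (Φ u, fderiv ℝ Φ u y)) :=
    hΨu.continuousAt
  have hL : ContDiffAt ℝ 2 L (u, y) := by
    refine ContDiffAt.congr_of_eventuallyEq ?_ h
    refine ContDiffAt.comp (u, y) (f := Ψ) hL' ?_
    exact (ContDiffAt.comp (u, y) (hΦ.of_le (by norm_num)) contDiffAt_fst).prodMk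
      ((ContDiffAt.comp (u, y) hΦ' contDiffAt_fst).clm_apply contDiffAt_snd)
  have hd : ∀ᶠ p in nhds (u, y), ∀ w : V × V, fderiv ℝ L p w =
      fderiv ℝ L' (Ψ p) (fderiv ℝ Φ p.1 w.1,
        fderiv ℝ Φ p.1 w.2 + fderiv ℝ (fderiv ℝ Φ) p.1 w.1 p.2) := by
    filter_upwards [h.eventuallyEq_nhds, hfst.eventually hΦe,
      hΨc.eventually (eventually_differentiableAt hL')] with p h1 h2 h3 w
    rw [h1.fderiv_eq]
    have := h3.hasFDerivAt.comp p (hΨ1 p h2.1 h2.2)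
    have h4 : (fun p : V × V => L' (Φ p.1, fderiv ℝ Φ p.1 p.2)) = L' ∘ Ψ := rfl
    rw [h4, this.fderiv]
    simp
  have hdz : (fun p => fderiv ℝ L p (0, z)) =ᶠ[nhds (u, y)]
      fun p => fderiv ℝ L' (Ψ p) (0, fderiv ℝ Φ p.1 z) := by
    filter_upwards [hd] with p hp
    rw [hp]
    simp
  have hD : DifferentiableAt ℝ (fderiv ℝ L') (Ψ (u, y)) :=
    (hL'.fderiv_right (m := 1) (by norm_num)).differentiableAt (by simp)
  have hX : HasFDerivAt (fun p : V × V => ((0 : V), fderiv ℝ Φ p.1 z))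
      ((0 : V × V →L[ℝ] V).prod (((fderiv ℝ (fderiv ℝ Φ) u).comp
        (ContinuousLinearMap.fst ℝ V V)).flip z)) (u, y) := by
    refine (hasFDerivAt_const _ _).prodMk ?_
    have hg : HasFDerivAt (fun p : V × V => fderiv ℝ Φ p.1) ((fderiv ℝ (fderiv ℝ Φ) u).comp
        (ContinuousLinearMap.fst ℝ V V)) (u, y) :=
      HasFDerivAt.comp (g := fderiv ℝ Φ) (u, y) hΦe.self_of_nhds.2.hasFDerivAt hasFDerivAt_fst
    simpa using hg.clm_apply (hasFDerivAt_const z (u, y))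
  have hsym : fderiv ℝ (fderiv ℝ Φ) u y z = fderiv ℝ (fderiv ℝ Φ) u z y :=
    (hΦ.isSymmSndFDerivAt (by simp; norm_num)).eq y z
  have hprod := (hD.hasFDerivAt.comp (u, y) hΨu).clm_apply hX
  unfold eulerLagrange
  rw [fderiv_fderiv_apply hL, hdz.fderiv_eq, hd.self_of_nhds]
  simp only [Function.comp_def] at hprod
  rw [hprod.fderiv]
  have hadd : ∀ v w : V, fderiv ℝ L' (Ψ (u, y)) (v, w) =
      fderiv ℝ L' (Ψ (u, y)) (v, 0) + fderiv ℝ L' (Ψ (u, y)) (0, w) := by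
    intro v w
    rw [← map_add]
    simp
  rw [hadd (fderiv ℝ Φ u (z, (0 : V)).1)]
  simp [hsym, Ψ]
  abel

theorem fderiv_comp_prodMk {W : Type*} [NormedAddCommGroup W] [NormedSpace ℝ W]
    {f f₁ f₂ : ℝ × ℝ → ℝ} {A B : W → ℝ} {p : W}
    (hf : HasFDerivAt f (f₁ (A p, B p) • ContinuousLinearMap.fst ℝ ℝ ℝ +
      f₂ (A p, B p) • ContinuousLinearMap.snd ℝ ℝ ℝ) (A p, B p))
    (hA : DifferentiableAt ℝ A p) (hB : DifferentiableAt ℝ B p) :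
    HasFDerivAt (fun x => f (A x, B x))
      (f₁ (A p, B p) • fderiv ℝ A p + f₂ (A p, B p) • fderiv ℝ B p) p := by
  have := hf.comp p (hA.hasFDerivAt.prodMk hB.hasFDerivAt)
  refine this.congr_fderiv ?_
  ext w
  simp

theorem snd_fderiv_comp_prodMk {W : Type*} [NormedAddCommGroup W] [NormedSpace ℝ W]
    {f f₁ f₂ : ℝ × ℝ → ℝ} {f₁₁ f₁₂ f₂₂ : ℝ} {A B : W → ℝ} {p : W}
    (hf : ∀ᶠ x in nhds (A p, B p), HasFDerivAt f (f₁ x • ContinuousLinearMap.fst ℝ ℝ ℝ +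
      f₂ x • ContinuousLinearMap.snd ℝ ℝ ℝ) x)
    (hf₁ : HasFDerivAt f₁ (f₁₁ • ContinuousLinearMap.fst ℝ ℝ ℝ +
      f₁₂ • ContinuousLinearMap.snd ℝ ℝ ℝ) (A p, B p))
    (hf₂ : HasFDerivAt f₂ (f₁₂ • ContinuousLinearMap.fst ℝ ℝ ℝ +
      f₂₂ • ContinuousLinearMap.snd ℝ ℝ ℝ) (A p, B p))
    (hA : ContDiffAt ℝ 2 A p) (hB : ContDiffAt ℝ 2 B p) (v w : W) :
    fderiv ℝ (fderiv ℝ fun x => f (A x, B x)) p v w =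
      f₁ (A p, B p) * fderiv ℝ (fderiv ℝ A) p v w + f₂ (A p, B p) * fderiv ℝ (fderiv ℝ B) p v w +
      (f₁₁ * fderiv ℝ A p v + f₁₂ * fderiv ℝ B p v) * fderiv ℝ A p w +
      (f₁₂ * fderiv ℝ A p v + f₂₂ * fderiv ℝ B p v) * fderiv ℝ B p w := by
  have hc : Filter.Tendsto (fun x => (A x, B x)) (nhds p) (nhds (A p, B p)) :=
    (hA.continuousAt).prodMk_nhds hB.continuousAt
  have hA' : DifferentiableAt ℝ (fderiv ℝ A) p :=
    (hA.fderiv_right (m := 1) (by norm_num)).differentiableAt (by simp)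
  have hB' : DifferentiableAt ℝ (fderiv ℝ B) p :=
    (hB.fderiv_right (m := 1) (by norm_num)).differentiableAt (by simp)
  have h1 : (fderiv ℝ fun x => f (A x, B x)) =ᶠ[nhds p]
      fun x => f₁ (A x, B x) • fderiv ℝ A x + f₂ (A x, B x) • fderiv ℝ B x := by
    filter_upwards [hc.eventually hf, eventually_differentiableAt hA,
      eventually_differentiableAt hB] with x h1 h2 h3
    exact (fderiv_comp_prodMk h1 h2 h3).fderiv
  have hAd := hA.differentiableAt (by simp)
  have hBd := hB.differentiableAt (by simp)
  have hp := hAd.hasFDerivAt.prodMk hBd.hasFDerivAt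
  have h2 := ((hf₁.comp p hp).smul hA'.hasFDerivAt).add ((hf₂.comp p hp).smul hB'.hasFDerivAt)
  have h3 := h2.fderiv
  simp only [Function.comp_def] at h3
  rw [h1.fderiv_eq]
  refine (congrArg (fun T => T v w) h3).trans ?_
  simp
  ring

theorem contDiffAt_two_of_infty {W : Type*} [NormedAddCommGroup W] [NormedSpace ℝ W]
    {f : W → ℝ} {p : W} (h : ContDiffAt ℝ ∞ f p) : ContDiffAt ℝ 2 f p :=
  h.of_le ENat.LEInfty.out

end EulerLagrange

/-! ### Spray coefficients as solutions of the Euler–Lagrange equation -/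

section SprayEquation

variable {n : ℕ} {M : Type*} [TopologicalSpace M] [ChartedSpace (EuclideanSpace ℝ (Fin n)) M]

theorem pd_fst {L : Coord n × Coord n → ℝ} {v y : Coord n}
    (h : DifferentiableAt ℝ L (v, y)) (k : Fin n) :
    pd k (fun v => L (v, y)) v = fderiv ℝ L (v, y) (stdVec k, 0) := by
  have h' : HasFDerivAt (fun v : Coord n => (v, y)) (ContinuousLinearMap.inl ℝ _ _) v :=
    hasFDerivAt_prodMk_left v y
  have := HasFDerivAt.comp (g := L) (f := fun v : Coord n => (v, y)) v h.hasFDerivAt h'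
  unfold pd
  simp only [Function.comp_def] at this
  rw [this.fderiv]
  simp

theorem pd_snd {L : Coord n × Coord n → ℝ} {v y : Coord n}
    (h : DifferentiableAt ℝ L (v, y)) (k : Fin n) :
    pd k (fun w => L (v, w)) y = fderiv ℝ L (v, y) (0, stdVec k) := by
  have h' : HasFDerivAt (fun w : Coord n => (v, w)) (ContinuousLinearMap.inr ℝ _ _) y :=
    hasFDerivAt_prodMk_right v y
  have := HasFDerivAt.comp (g := L) (f := fun w : Coord n => (v, w)) y h.hasFDerivAt h'
  unfold pd
  simp only [Function.comp_def] at this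
  rw [this.fderiv]
  simp

theorem pd_congr {f g : Coord n → ℝ} {u : Coord n} (h : f =ᶠ[nhds u] g) (k : Fin n) :
    pd k f u = pd k g u := by
  unfold pd
  rw [h.fderiv_eq]

theorem pd_fst_pd_snd {L : Coord n × Coord n → ℝ} {u y : Coord n}
    (hL : ContDiffAt ℝ 2 L (u, y)) (k l : Fin n) :
    pd k (fun v => pd l (fun w => L (v, w)) y) u =
      fderiv ℝ (fderiv ℝ L) (u, y) (stdVec k, 0) (0, stdVec l) := by
  have hc : Filter.Tendsto (fun v => (v, y)) (nhds u) (nhds (u, y)) :=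
    (Continuous.prodMk_left y).tendsto u
  have h1 : (fun v => pd l (fun w => L (v, w)) y) =ᶠ[nhds u]
      fun v => fderiv ℝ L (v, y) (0, stdVec l) := by
    filter_upwards [hc.eventually (eventually_differentiableAt hL)] with v hv
    exact pd_snd hv l
  have hd : DifferentiableAt ℝ (fderiv ℝ L) (u, y) :=
    (hL.fderiv_right (m := 1) (by norm_num)).differentiableAt (by simp)
  rw [pd_congr h1, fderiv_fderiv_apply hL]
  exact pd_fst (L := fun p => fderiv ℝ L p (0, stdVec l))
    (hd.clm_apply (differentiableAt_const _)) k

theorem pd_snd_pd_snd {L : Coord n × Coord n → ℝ} {u y : Coord n}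
    (hL : ContDiffAt ℝ 2 L (u, y)) (k l : Fin n) :
    pd k (fun z => pd l (fun w => L (u, w)) z) y =
      fderiv ℝ (fderiv ℝ L) (u, y) (0, stdVec k) (0, stdVec l) := by
  have hc : Filter.Tendsto (fun z => (u, z)) (nhds y) (nhds (u, y)) :=
    (Continuous.prodMk_right u).tendsto y
  have h1 : (fun z => pd l (fun w => L (u, w)) z) =ᶠ[nhds y]
      fun z => fderiv ℝ L (u, z) (0, stdVec l) := by
    filter_upwards [hc.eventually (eventually_differentiableAt hL)] with v hv
    exact pd_snd hv l
  have hd : DifferentiableAt ℝ (fderiv ℝ L) (u, y) :=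
    (hL.fderiv_right (m := 1) (by norm_num)).differentiableAt (by simp)
  rw [pd_congr h1, fderiv_fderiv_apply hL]
  exact pd_snd (L := fun p => fderiv ℝ L p (0, stdVec l))
    (hd.clm_apply (differentiableAt_const _)) k

theorem sum_smul_stdVec (y : Coord n) : ∑ i, y i • stdVec i = y := by
  simpa [stdVec] using (EuclideanSpace.basisFun (Fin n) ℝ).sum_repr y

/-- The energy `F²` in the coordinates `(x, y)` of a chart. -/
def energy (F : ∀ x : M, TangentSpace (𝓡 n) x → ℝ) (e : OpenPartialHomeomorph M (Coord n))
    (p : Coord n × Coord n) : ℝ :=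
  inChart F e p.1 p.2 ^ 2

variable {F : ∀ x : M, TangentSpace (𝓡 n) x → ℝ} {e : OpenPartialHomeomorph M (Coord n)}
  {u y : Coord n}

theorem fundTensor_apply (hL : ContDiffAt ℝ 2 (energy F e) (u, y)) (i j : Fin n) :
    fundTensor F e u y i j =
      (1 / 2) * fderiv ℝ (fderiv ℝ (energy F e)) (u, y) (0, stdVec i) (0, stdVec j) := by
  rw [← pd_snd_pd_snd hL]
  rfl

theorem fundTensor_mulVec (hL : ContDiffAt ℝ 2 (energy F e) (u, y)) (ξ : Coord n) (i : Fin n) :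
    (fundTensor F e u y *ᵥ ξ) i =
      (1 / 2) * fderiv ℝ (fderiv ℝ (energy F e)) (u, y) (0, ξ) (0, stdVec i) := by
  have hs : IsSymmSndFDerivAt ℝ (energy F e) (u, y) := hL.isSymmSndFDerivAt (by simp)
  rw [← hs.eq (0, stdVec i) (0, ξ)]
  have : ((0 : Coord n), ξ) = ∑ j, ξ j • ((0 : Coord n), (stdVec j : Coord n)) := by
    conv_lhs => rw [← sum_smul_stdVec ξ]
    ext1
    · simp [Prod.fst_sum]
    · simp [Prod.snd_sum]
  change ∑ j, fundTensor F e u y i j * ξ j = _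
  rw [this, map_sum, Finset.mul_sum]
  refine Finset.sum_congr rfl fun j _ => ?_
  rw [fundTensor_apply hL, map_smul, smul_eq_mul]
  ring

theorem eulerLagrange_stdVec (hL : ContDiffAt ℝ 2 (energy F e) (u, y)) (ξ : Coord n)
    (l : Fin n) :
    eulerLagrange (energy F e) u y ξ (stdVec l) =
      2 * (fundTensor F e u y *ᵥ ξ) l +
      ((∑ k, pd k (fun v => pd l (fun w => inChart F e v w ^ 2) y) u * y k)
        - pd l (fun v => inChart F e v y ^ 2) u) := by
  have h1 : ∀ k, pd k (fun v => pd l (fun w => inChart F e v w ^ 2) y) u =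
      fderiv ℝ (fderiv ℝ (energy F e)) (u, y) (stdVec k, 0) (0, stdVec l) :=
    fun k => pd_fst_pd_snd hL k l
  have h2 : pd l (fun v => inChart F e v y ^ 2) u =
      fderiv ℝ (energy F e) (u, y) (stdVec l, 0) :=
    pd_fst (L := energy F e) (hL.differentiableAt (by simp)) l
  have h3 : (y, ξ) = (∑ k, y k • ((stdVec k : Coord n), (0 : Coord n))) + (0, ξ) := by
    conv_lhs => rw [← sum_smul_stdVec y]
    ext1
    · simp [Prod.fst_sum]
    · simp [Prod.snd_sum]
  rw [fundTensor_mulVec hL, h2]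
  simp only [h1]
  unfold eulerLagrange
  rw [h3, map_add, map_sum, _root_.add_apply, _root_.sum_apply]
  simp only [map_smul, _root_.smul_apply, smul_eq_mul]
  rw [Finset.sum_congr rfl fun k _ => mul_comm _ (y k)]
  ring

theorem spray_eq_mulVec (F : ∀ x : M, TangentSpace (𝓡 n) x → ℝ)
    (e : OpenPartialHomeomorph M (Coord n)) (u y : Coord n) :
    spray F e u y = (1 / 4 : ℝ) • ((fundTensor F e u y)⁻¹ *ᵥ fun l =>
      ((∑ k, pd k (fun v => pd l (fun w => inChart F e v w ^ 2) y) u * y k)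
        - pd l (fun v => inChart F e v y ^ 2) u)) :=
  rfl

theorem eulerLagrange_eq_sum (L : Coord n × Coord n → ℝ) (u y ξ z : Coord n) :
    eulerLagrange L u y ξ z = ∑ l, z l * eulerLagrange L u y ξ (stdVec l) := by
  have h1 : ((0 : Coord n), z) = ∑ j, z j • ((0 : Coord n), (stdVec j : Coord n)) := by
    conv_lhs => rw [← sum_smul_stdVec z]
    ext1
    · simp [Prod.fst_sum]
    · simp [Prod.snd_sum]
  have h2 : (z, (0 : Coord n)) = ∑ j, z j • ((stdVec j : Coord n), (0 : Coord n)) := by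
    conv_lhs => rw [← sum_smul_stdVec z]
    ext1
    · simp [Prod.fst_sum]
    · simp [Prod.snd_sum]
  unfold eulerLagrange
  rw [h1, h2, map_sum, map_sum, ← Finset.sum_sub_distrib]
  refine Finset.sum_congr rfl fun l _ => ?_
  rw [map_smul, map_smul, smul_eq_mul, smul_eq_mul, mul_sub]

/-- The spray coefficients are characterised by the Euler–Lagrange equation of the energy. -/
theorem spray_eq_iff (hL : ContDiffAt ℝ 2 (energy F e) (u, y))
    (hg : IsUnit (fundTensor F e u y).det) (G : Coord n) :
    (∀ i, spray F e u y i = G i) ↔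
      ∀ z, eulerLagrange (energy F e) u y ((-2 : ℝ) • G) z = 0 := by
  set w : Fin n → ℝ := fun l =>
    ((∑ k, pd k (fun v => pd l (fun w => inChart F e v w ^ 2) y) u * y k)
        - pd l (fun v => inChart F e v y ^ 2) u) with hw
  have h0 : ∀ l, eulerLagrange (energy F e) u y ((-2 : ℝ) • G) (stdVec l) =
      -4 * (fundTensor F e u y *ᵥ G) l + w l := by
    intro l
    rw [eulerLagrange_stdVec hL, WithLp.ofLp_smul, Matrix.mulVec_smul, Pi.smul_apply, smul_eq_mul]
    ring
  constructor
  · intro h z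
    have h1 : spray F e u y = G.ofLp := funext h
    rw [spray_eq_mulVec] at h1
    rw [eulerLagrange_eq_sum]
    refine Finset.sum_eq_zero fun l _ => ?_
    rw [h0, ← h1, Matrix.mulVec_smul, Matrix.mulVec_mulVec, Matrix.mul_nonsing_inv _ hg,
      Matrix.one_mulVec, Pi.smul_apply, smul_eq_mul]
    ring
  · intro h i
    have h1 : w = (4 : ℝ) • (fundTensor F e u y *ᵥ G) := by
      ext l
      have := h0 l
      rw [h] at this
      rw [Pi.smul_apply, smul_eq_mul]
      linarith
    rw [spray_eq_mulVec, ← hw, h1, Matrix.mulVec_smul, Matrix.mulVec_mulVec,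
      Matrix.nonsing_inv_mul _ hg, Matrix.one_mulVec, smul_smul]
    norm_num

end SprayEquation
end FinslerProj

/-! ### Charts, tangent vectors and components -/

namespace FinslerProj
variable {n : ℕ} {M : Type*} [TopologicalSpace M] [ChartedSpace (EuclideanSpace ℝ (Fin n)) M]
  [IsManifold (𝓡 n) ∞ M]

section ChartSmoothness

/-- The coordinate vector field is the image of a constant field under the tangent map of `e.symm`.
Smoothness of the components of metrics and 1-forms rests on this. -/
theorem contMDiffAt_tvec {e : OpenPartialHomeomorph M (Coord n)} (he : e ∈ charts n M)
    {u : Coord n} (hu : u ∈ e.target) (y : Coord n) :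
    ContMDiffAt (𝓡 n) (𝓡 n).tangent ∞
      (fun v => (⟨e.symm v, tvec e v y⟩ : TangentBundle (𝓡 n) M)) u := by
  have h1 := contMDiffOn_symm_of_mem_maximalAtlas he
  have h2 := h1.contMDiffOn_tangentMapWithin (m := ∞) (by simp) e.open_target.uniqueMDiffOn
  have h3 : ContMDiffAt (𝓡 n) (𝓡 n).tangent ∞
      (fun v : Coord n => (⟨v, y⟩ : TangentBundle (𝓡 n) (Coord n))) u :=
    (contMDiffAt_vectorSpace_iff_contDiffAt (V := fun _ : Coord n => y)).2 contDiffAt_const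
  have h4 := (h2.contMDiffAt (x := ⟨u, y⟩)
    ((e.open_target.preimage (FiberBundle.continuous_proj _ _)).mem_nhds hu)).comp u h3
  refine h4.congr_of_eventuallyEq ?_
  filter_upwards [e.open_target.mem_nhds hu] with v hv
  simp only [Function.comp, tangentMapWithin, tvec]
  rw [mfderivWithin_of_isOpen e.open_target hv]

end ChartSmoothness

/-! ### Coordinate frames and coordinate changes -/

section Frame

theorem mdifferentiableAt_symm {e : OpenPartialHomeomorph M (Coord n)} (he : e ∈ charts n M)
    {u : Coord n} (hu : u ∈ e.target) : MDifferentiableAt (𝓡 n) (𝓡 n) e.symm u :=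
  (contMDiffAt_symm_of_mem_maximalAtlas he hu).mdifferentiableAt (by simp)

theorem tvec_smul (e : OpenPartialHomeomorph M (Coord n)) (u : Coord n) (c : ℝ) (y : Coord n) :
    tvec e u (c • y) = c • tvec e u y :=
  map_smul (mfderiv (𝓡 n) (𝓡 n) e.symm u) c y

theorem tvec_zero (e : OpenPartialHomeomorph M (Coord n)) (u : Coord n) :
    tvec e u 0 = 0 :=
  map_zero (mfderiv (𝓡 n) (𝓡 n) e.symm u)

theorem tvec_sum (e : OpenPartialHomeomorph M (Coord n)) (u : Coord n) {ι : Type*}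
    (s : Finset ι) (f : ι → Coord n) :
    tvec e u (∑ i ∈ s, f i) = ∑ i ∈ s, tvec e u (f i) :=
  map_sum (mfderiv (𝓡 n) (𝓡 n) e.symm u) f s

theorem tvec_eq_sum (e : OpenPartialHomeomorph M (Coord n)) (u y : Coord n) :
    tvec e u y = ∑ i, y i • tvec e u (stdVec i) := by
  conv_lhs => rw [← sum_smul_stdVec y]
  simp only [tvec_sum, tvec_smul]

/-- The coordinate change from the chart `e` to the chart `e₀`. -/
def transition (e e₀ : OpenPartialHomeomorph M (Coord n)) (v : Coord n) : Coord n :=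
  e₀ (e.symm v)

variable {e e₀ : OpenPartialHomeomorph M (Coord n)}

theorem contDiffAt_transition (he : e ∈ charts n M) (he₀ : e₀ ∈ charts n M) {u : Coord n}
    (hu : u ∈ e.target) (hu₀ : e.symm u ∈ e₀.source) : ContDiffAt ℝ ∞ (transition e e₀) u := by
  rw [← contMDiffAt_iff_contDiffAt]
  exact (contMDiffAt_of_mem_maximalAtlas he₀ hu₀).comp u
    (contMDiffAt_symm_of_mem_maximalAtlas he hu)

theorem eventually_transition (hu : u ∈ e.target) (hu₀ : e.symm u ∈ e₀.source) :
    ∀ᶠ v in nhds u, v ∈ e.target ∧ e.symm v ∈ e₀.source := by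
  filter_upwards [e.open_target.mem_nhds hu,
    (e.symm.continuousAt hu).preimage_mem_nhds (e₀.open_source.mem_nhds hu₀)] with v h1 h2
  exact ⟨h1, h2⟩

theorem symm_transition {v : Coord n} (hv : e.symm v ∈ e₀.source) :
    e₀.symm (transition e e₀ v) = e.symm v :=
  e₀.left_inv hv

theorem transition_mem {v : Coord n} (hv : e.symm v ∈ e₀.source) :
    transition e e₀ v ∈ e₀.target :=
  e₀.map_source hv

theorem tvec_transition (he : e ∈ charts n M) (he₀ : e₀ ∈ charts n M) {u : Coord n}
    (hu : u ∈ e.target) (hu₀ : e.symm u ∈ e₀.source) (y : Coord n) :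
    (tvec e u y : Coord n) =
      tvec e₀ (transition e e₀ u) (fderiv ℝ (transition e e₀) u y) := by
  have h1 : e.symm =ᶠ[nhds u] e₀.symm ∘ transition e e₀ := by
    filter_upwards [eventually_transition hu hu₀] with v hv
    exact (symm_transition hv.2).symm
  have h2 := h1.mfderiv_eq (I := 𝓡 n) (I' := 𝓡 n)
  have h3 : MDifferentiableAt (𝓡 n) (𝓡 n) (transition e e₀) u :=
    ((contDiffAt_transition he he₀ hu hu₀).differentiableAt (by simp)).mdifferentiableAt
  have h4 := mfderiv_comp u (mdifferentiableAt_symm he₀ (transition_mem hu₀)) h3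
  rw [mfderiv_eq_fderiv] at h4
  exact (congrArg (fun A : Coord n →L[ℝ] Coord n => A y) h2).trans
    (congrArg (fun A : Coord n →L[ℝ] Coord n => A y) h4)

theorem apply_transition {γ : Type*} (F : ∀ x : M, TangentSpace (𝓡 n) x → γ)
    (he : e ∈ charts n M) (he₀ : e₀ ∈ charts n M) {u : Coord n}
    (hu : u ∈ e.target) (hu₀ : e.symm u ∈ e₀.source) (y : Coord n) :
    F (e.symm u) (tvec e u y) = F (e₀.symm (transition e e₀ u))
      (tvec e₀ (transition e e₀ u) (fderiv ℝ (transition e e₀) u y)) := by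
  -- The two vectors lie in tangent spaces over points that are only propositionally equal. Since
  -- both spaces unfold to `Coord n`, base points and vectors are generalised and the equalities
  -- eliminated.
  have key : ∀ (x x' : M) (v v' : Coord n), x = x' → v = v' → F x v = F x' v' := by
    rintro x _ v _ rfl rfl
    rfl
  exact key _ _ _ _ (symm_transition hu₀).symm (tvec_transition he he₀ hu hu₀ y)

theorem tvec_injective (he : e ∈ charts n M) {u : Coord n} (hu : u ∈ e.target) :
    Function.Injective (tvec e u) := by
  have h0 : e.symm u ∈ e.source := e.map_target hu
  have h1 : MDifferentiableAt (𝓡 n) (𝓡 n) e (e.symm u) :=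
    (contMDiffAt_of_mem_maximalAtlas he h0).mdifferentiableAt (by simp)
  have h2 := mfderiv_comp u h1 (mdifferentiableAt_symm he hu)
  have h3 : e ∘ e.symm =ᶠ[nhds u] id := by
    filter_upwards [e.open_target.mem_nhds hu] with v hv
    exact e.right_inv hv
  rw [h3.mfderiv_eq, mfderiv_id] at h2
  intro y z hyz
  have h4 := congrArg (fun A : Coord n →L[ℝ] Coord n => A y) h2
  have h5 := congrArg (fun A : Coord n →L[ℝ] Coord n => A z) h2
  have h6 : (mfderiv (𝓡 n) (𝓡 n) e (e.symm u)) (tvec e u y) =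
    (mfderiv (𝓡 n) (𝓡 n) e (e.symm u)) (tvec e u z) := by rw [hyz]
  exact h4.trans (h6.trans h5.symm)

theorem tvec_surjective (he : e ∈ charts n M) {u : Coord n} (hu : u ∈ e.target)
    (v : TangentSpace (𝓡 n) (e.symm u)) : ∃ y, tvec e u y = v := by
  have h := tvec_injective he hu
  exact LinearMap.surjective_of_injective
    (f := (show Coord n →L[ℝ] Coord n from mfderiv (𝓡 n) (𝓡 n) e.symm u).toLinearMap) h v

theorem tvec_eq_zero_iff (he : e ∈ charts n M) {u : Coord n} (hu : u ∈ e.target) {y : Coord n} :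
    tvec e u y = 0 ↔ y = 0 :=
  ⟨fun h => tvec_injective he hu (h.trans (tvec_zero e u).symm), fun h => h ▸ tvec_zero e u⟩

end Frame

/-! ### Components of metrics and 1-forms -/

section Components

variable (a : RiemMetric n M) (β : OneForm n M) {e : OpenPartialHomeomorph M (Coord n)}

theorem contDiffAt_bComp (he : e ∈ charts n M) {u : Coord n} (hu : u ∈ e.target) (i : Fin n) :
    ContDiffAt ℝ ∞ (fun v => bComp β e v i) u := by
  rw [← contMDiffAt_iff_contDiffAt]
  have hs : ContMDiffAt (𝓡 n) (𝓡 n) ∞ e.symm u :=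
    contMDiffAt_symm_of_mem_maximalAtlas he hu
  have : ContMDiffAt (𝓡 n) ((𝓡 n).prod 𝓘(ℝ)) ∞
      (fun m ↦ Bundle.TotalSpace.mk' ℝ (E := Bundle.Trivial M ℝ) (e.symm m)
        (β (e.symm m) (tvec e m (stdVec i)))) u := by
    apply ContMDiffAt.clm_bundle_apply (F₁ := Coord n)
    · exact (β.contMDiff (e.symm u)).comp u hs
    · exact contMDiffAt_tvec he hu (stdVec i)
  rw [Bundle.contMDiffAt_totalSpace] at this
  exact this.2

theorem contDiffAt_aComp (he : e ∈ charts n M) {u : Coord n} (hu : u ∈ e.target)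
    (i j : Fin n) : ContDiffAt ℝ ∞ (fun v => aComp a e v i j) u := by
  rw [← contMDiffAt_iff_contDiffAt]
  have hs : ContMDiffAt (𝓡 n) (𝓡 n) ∞ e.symm u :=
    contMDiffAt_symm_of_mem_maximalAtlas he hu
  have : ContMDiffAt (𝓡 n) ((𝓡 n).prod 𝓘(ℝ)) ∞
      (fun m ↦ Bundle.TotalSpace.mk' ℝ (E := Bundle.Trivial M ℝ) (e.symm m)
        (a.inner (e.symm m) (tvec e m (stdVec i)) (tvec e m (stdVec j)))) u := by
    apply ContMDiffAt.clm_bundle_apply₂ (F₁ := Coord n) (F₂ := Coord n)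
    · exact (a.contMDiff (e.symm u)).comp u hs
    · exact contMDiffAt_tvec he hu (stdVec i)
    · exact contMDiffAt_tvec he hu (stdVec j)
  rw [Bundle.contMDiffAt_totalSpace] at this
  exact this.2

theorem form_tvec (e : OpenPartialHomeomorph M (Coord n)) (u y : Coord n) :
    β (e.symm u) (tvec e u y) = ∑ i, bComp β e u i * y i := by
  conv_lhs => rw [tvec_eq_sum, map_sum]
  exact Finset.sum_congr rfl fun i _ => by rw [map_smul, smul_eq_mul, mul_comm, bComp]

theorem inner_tvec (e : OpenPartialHomeomorph M (Coord n)) (u y z : Coord n) :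
    a.inner (e.symm u) (tvec e u y) (tvec e u z) = ∑ i, ∑ j, aComp a e u i j * y i * z j := by
  conv_lhs => rw [tvec_eq_sum e u y, map_sum, sum_apply]
  refine Finset.sum_congr rfl fun i _ => ?_
  rw [map_smul, smul_apply, smul_eq_mul, tvec_eq_sum e u z, map_sum,
    Finset.mul_sum]
  refine Finset.sum_congr rfl fun j _ => ?_
  rw [map_smul, smul_eq_mul, aComp, Matrix.of_apply]
  ring

theorem aComp_symm (e : OpenPartialHomeomorph M (Coord n)) (u : Coord n) (i j : Fin n) :
    aComp a e u i j = aComp a e u j i :=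
  a.symm _ _ _

theorem aComp_posDef (he : e ∈ charts n M) {u : Coord n} (hu : u ∈ e.target) :
    (aComp a e u).PosDef := by
  refine Matrix.PosDef.of_dotProduct_mulVec_pos (Matrix.ext fun i j => aComp_symm a e u j i)
    fun x hx => ?_
  have h := a.pos (e.symm u) (tvec e u (WithLp.toLp 2 x)) (by
    rw [Ne, tvec_eq_zero_iff he hu]
    intro h
    exact hx (congrArg WithLp.ofLp h))
  rw [inner_tvec] at h
  simpa [dotProduct, Matrix.mulVec, Finset.mul_sum, mul_comm, mul_assoc, mul_left_comm] using h

end Components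

end FinslerProj

/-! ### Bilinear and linear forms in coordinates -/

namespace FinslerProj
variable {n : ℕ} {M : Type*} [TopologicalSpace M] [ChartedSpace (EuclideanSpace ℝ (Fin n)) M]
  [IsManifold (𝓡 n) ∞ M]

section CoordinateForms

variable (a : RiemMetric n M) (β : OneForm n M) (e : OpenPartialHomeomorph M (Coord n))
  (u : Coord n)

/-- The inner product in coordinates. -/
def gForm (y z : Coord n) : ℝ := ∑ i, ∑ j, aComp a e u i j * y i * z j

/-- The derivative of the inner product in the direction `w`. -/
def gForm' (w y z : Coord n) : ℝ :=
  ∑ i, ∑ j, fderiv ℝ (fun v => aComp a e v i j) u w * y i * z j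

/-- The 1-form in coordinates. -/
def bForm (y : Coord n) : ℝ := ∑ i, bComp β e u i * y i

/-- The derivative of the 1-form in the direction `w`. -/
def bForm' (w y : Coord n) : ℝ := ∑ i, fderiv ℝ (fun v => bComp β e v i) u w * y i

theorem inChart_form (y : Coord n) : inChart (fun x => β x) e u y = bForm β e u y :=
  form_tvec β e u y

theorem gForm_eq (y z : Coord n) :
    gForm a e u y z = a.inner (e.symm u) (tvec e u y) (tvec e u z) :=
  (inner_tvec a e u y z).symm

theorem inChart_rnorm (y : Coord n) : inChart (rnorm a) e u y = √(gForm a e u y y) := by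
  rw [gForm_eq]
  rfl

theorem gForm_comm (y z : Coord n) : gForm a e u y z = gForm a e u z y := by
  rw [gForm_eq, gForm_eq]
  exact a.symm _ _ _

theorem gForm_add_left (y y' z : Coord n) :
    gForm a e u (y + y') z = gForm a e u y z + gForm a e u y' z := by
  simp only [gForm, PiLp.add_apply, mul_add, add_mul, Finset.sum_add_distrib]

theorem gForm_smul_left (c : ℝ) (y z : Coord n) :
    gForm a e u (c • y) z = c * gForm a e u y z := by
  simp only [gForm, PiLp.smul_apply, smul_eq_mul, Finset.mul_sum]
  exact Finset.sum_congr rfl fun i _ => Finset.sum_congr rfl fun j _ => by ring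

theorem gForm_add_right (y z z' : Coord n) :
    gForm a e u y (z + z') = gForm a e u y z + gForm a e u y z' := by
  rw [gForm_comm, gForm_add_left, gForm_comm a e u z, gForm_comm a e u z']

theorem gForm_smul_right (c : ℝ) (y z : Coord n) :
    gForm a e u y (c • z) = c * gForm a e u y z := by
  rw [gForm_comm, gForm_smul_left, gForm_comm]

theorem bForm_add (y z : Coord n) : bForm β e u (y + z) = bForm β e u y + bForm β e u z := by
  simp only [bForm, PiLp.add_apply, mul_add, Finset.sum_add_distrib]

theorem bForm_smul (c : ℝ) (y : Coord n) : bForm β e u (c • y) = c * bForm β e u y := by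
  simp only [bForm, PiLp.smul_apply, smul_eq_mul, Finset.mul_sum]
  exact Finset.sum_congr rfl fun i _ => by ring

variable {e u}

theorem gForm_pos (he : e ∈ charts n M) (hu : u ∈ e.target) {y : Coord n} (hy : y ≠ 0) :
    0 < gForm a e u y y := by
  rw [gForm_eq]
  exact a.pos _ _ fun h => hy ((tvec_eq_zero_iff he hu).1 h)

theorem hasFDerivAt_coord (p : Coord n × Coord n) (k : Fin n) :
    HasFDerivAt (fun p : Coord n × Coord n => p.2 k)
      ((EuclideanSpace.proj k : Coord n →L[ℝ] ℝ).comp (ContinuousLinearMap.snd ℝ _ _)) p := by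
  have h := ((EuclideanSpace.proj k : Coord n →L[ℝ] ℝ).comp
    (ContinuousLinearMap.snd ℝ (Coord n) (Coord n))).hasFDerivAt (x := p)
  exact h

theorem hasFDerivAt_coeff_quadratic {c : Coord n → ℝ} {v y : Coord n}
    (hc : DifferentiableAt ℝ c v) (i j : Fin n) :
    ∃ T : Coord n × Coord n →L[ℝ] ℝ,
      HasFDerivAt (fun p : Coord n × Coord n => c p.1 * p.2 i * p.2 j) T (v, y) ∧
      ∀ w z, T (w, z) = fderiv ℝ c v w * y i * y j + c v * z i * y j + c v * y i * z j := by
  have h1 : HasFDerivAt (fun p : Coord n × Coord n => c p.1)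
      ((fderiv ℝ c v).comp (ContinuousLinearMap.fst ℝ _ _)) (v, y) :=
    HasFDerivAt.comp (g := c) (v, y) hc.hasFDerivAt hasFDerivAt_fst
  have h2 := fun k : Fin n => hasFDerivAt_coord (v, y) k
  refine ⟨_, (h1.mul (h2 i)).mul (h2 j), fun w z => ?_⟩
  simp
  ring

theorem hasFDerivAt_coeff_linear {c : Coord n → ℝ} {v y : Coord n}
    (hc : DifferentiableAt ℝ c v) (i : Fin n) :
    ∃ T : Coord n × Coord n →L[ℝ] ℝ,
      HasFDerivAt (fun p : Coord n × Coord n => c p.1 * p.2 i) T (v, y) ∧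
      ∀ w z, T (w, z) = fderiv ℝ c v w * y i + c v * z i := by
  have h1 : HasFDerivAt (fun p : Coord n × Coord n => c p.1)
      ((fderiv ℝ c v).comp (ContinuousLinearMap.fst ℝ _ _)) (v, y) :=
    HasFDerivAt.comp (g := c) (v, y) hc.hasFDerivAt hasFDerivAt_fst
  have h2 := fun k : Fin n => hasFDerivAt_coord (v, y) k
  refine ⟨_, h1.mul (h2 i), fun w z => ?_⟩
  simp
  ring

theorem differentiableAt_aComp (he : e ∈ charts n M) {v : Coord n} (hv : v ∈ e.target)
    (i j : Fin n) : DifferentiableAt ℝ (fun v => aComp a e v i j) v :=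
  (contDiffAt_aComp a he hv i j).differentiableAt (by simp)

theorem differentiableAt_bComp (he : e ∈ charts n M) {v : Coord n} (hv : v ∈ e.target)
    (i : Fin n) : DifferentiableAt ℝ (fun v => bComp β e v i) v :=
  (contDiffAt_bComp β he hv i).differentiableAt (by simp)

/-- `α²` as a function of `(x, y)`. -/
def quadEnergy (a : RiemMetric n M) (e : OpenPartialHomeomorph M (Coord n))
    (p : Coord n × Coord n) : ℝ := gForm a e p.1 p.2 p.2

/-- `β` as a function of `(x, y)`. -/
def linEnergy (β : OneForm n M) (e : OpenPartialHomeomorph M (Coord n))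
    (p : Coord n × Coord n) : ℝ := bForm β e p.1 p.2

theorem contDiffAt_coord (p : Coord n × Coord n) (i : Fin n) :
    ContDiffAt ℝ ∞ (fun p : Coord n × Coord n => p.2 i) p :=
  ((EuclideanSpace.proj i : Coord n →L[ℝ] ℝ).comp
    (ContinuousLinearMap.snd ℝ (Coord n) (Coord n))).contDiff.contDiffAt

theorem contDiffAt_quadEnergy (he : e ∈ charts n M) (hu : u ∈ e.target) (y : Coord n) :
    ContDiffAt ℝ ∞ (quadEnergy a e) (u, y) := by
  change ContDiffAt ℝ ∞ (fun p : Coord n × Coord n =>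
    ∑ i, ∑ j, aComp a e p.1 i j * p.2 i * p.2 j) (u, y)
  refine ContDiffAt.sum fun i _ => ContDiffAt.sum fun j _ => ?_
  exact ((ContDiffAt.comp (g := fun v => aComp a e v i j) (u, y) (contDiffAt_aComp a he hu i j) contDiffAt_fst).mul
    (contDiffAt_coord _ i)).mul (contDiffAt_coord _ j)

theorem contDiffAt_linEnergy (he : e ∈ charts n M) (hu : u ∈ e.target) (y : Coord n) :
    ContDiffAt ℝ ∞ (linEnergy β e) (u, y) := by
  change ContDiffAt ℝ ∞ (fun p : Coord n × Coord n => ∑ i, bComp β e p.1 i * p.2 i) (u, y)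
  refine ContDiffAt.sum fun i _ => ?_
  exact (ContDiffAt.comp (g := fun v => bComp β e v i) (u, y) (contDiffAt_bComp β he hu i) contDiffAt_fst).mul
    (contDiffAt_coord _ i)

theorem fderiv_quadEnergy (he : e ∈ charts n M) (hu : u ∈ e.target) (y w z : Coord n) :
    fderiv ℝ (quadEnergy a e) (u, y) (w, z) = gForm' a e u w y y + 2 * gForm a e u y z := by
  choose T hT hT' using fun i j =>
    hasFDerivAt_coeff_quadratic (y := y) (differentiableAt_aComp a he hu i j) i j
  have h : HasFDerivAt (fun p : Coord n × Coord n =>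
      ∑ i, ∑ j, aComp a e p.1 i j * p.2 i * p.2 j) (∑ i, ∑ j, T i j) (u, y) :=
    HasFDerivAt.fun_sum fun i _ => HasFDerivAt.fun_sum fun j _ => hT i j
  change fderiv ℝ (fun p : Coord n × Coord n =>
      ∑ i, ∑ j, aComp a e p.1 i j * p.2 i * p.2 j) (u, y) (w, z) = _
  rw [h.fderiv, two_mul]
  conv_rhs => rw [gForm_comm a e u y z]
  conv_rhs => enter [2, 2]; rw [gForm_comm]
  simp only [sum_apply, hT', Finset.sum_add_distrib, gForm, gForm']
  ring

theorem fderiv_linEnergy (he : e ∈ charts n M) (hu : u ∈ e.target) (y w z : Coord n) :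
    fderiv ℝ (linEnergy β e) (u, y) (w, z) = bForm' β e u w y + bForm β e u z := by
  choose T hT hT' using fun i =>
    hasFDerivAt_coeff_linear (y := y) (differentiableAt_bComp β he hu i) i
  have h : HasFDerivAt (fun p : Coord n × Coord n =>
      ∑ i, bComp β e p.1 i * p.2 i) (∑ i, T i) (u, y) :=
    HasFDerivAt.fun_sum fun i _ => hT i
  change fderiv ℝ (fun p : Coord n × Coord n => ∑ i, bComp β e p.1 i * p.2 i) (u, y) (w, z) = _
  rw [h.fderiv]
  simp only [sum_apply, hT', Finset.sum_add_distrib, bForm, bForm']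

theorem eventually_fst_mem (hu : u ∈ e.target) (y : Coord n) :
    ∀ᶠ p : Coord n × Coord n in nhds (u, y), p.1 ∈ e.target :=
  (continuous_fst.tendsto (u, y)).eventually (e.open_target.mem_nhds hu)

theorem snd_fderiv_quadEnergy (he : e ∈ charts n M) (hu : u ∈ e.target) (y w v z : Coord n) :
    fderiv ℝ (fderiv ℝ (quadEnergy a e)) (u, y) (w, v) (0, z) =
      2 * gForm' a e u w y z + 2 * gForm a e u v z := by
  rw [fderiv_fderiv_apply (contDiffAt_two_of_infty (contDiffAt_quadEnergy a he hu y))]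
  have h0 : (fun p => fderiv ℝ (quadEnergy a e) p (0, z)) =ᶠ[nhds (u, y)]
      fun p => ∑ i, (2 * ∑ j, aComp a e p.1 i j * z j) * p.2 i := by
    filter_upwards [eventually_fst_mem hu y] with p hp
    rw [show p = (p.1, p.2) from rfl, fderiv_quadEnergy a he hp]
    simp only [gForm, gForm', map_zero, zero_mul, Finset.sum_const_zero, zero_add,
      Finset.mul_sum, Finset.sum_mul]
    exact Finset.sum_congr rfl fun i _ => Finset.sum_congr rfl fun j _ => by ring
  have hc : ∀ i, HasFDerivAt (fun v => 2 * ∑ j, aComp a e v i j * z j)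
      ((2 : ℝ) • ∑ j, z j • fderiv ℝ (fun v => aComp a e v i j) u) u := fun i =>
    (HasFDerivAt.fun_sum fun j _ =>
      (differentiableAt_aComp a he hu i j).hasFDerivAt.mul_const (z j)).const_mul 2
  choose T hT hT' using fun i =>
    hasFDerivAt_coeff_linear (y := y) (hc i).differentiableAt i
  have h : HasFDerivAt (fun p : Coord n × Coord n =>
      ∑ i, (2 * ∑ j, aComp a e p.1 i j * z j) * p.2 i) (∑ i, T i) (u, y) :=
    HasFDerivAt.fun_sum fun i _ => hT i
  rw [h0.fderiv_eq, h.fderiv]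
  simp only [sum_apply, hT', Finset.sum_add_distrib, (hc _).fderiv]
  simp only [gForm, gForm', Finset.mul_sum, Finset.sum_mul, smul_apply, sum_apply, smul_eq_mul]
  congr 1 <;>
  exact Finset.sum_congr rfl fun i _ => Finset.sum_congr rfl fun j _ => by ring

theorem snd_fderiv_linEnergy (he : e ∈ charts n M) (hu : u ∈ e.target) (y w v z : Coord n) :
    fderiv ℝ (fderiv ℝ (linEnergy β e)) (u, y) (w, v) (0, z) = bForm' β e u w z := by
  rw [fderiv_fderiv_apply (contDiffAt_two_of_infty (contDiffAt_linEnergy β he hu y))]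
  have h0 : (fun p => fderiv ℝ (linEnergy β e) p (0, z)) =ᶠ[nhds (u, y)]
      fun p => ∑ i, bComp β e p.1 i * z i := by
    filter_upwards [eventually_fst_mem hu y] with p hp
    rw [show p = (p.1, p.2) from rfl, fderiv_linEnergy β he hp]
    simp only [bForm, bForm', map_zero, zero_mul, Finset.sum_const_zero, zero_add]
  have h1 : ∀ i, HasFDerivAt (fun p : Coord n × Coord n => bComp β e p.1 i)
      ((fderiv ℝ (fun v => bComp β e v i) u).comp (ContinuousLinearMap.fst ℝ _ _)) (u, y) :=
    fun i => HasFDerivAt.comp (g := fun v => bComp β e v i) (u, y)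
      (differentiableAt_bComp β he hu i).hasFDerivAt hasFDerivAt_fst
  have h : HasFDerivAt (fun p : Coord n × Coord n => ∑ i, bComp β e p.1 i * z i) _ (u, y) :=
    HasFDerivAt.fun_sum fun i _ => (h1 i).mul_const (z i)
  rw [h0.fderiv_eq, h.fderiv]
  simp only [sum_apply, bForm', smul_apply, smul_eq_mul, ContinuousLinearMap.comp_apply,
    ContinuousLinearMap.coe_fst']
  exact Finset.sum_congr rfl fun i _ => by ring

end CoordinateForms

end FinslerProj

/-! ### The Levi-Civita connection and the covariant derivative of a 1-form -/

namespace FinslerProj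
variable {n : ℕ} {M : Type*} [TopologicalSpace M] [ChartedSpace (EuclideanSpace ℝ (Fin n)) M]
  [IsManifold (𝓡 n) ∞ M]

section Connection

variable (a : RiemMetric n M) (β : OneForm n M) (e : OpenPartialHomeomorph M (Coord n))
  (u : Coord n)

/-- The vector `Γⁱ_jk yʲ zᵏ`. -/
def christoffelVec (y z : Coord n) : Coord n :=
  WithLp.toLp 2 fun k => ∑ i, ∑ j, christoffel a e u k i j * y i * z j

/-- The bilinear form `b_{i|j} yⁱ zʲ`. -/
def covForm (y z : Coord n) : ℝ := ∑ i, ∑ j, covDeriv a β e u i j * y i * z j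

/-- The bilinear form `r_ij yⁱ zʲ`. -/
def rForm (y z : Coord n) : ℝ := ∑ i, ∑ j, rTen a β e u i j * y i * z j

/-- The bilinear form `s_ij yⁱ zʲ`. -/
def sForm (y z : Coord n) : ℝ := ∑ i, ∑ j, sTen a β e u i j * y i * z j

/-- The vector `bⁱ`. -/
def bVec : Coord n := WithLp.toLp 2 (bUp a β e u)

/-- The vector `sⁱ`. -/
def sVec : Coord n := WithLp.toLp 2 (sUp a β e u)

/-- The vector `sⁱ_j yʲ`. -/
def sMap (y : Coord n) : Coord n :=
  WithLp.toLp 2 ((aComp a e u)⁻¹ *ᵥ fun i => ∑ j, sTen a β e u i j * y j)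

/-- The spray coefficients as a vector. -/
def sprayVec (F : ∀ x : M, TangentSpace (𝓡 n) x → ℝ) (e : OpenPartialHomeomorph M (Coord n))
    (u y : Coord n) : Coord n := WithLp.toLp 2 (spray F e u y)

variable {e u}

theorem isUnit_det_aComp (he : e ∈ charts n M) (hu : u ∈ e.target) :
    IsUnit (aComp a e u).det :=
  (aComp_posDef a he hu).det_pos.ne'.isUnit

theorem gForm_toLp_inv_mulVec (he : e ∈ charts n M) (hu : u ∈ e.target) (w : Fin n → ℝ)
    (z : Coord n) : gForm a e u (WithLp.toLp 2 ((aComp a e u)⁻¹ *ᵥ w)) z = ∑ i, w i * z i := by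
  have h : ∀ i, ∑ j, aComp a e u i j * ((aComp a e u)⁻¹ *ᵥ w) j = w i := by
    intro i
    have : (aComp a e u *ᵥ ((aComp a e u)⁻¹ *ᵥ w)) i = w i := by
      rw [Matrix.mulVec_mulVec, Matrix.mul_nonsing_inv _ (isUnit_det_aComp a he hu),
        Matrix.one_mulVec]
    exact this
  rw [gForm_comm, gForm]
  refine Finset.sum_congr rfl fun i _ => ?_
  rw [← h i, Finset.sum_mul]
  exact Finset.sum_congr rfl fun j _ => by ring

theorem gForm_bVec (he : e ∈ charts n M) (hu : u ∈ e.target) (z : Coord n) :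
    gForm a e u (bVec a β e u) z = bForm β e u z :=
  gForm_toLp_inv_mulVec a he hu _ z

theorem bForm_bVec : bForm β e u (bVec a β e u) = bSq a β e u :=
  Finset.sum_congr rfl fun _ _ => mul_comm _ _

theorem gForm_sMap (he : e ∈ charts n M) (hu : u ∈ e.target) (y z : Coord n) :
    gForm a e u (sMap a β e u y) z = sForm a β e u z y := by
  rw [sMap, gForm_toLp_inv_mulVec a he hu, sForm]
  refine Finset.sum_congr rfl fun i _ => ?_
  rw [Finset.sum_mul]
  exact Finset.sum_congr rfl fun j _ => by ring

theorem gForm_sVec (he : e ∈ charts n M) (hu : u ∈ e.target) (z : Coord n) :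
    gForm a e u (sVec a β e u) z = sForm a β e u (bVec a β e u) z := by
  have := gForm_toLp_inv_mulVec a he hu (sDown a β e u) z
  refine this.trans ?_
  simp only [sDown, Finset.sum_mul, sForm]
  rw [Finset.sum_comm]
  exact Finset.sum_congr rfl fun i _ => Finset.sum_congr rfl fun j _ => by
    simp only [bVec]
    ring

theorem eq_of_gForm_eq (he : e ∈ charts n M) (hu : u ∈ e.target) {x y : Coord n}
    (h : ∀ z, gForm a e u x z = gForm a e u y z) : x = y := by
  by_contra hne
  have h1 := gForm_pos a he hu (sub_ne_zero.2 hne)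
  have h2 := h (x - y)
  rw [sub_eq_add_neg, ← neg_one_smul ℝ y] at h1 h2
  rw [gForm_add_left, gForm_smul_left, h2] at h1
  linarith

theorem christoffel_symm (i j k : Fin n) :
    christoffel a e u i j k = christoffel a e u i k j := by
  unfold christoffel
  congr 1
  refine Finset.sum_congr rfl fun l _ => ?_
  have : (fun v => aComp a e v j k) = fun v => aComp a e v k j :=
    funext fun v => aComp_symm a e v j k
  rw [this]
  ring

theorem fderiv_apply_eq_sum (f : Coord n → ℝ) (w : Coord n) :
    fderiv ℝ f u w = ∑ k, pd k f u * w k := by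
  conv_lhs => rw [← sum_smul_stdVec w, map_sum]
  exact Finset.sum_congr rfl fun k _ => by rw [map_smul, smul_eq_mul, mul_comm]; rfl

/-- The Koszul formula: lowering the index removes the inverse matrix from the Christoffel symbols.
-/
theorem gForm_christoffelVec (he : e ∈ charts n M) (hu : u ∈ e.target) (x y z : Coord n) :
    gForm a e u (christoffelVec a e u y z) x =
      (1 / 2) * (gForm' a e u y x z + gForm' a e u z x y - gForm' a e u x y z) := by
  have h0 : christoffelVec a e u y z = WithLp.toLp 2 ((aComp a e u)⁻¹ *ᵥ fun l =>
      ∑ i, ∑ j, (1 / 2) * (pd i (fun v => aComp a e v l j) u + pd j (fun v => aComp a e v l i) u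
      - pd l (fun v => aComp a e v i j) u) * y i * z j) := by
    unfold christoffelVec
    congr 1
    ext k
    simp only [christoffel, Matrix.mulVec, dotProduct, Finset.mul_sum, Finset.sum_mul]
    rw [Finset.sum_comm]
    conv_rhs => rw [Finset.sum_comm]
    rw [Finset.sum_comm]
    refine Finset.sum_congr rfl fun i _ => ?_
    rw [Finset.sum_comm]
    refine Finset.sum_congr rfl fun l _ => Finset.sum_congr rfl fun j _ => ?_
    ring
  rw [h0, gForm_toLp_inv_mulVec a he hu]
  have h1 : gForm' a e u y x z = ∑ l, ∑ i, ∑ j, pd i (fun v => aComp a e v l j) u *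
      y i * z j * x l := by
    simp only [gForm', fderiv_apply_eq_sum, Finset.sum_mul]
    refine Finset.sum_congr rfl fun l _ => ?_
    rw [Finset.sum_comm]
    exact Finset.sum_congr rfl fun i _ => Finset.sum_congr rfl fun j _ => by ring
  have h2 : gForm' a e u z x y = ∑ l, ∑ i, ∑ j, pd j (fun v => aComp a e v l i) u *
      y i * z j * x l := by
    simp only [gForm', fderiv_apply_eq_sum, Finset.sum_mul]
    refine Finset.sum_congr rfl fun l _ => ?_
    exact Finset.sum_congr rfl fun i _ => Finset.sum_congr rfl fun j _ => by ring
  have h3 : gForm' a e u x y z = ∑ l, ∑ i, ∑ j, pd l (fun v => aComp a e v i j) u *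
      y i * z j * x l := by
    simp only [gForm', fderiv_apply_eq_sum, Finset.sum_mul]
    rw [Finset.sum_comm]
    conv_rhs => rw [Finset.sum_comm]; enter [2, i]; rw [Finset.sum_comm]
    rw [Finset.sum_comm]
    exact Finset.sum_congr rfl fun l _ => Finset.sum_congr rfl fun i _ =>
      Finset.sum_congr rfl fun j _ => by ring
  rw [h1, h2, h3, ← Finset.sum_add_distrib, ← Finset.sum_sub_distrib, Finset.mul_sum]
  refine Finset.sum_congr rfl fun l _ => ?_
  rw [← Finset.sum_add_distrib, ← Finset.sum_sub_distrib, Finset.mul_sum, Finset.sum_mul]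
  refine Finset.sum_congr rfl fun i _ => ?_
  rw [← Finset.sum_add_distrib, ← Finset.sum_sub_distrib, Finset.mul_sum, Finset.sum_mul]
  exact Finset.sum_congr rfl fun j _ => by ring

theorem covForm_eq (y z : Coord n) : covForm a β e u y z =
    bForm' β e u z y - bForm β e u (christoffelVec a e u y z) := by
  simp only [covForm, covDeriv, bForm', bForm, christoffelVec, fderiv_apply_eq_sum, sub_mul,
    Finset.sum_sub_distrib, Finset.sum_mul, Finset.mul_sum]
  congr 1
  · exact Finset.sum_congr rfl fun i _ => Finset.sum_congr rfl fun j _ => by ring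
  · conv_rhs => rw [Finset.sum_comm]
    refine Finset.sum_congr rfl fun i _ => ?_
    conv_rhs => rw [Finset.sum_comm]
    exact Finset.sum_congr rfl fun j _ => Finset.sum_congr rfl fun k _ => by ring

theorem covForm_swap (y z : Coord n) : covForm a β e u z y =
    ∑ i, ∑ j, covDeriv a β e u j i * y i * z j := by
  rw [covForm, Finset.sum_comm]
  exact Finset.sum_congr rfl fun i _ => Finset.sum_congr rfl fun j _ => by ring

theorem rForm_eq (y z : Coord n) : rForm a β e u y z =
    (1 / 2) * (covForm a β e u y z + covForm a β e u z y) := by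
  rw [covForm_swap a β y z]
  simp only [covForm, rForm, rTen, ← Finset.sum_add_distrib, Finset.mul_sum]
  exact Finset.sum_congr rfl fun i _ => Finset.sum_congr rfl fun j _ => by ring

theorem sForm_eq (y z : Coord n) : sForm a β e u y z =
    (1 / 2) * (covForm a β e u y z - covForm a β e u z y) := by
  rw [covForm_swap a β y z]
  simp only [covForm, sForm, sTen, ← Finset.sum_sub_distrib, Finset.mul_sum]
  exact Finset.sum_congr rfl fun i _ => Finset.sum_congr rfl fun j _ => by ring

theorem christoffelVec_symm (y z : Coord n) :
    christoffelVec a e u y z = christoffelVec a e u z y := by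
  unfold christoffelVec
  congr 1
  ext k
  rw [Finset.sum_comm]
  exact Finset.sum_congr rfl fun i _ => Finset.sum_congr rfl fun j _ => by
    rw [christoffel_symm]
    ring

/-- The Christoffel terms cancel by symmetry: up to a factor, the skew part is the exterior
derivative of `β`. In this form it arises from the Euler–Lagrange expression. -/
theorem sForm_eq' (y z : Coord n) : sForm a β e u y z =
    (1 / 2) * (bForm' β e u z y - bForm' β e u y z) := by
  rw [sForm_eq, covForm_eq, covForm_eq, christoffelVec_symm a z y]
  ring

theorem rForm_comm (y z : Coord n) : rForm a β e u y z = rForm a β e u z y := by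
  rw [rForm_eq, rForm_eq, add_comm]

theorem sForm_neg_swap (y z : Coord n) : sForm a β e u y z = -sForm a β e u z y := by
  rw [sForm_eq, sForm_eq]
  ring

theorem r00_eq (y : Coord n) : r00 a β e u y = rForm a β e u y y := rfl

theorem energy_rnorm : energy (rnorm a) e = quadEnergy a e := by
  ext p
  have h : 0 ≤ gForm a e p.1 p.2 p.2 := by
    rw [gForm_eq]
    rcases eq_or_ne (tvec e p.1 p.2) 0 with h | h
    · rw [h, map_zero]
    · exact (a.pos _ _ h).le
  rw [energy, inChart_rnorm, Real.sq_sqrt h]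
  rfl

theorem gForm_stdVec (i j : Fin n) : gForm a e u (stdVec i) (stdVec j) = aComp a e u i j := by
  simp [gForm, stdVec]

theorem fundTensor_rnorm (he : e ∈ charts n M) (hu : u ∈ e.target) (y : Coord n) :
    fundTensor (rnorm a) e u y = aComp a e u := by
  ext i j
  rw [fundTensor_apply (by
    rw [energy_rnorm]; exact contDiffAt_two_of_infty (contDiffAt_quadEnergy a he hu y)),
    energy_rnorm, snd_fderiv_quadEnergy a he hu, gForm_stdVec]
  simp [gForm']

theorem eulerLagrange_quadEnergy (he : e ∈ charts n M) (hu : u ∈ e.target) (y ξ z : Coord n) :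
    eulerLagrange (quadEnergy a e) u y ξ z =
      2 * gForm' a e u y y z + 2 * gForm a e u ξ z - gForm' a e u z y y := by
  have h0 : gForm a e u y 0 = 0 := by simp [gForm]
  rw [eulerLagrange, snd_fderiv_quadEnergy a he hu, fderiv_quadEnergy a he hu, h0]
  ring

theorem sprayVec_rnorm (he : e ∈ charts n M) (hu : u ∈ e.target) (y : Coord n) :
    sprayVec (rnorm a) e u y = (1 / 2 : ℝ) • christoffelVec a e u y y := by
  have := (spray_eq_iff (F := rnorm a) (e := e) (u := u) (y := y) (by
    rw [energy_rnorm]; exact contDiffAt_two_of_infty (contDiffAt_quadEnergy a he hu y))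
    (by rw [fundTensor_rnorm a he hu]; exact isUnit_det_aComp a he hu)
    ((1 / 2 : ℝ) • christoffelVec a e u y y)).2 (fun z => by
      rw [energy_rnorm, eulerLagrange_quadEnergy a he hu, gForm_smul_left, gForm_smul_left,
        gForm_christoffelVec a he hu]
      have : gForm' a e u y z y = gForm' a e u y y z := by
        rw [gForm', gForm', Finset.sum_comm]
        refine Finset.sum_congr rfl fun i _ => Finset.sum_congr rfl fun j _ => ?_
        have : (fun v => aComp a e v j i) = fun v => aComp a e v i j :=
          funext fun v => aComp_symm a e v j i
        rw [this]
        ring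
      rw [this]
      ring)
  ext i
  exact this i

/-- The left side is the derivative of `β` along a geodesic of `α` with velocity `y`, whose
acceleration is `-2 G_α`. -/
theorem bForm'_sub_sprayVec (he : e ∈ charts n M) (hu : u ∈ e.target) (y : Coord n) :
    bForm' β e u y y - 2 * bForm β e u (sprayVec (rnorm a) e u y) = rForm a β e u y y := by
  rw [sprayVec_rnorm a he hu, rForm_eq, covForm_eq, bForm_smul]
  ring

end Connection
end FinslerProj

/-! ### Sprays of metrics depending on `α²` and `β` only -/

namespace FinslerProj
variable {n : ℕ} {M : Type*} [TopologicalSpace M] [ChartedSpace (EuclideanSpace ℝ (Fin n)) M]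
  [IsManifold (𝓡 n) ∞ M]

section AlphaBetaSpray

/-- `f` is a smooth function near `x` with the given first derivatives near `x` and the given
second derivatives at `x`. -/
structure IsTwoJet (f f₁ f₂ : ℝ × ℝ → ℝ) (f₁₁ f₁₂ f₂₂ : ℝ) (x : ℝ × ℝ) : Prop where
  smooth : ContDiffAt ℝ ∞ f x
  der : ∀ᶠ x in nhds x, HasFDerivAt f (f₁ x • ContinuousLinearMap.fst ℝ ℝ ℝ +
      f₂ x • ContinuousLinearMap.snd ℝ ℝ ℝ) x
  der₁ : HasFDerivAt f₁ (f₁₁ • ContinuousLinearMap.fst ℝ ℝ ℝ +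
      f₁₂ • ContinuousLinearMap.snd ℝ ℝ ℝ) x
  der₂ : HasFDerivAt f₂ (f₁₂ • ContinuousLinearMap.fst ℝ ℝ ℝ +
      f₂₂ • ContinuousLinearMap.snd ℝ ℝ ℝ) x

variable {a : RiemMetric n M} {β : OneForm n M} {e : OpenPartialHomeomorph M (Coord n)}
  {u y : Coord n} {F : ∀ x : M, TangentSpace (𝓡 n) x → ℝ}
  {f f₁ f₂ : ℝ × ℝ → ℝ} {f₁₁ f₁₂ f₂₂ : ℝ}

theorem IsTwoJet.contDiffAt_energy
    (hf : IsTwoJet f f₁ f₂ f₁₁ f₁₂ f₂₂ (gForm a e u y y, bForm β e u y))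
    (he : e ∈ charts n M) (hu : u ∈ e.target)
    (hE : energy F e = fun p => f (quadEnergy a e p, linEnergy β e p)) :
    ContDiffAt ℝ ∞ (energy F e) (u, y) := by
  rw [hE]
  exact ContDiffAt.comp (u, y) (g := f) (f := fun p => (quadEnergy a e p, linEnergy β e p))
    hf.smooth ((contDiffAt_quadEnergy a he hu y).prodMk (contDiffAt_linEnergy β he hu y))

theorem gForm_zero_right (y : Coord n) : gForm a e u y 0 = 0 := by simp [gForm]
theorem bForm_zero : bForm β e u 0 = 0 := by simp [bForm]
theorem gForm'_zero_left (y z : Coord n) : gForm' a e u 0 y z = 0 := by simp [gForm']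
theorem bForm'_zero_left (y : Coord n) : bForm' β e u 0 y = 0 := by simp [bForm']

theorem IsTwoJet.snd_fderiv_energy
    (hf : IsTwoJet f f₁ f₂ f₁₁ f₁₂ f₂₂ (gForm a e u y y, bForm β e u y))
    (he : e ∈ charts n M) (hu : u ∈ e.target)
    (hE : energy F e = fun p => f (quadEnergy a e p, linEnergy β e p)) (v z : Coord n) :
    fderiv ℝ (fderiv ℝ (energy F e)) (u, y) (0, v) (0, z) =
      2 * (f₁ (gForm a e u y y, bForm β e u y) * gForm a e u v z) +
      (f₁₁ * (2 * gForm a e u y v) + f₁₂ * bForm β e u v) * (2 * gForm a e u y z) +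
      (f₁₂ * (2 * gForm a e u y v) + f₂₂ * bForm β e u v) * bForm β e u z := by
  have hf' : IsTwoJet f f₁ f₂ f₁₁ f₁₂ f₂₂ (quadEnergy a e (u, y), linEnergy β e (u, y)) := hf
  have h := snd_fderiv_comp_prodMk (A := quadEnergy a e) (B := linEnergy β e) (p := (u, y))
    hf'.der hf'.der₁ hf'.der₂ (contDiffAt_two_of_infty (contDiffAt_quadEnergy a he hu y))
    (contDiffAt_two_of_infty (contDiffAt_linEnergy β he hu y)) (0, v) (0, z)
  rw [hE, h, snd_fderiv_quadEnergy a he hu, snd_fderiv_linEnergy β he hu, fderiv_quadEnergy a he hu,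
    fderiv_linEnergy β he hu, fderiv_quadEnergy a he hu, fderiv_linEnergy β he hu]
  simp only [gForm'_zero_left, bForm'_zero_left, quadEnergy, linEnergy]
  ring

theorem IsTwoJet.fundTensor_quadratic
    (hf : IsTwoJet f f₁ f₂ f₁₁ f₁₂ f₂₂ (gForm a e u y y, bForm β e u y))
    (he : e ∈ charts n M) (hu : u ∈ e.target)
    (hE : energy F e = fun p => f (quadEnergy a e p, linEnergy β e p)) (v : Coord n) :
    v.ofLp ⬝ᵥ (fundTensor F e u y *ᵥ v.ofLp) =
      f₁ (gForm a e u y y, bForm β e u y) * gForm a e u v v + 2 * f₁₁ * gForm a e u y v ^ 2 +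
      2 * f₁₂ * gForm a e u y v * bForm β e u v + (1 / 2) * f₂₂ * bForm β e u v ^ 2 := by
  have hL := contDiffAt_two_of_infty (hf.contDiffAt_energy he hu hE)
  have h1 : v.ofLp ⬝ᵥ (fundTensor F e u y *ᵥ v.ofLp) =
      (1 / 2) * fderiv ℝ (fderiv ℝ (energy F e)) (u, y) (0, v) (0, v) := by
    have h2 : ((0 : Coord n), v) = ∑ j, v j • ((0 : Coord n), (stdVec j : Coord n)) := by
      conv_lhs => rw [← sum_smul_stdVec v]
      ext1
      · simp [Prod.fst_sum]
      · simp [Prod.snd_sum]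
    conv_rhs => enter [2, 2]; rw [h2]
    rw [map_sum, Finset.mul_sum]
    refine Finset.sum_congr rfl fun j _ => ?_
    rw [fundTensor_mulVec hL, map_smul, smul_eq_mul]
    ring
  rw [h1, hf.snd_fderiv_energy he hu hE]
  ring

/-- An ansatz `Z` for the deviation from `G_α` is inserted in the Euler–Lagrange equation. Tested on
`z`, the equation has components along `⟨y, z⟩`, `β(z)` and `s(z, y)`; `hp`, `ht` and `hσ` say that
each of them vanishes. `DA` and `DB` stand for the derivatives of `α²` and `β` along the geodesic.
-/
theorem IsTwoJet.sprayVec_eq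
    (hf : IsTwoJet f f₁ f₂ f₁₁ f₁₂ f₂₂ (gForm a e u y y, bForm β e u y))
    (he : e ∈ charts n M) (hu : u ∈ e.target)
    (hE : energy F e = fun p => f (quadEnergy a e p, linEnergy β e p))
    (hg : IsUnit (fundTensor F e u y).det) {σ t p : ℝ}
    (hσ : f₂ (gForm a e u y y, bForm β e u y) =
      2 * f₁ (gForm a e u y y, bForm β e u y) * σ)
    {DA DB : ℝ} (hDA : DA = -4 * (p * gForm a e u y y + t * bForm β e u y))
    (hDB : DB = rForm a β e u y y - 2 * σ * sForm a β e u (bVec a β e u) y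
      - 2 * p * bForm β e u y - 2 * t * bSq a β e u)
    (hp : -4 * f₁ (gForm a e u y y, bForm β e u y) * p + 2 * (f₁₁ * DA + f₁₂ * DB) = 0)
    (ht : -4 * f₁ (gForm a e u y y, bForm β e u y) * t + (f₁₂ * DA + f₂₂ * DB) = 0) :
    sprayVec F e u y = sprayVec (rnorm a) e u y + (σ • sMap a β e u y + t • bVec a β e u + p • y) := by
  have hL := contDiffAt_two_of_infty (hf.contDiffAt_energy he hu hE)
  set G := sprayVec (rnorm a) e u y with hG
  set Z := σ • sMap a β e u y + t • bVec a β e u + p • y with hZ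
  have hgs : ∀ z, gForm a e u (sMap a β e u y) z = sForm a β e u z y := gForm_sMap a β he hu y
  have hgZ : ∀ z, gForm a e u Z z = σ * sForm a β e u z y + t * bForm β e u z
      + p * gForm a e u y z := by
    intro z
    simp only [hZ, gForm_add_left, gForm_smul_left, gForm_sMap a β he hu, gForm_bVec a β he hu]
  have hsyy : sForm a β e u y y = 0 := by
    have := sForm_neg_swap a β (e := e) (u := u) y y
    linarith
  have hyZ : gForm a e u y Z = t * bForm β e u y + p * gForm a e u y y := by
    rw [gForm_comm, hgZ, hsyy]
    ring
  have hbs : bForm β e u (sMap a β e u y) = sForm a β e u (bVec a β e u) y := by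
    rw [← gForm_bVec a β he hu, gForm_comm, hgs]
  have hbZ : bForm β e u Z = σ * sForm a β e u (bVec a β e u) y + t * bSq a β e u
      + p * bForm β e u y := by
    simp only [hZ, bForm_add, bForm_smul, hbs, bForm_bVec]
  have hEα : ∀ z, 2 * gForm' a e u y y z - 4 * gForm a e u G z - gForm' a e u z y y = 0 := by
    intro z
    have h := (spray_eq_iff (F := rnorm a) (e := e) (u := u) (y := y) (by
      rw [energy_rnorm]; exact contDiffAt_two_of_infty (contDiffAt_quadEnergy a he hu y))
      (by rw [fundTensor_rnorm a he hu]; exact isUnit_det_aComp a he hu) G).1 (fun i => rfl) z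
    rw [energy_rnorm, eulerLagrange_quadEnergy a he hu, gForm_smul_left] at h
    linarith
  have hEy := hEα y
  have hr := bForm'_sub_sprayVec a β he hu y
  rw [← hG] at hr
  have hf' : IsTwoJet f f₁ f₂ f₁₁ f₁₂ f₂₂ (quadEnergy a e (u, y), linEnergy β e (u, y)) := hf
  have hD2 := snd_fderiv_comp_prodMk (A := quadEnergy a e) (B := linEnergy β e) (p := (u, y))
    hf'.der hf'.der₁ hf'.der₂ (contDiffAt_two_of_infty (contDiffAt_quadEnergy a he hu y))
    (contDiffAt_two_of_infty (contDiffAt_linEnergy β he hu y))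
  have hD1 := (fderiv_comp_prodMk (A := quadEnergy a e) (B := linEnergy β e) (p := (u, y))
    hf'.der.self_of_nhds ((contDiffAt_quadEnergy a he hu y).differentiableAt (by simp))
    ((contDiffAt_linEnergy β he hu y).differentiableAt (by simp))).fderiv
  have key := (spray_eq_iff hL hg (G + Z)).2 (fun z => by
    have hEz := hEα z
    rw [eulerLagrange, hE, hD2, hD1, add_apply, smul_apply, smul_apply,
      snd_fderiv_quadEnergy a he hu, snd_fderiv_linEnergy β he hu]
    simp only [fderiv_quadEnergy a he hu, fderiv_linEnergy β he hu,
      gForm'_zero_left, bForm'_zero_left, gForm_zero_right, bForm_zero, smul_eq_mul]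
    have hs := sForm_eq' a β (e := e) (u := u) z y
    rw [gForm_smul_left, gForm_add_left, hgZ, gForm_smul_right, gForm_add_right, hyZ,
      bForm_smul, bForm_add, hbZ, gForm_comm a e u y G]
    -- The derivatives of `α²` and `β` along a curve with velocity `y` and acceleration `-2 (G_α +
    -- Z)`; the `G_α` part contributes `0` and `r₀₀` respectively.
    have hDA' : gForm' a e u y y y + 2 * (-2 * (gForm a e u G y + (t * bForm β e u y +
        p * gForm a e u y y))) = DA := by
      rw [hDA]
      linarith
    have hDB' : bForm' β e u y y + -2 * (bForm β e u G + (σ * sForm a β e u (bVec a β e u) y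
        + t * bSq a β e u + p * bForm β e u y)) = DB := by
      rw [hDB]
      linarith
    rw [hDA', hDB']
    simp only [quadEnergy, linEnergy]
    linear_combination (f₁ (gForm a e u y y, bForm β e u y)) * hEz + gForm a e u y z * hp +
      bForm β e u z * ht - 2 * (f₂ (gForm a e u y y, bForm β e u y)) * hs +
      2 * sForm a β e u z y * hσ)
  ext i
  exact key i

end AlphaBetaSpray
end FinslerProj

/-! ### Derivatives of the two energies -/

namespace FinslerProj
variable {n : ℕ} {M : Type*} [TopologicalSpace M] [ChartedSpace (EuclideanSpace ℝ (Fin n)) M]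
  [IsManifold (𝓡 n) ∞ M]

section Jets

theorem HasFDerivAt.div_real {W : Type*} [NormedAddCommGroup W] [NormedSpace ℝ W] {f g : W → ℝ}
    {f' g' : W →L[ℝ] ℝ} {x : W} (hf : HasFDerivAt f f' x) (hg : HasFDerivAt g g' x)
    (h : g x ≠ 0) :
    HasFDerivAt (fun x => f x / g x) ((1 / g x) • f' - (f x / g x ^ 2) • g') x := by
  have h1 := hf.mul ((hasDerivAt_inv h).comp_hasFDerivAt x hg)
  have h2 : HasFDerivAt (fun x => f x / g x) _ x := h1
  refine h2.congr_fderiv ?_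
  ext w
  simp
  field_simp
  ring

theorem isTwoJet_kropina {x : ℝ × ℝ} (hx : x.2 ≠ 0) :
    IsTwoJet (fun x => (x.1 / x.2) ^ 2) (fun x => 2 * x.1 / x.2 ^ 2)
      (fun x => -2 * x.1 ^ 2 / x.2 ^ 3) (2 / x.2 ^ 2) (-4 * x.1 / x.2 ^ 3)
      (6 * x.1 ^ 2 / x.2 ^ 4) x where
  smooth := (contDiffAt_fst.div contDiffAt_snd hx).pow 2
  der := by
    filter_upwards [(continuous_snd.continuousAt (x := x)).eventually_ne hx] with z hz
    have h := (HasFDerivAt.div_real (hasFDerivAt_fst (𝕜 := ℝ) (p := z))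
      (hasFDerivAt_snd (𝕜 := ℝ) (p := z)) hz).pow 2
    refine h.congr_fderiv ?_
    ext <;> (simp; field_simp)
  der₁ := by
    have h := HasFDerivAt.div_real ((hasFDerivAt_fst (𝕜 := ℝ) (p := x)).const_mul 2)
      ((hasFDerivAt_snd (𝕜 := ℝ) (p := x)).pow 2) (pow_ne_zero 2 hx)
    refine h.congr_fderiv ?_
    ext <;> simp <;> field_simp <;> ring
  der₂ := by
    have h := HasFDerivAt.div_real (((hasFDerivAt_fst (𝕜 := ℝ) (p := x)).pow 2).const_mul (-2))
      ((hasFDerivAt_snd (𝕜 := ℝ) (p := x)).pow 3) (pow_ne_zero 3 hx)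
    refine h.congr_fderiv ?_
    ext <;> simp <;> field_simp <;> ring

/-- The energy of `(α + β)^q / α^(q-1)` as a function of `α²` and `β`. -/
def qEnergy (q : ℝ) (x : ℝ × ℝ) : ℝ := ((√x.1 + x.2) ^ q / √x.1 ^ (q - 1)) ^ 2

theorem qEnergy_pos (q : ℝ) {x : ℝ × ℝ} (h1 : 0 < x.1) (h2 : 0 < √x.1 + x.2) :
    0 < qEnergy q x := by
  have := Real.sqrt_pos.2 h1
  unfold qEnergy
  positivity

/-- In exponential form the real powers disappear and every derivative of the energy is a rational
multiple of the energy itself, with `√x.1` as an extra variable. -/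
theorem qEnergy_eq_exp (q : ℝ) {x : ℝ × ℝ} (h1 : 0 < x.1) (h2 : 0 < √x.1 + x.2) :
    qEnergy q x = Real.exp (2 * q * Real.log (√x.1 + x.2) - (q - 1) * Real.log x.1) := by
  have h3 := Real.sqrt_pos.2 h1
  rw [qEnergy, Real.rpow_def_of_pos h2, Real.rpow_def_of_pos h3, ← Real.exp_sub, ← Real.exp_nat_mul,
    Real.log_sqrt h1.le]
  congr 1
  push_cast
  ring

theorem hasFDerivAt_sqrt_fst {x : ℝ × ℝ} (h1 : 0 < x.1) :
    HasFDerivAt (fun x : ℝ × ℝ => √x.1) ((1 / (2 * √x.1)) • ContinuousLinearMap.fst ℝ ℝ ℝ) x :=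
  (hasFDerivAt_fst (𝕜 := ℝ) (p := x)).sqrt h1.ne'

theorem hasFDerivAt_sqrt_add {x : ℝ × ℝ} (h1 : 0 < x.1) (c : ℝ) :
    HasFDerivAt (fun x : ℝ × ℝ => √x.1 + c * x.2)
      ((1 / (2 * √x.1)) • ContinuousLinearMap.fst ℝ ℝ ℝ + c • ContinuousLinearMap.snd ℝ ℝ ℝ) x :=
  (hasFDerivAt_sqrt_fst h1).add ((hasFDerivAt_snd (𝕜 := ℝ) (p := x)).const_mul c)

theorem eventually_domain {x : ℝ × ℝ} (h1 : 0 < x.1) (h2 : 0 < √x.1 + x.2) :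
    ∀ᶠ z : ℝ × ℝ in nhds x, 0 < z.1 ∧ 0 < √z.1 + z.2 := by
  have hc1 : ContinuousAt (fun z : ℝ × ℝ => z.1) x := continuous_fst.continuousAt
  have hc2 : ContinuousAt (fun z : ℝ × ℝ => √z.1 + z.2) x :=
    ((Real.continuous_sqrt.comp continuous_fst).add continuous_snd).continuousAt
  exact (hc1.eventually_const_lt h1).and (hc2.eventually_const_lt h2)

theorem hasFDerivAt_qEnergy (q : ℝ) {x : ℝ × ℝ} (h1 : 0 < x.1) (h2 : 0 < √x.1 + x.2) :
    HasFDerivAt (qEnergy q)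
      ((qEnergy q x * (√x.1 + (1 - q) * x.2) / ((√x.1 + x.2) * x.1)) •
        ContinuousLinearMap.fst ℝ ℝ ℝ +
      (2 * q * qEnergy q x / (√x.1 + x.2)) • ContinuousLinearMap.snd ℝ ℝ ℝ) x := by
  have h3 := Real.sqrt_pos.2 h1
  have hS := hasFDerivAt_sqrt_add h1 1
  simp only [one_mul] at hS
  have h := ((((hS.log h2.ne').const_mul (2 * q)).sub
    (((hasFDerivAt_fst (𝕜 := ℝ) (p := x)).log h1.ne').const_mul (q - 1)))).exp
  have h' := h.congr_of_eventuallyEq (f₁ := qEnergy q) (by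
    filter_upwards [eventually_domain h1 h2] with z hz
    exact qEnergy_eq_exp q hz.1 hz.2)
  refine h'.congr_fderiv ?_
  have hE := qEnergy_eq_exp q h1 h2
  simp only [Pi.sub_apply, ← hE]
  obtain ⟨A, b⟩ := x
  set s := √A
  have hA : A = s ^ 2 := (Real.sq_sqrt h1.le).symm
  ext <;> simp
  · rw [hA]
    field_simp
    ring
  · field_simp

/-- The derivative in `α²` is homogeneous of degree zero when `α²` has weight two and `β` weight
one. Euler's relation then gives `2 α² f₁₁ + β f₁₂ = 0`, which is why `f₁₁` is written through
`f₁₂`. -/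
theorem isTwoJet_qEnergy (q : ℝ) {x : ℝ × ℝ} (h1 : 0 < x.1) (h2 : 0 < √x.1 + x.2) :
    IsTwoJet (qEnergy q)
      (fun x => qEnergy q x * (√x.1 + (1 - q) * x.2) / ((√x.1 + x.2) * x.1))
      (fun x => 2 * q * qEnergy q x / (√x.1 + x.2))
      (-x.2 * (q * qEnergy q x * (√x.1 + 2 * (1 - q) * x.2) / (x.1 * (√x.1 + x.2) ^ 2))
        / (2 * x.1))
      (q * qEnergy q x * (√x.1 + 2 * (1 - q) * x.2) / (x.1 * (√x.1 + x.2) ^ 2))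
      (2 * q * (2 * q - 1) * qEnergy q x / (√x.1 + x.2) ^ 2) x where
  smooth := by
    have hs : ContDiffAt ℝ ∞ (fun x : ℝ × ℝ => √x.1) x := contDiffAt_fst.sqrt h1.ne'
    have : ContDiffAt ℝ ∞ (fun x : ℝ × ℝ =>
        Real.exp (2 * q * Real.log (√x.1 + x.2) - (q - 1) * Real.log x.1)) x :=
      ((contDiffAt_const.mul ((hs.add contDiffAt_snd).log h2.ne')).sub
        (contDiffAt_const.mul (contDiffAt_fst.log h1.ne'))).exp
    refine this.congr_of_eventuallyEq ?_
    filter_upwards [eventually_domain h1 h2] with z hz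
    exact qEnergy_eq_exp q hz.1 hz.2
  der := by
    filter_upwards [eventually_domain h1 h2] with z hz
    exact hasFDerivAt_qEnergy q hz.1 hz.2
  der₁ := by
    have h3 := Real.sqrt_pos.2 h1
    have hS := hasFDerivAt_sqrt_add h1 1
    simp only [one_mul] at hS
    have hD := hasFDerivAt_sqrt_add h1 (1 - q)
    have hne : (√x.1 + x.2) * x.1 ≠ 0 := (mul_pos h2 h1).ne'
    have h := HasFDerivAt.div_real ((hasFDerivAt_qEnergy q h1 h2).mul hD)
      (hS.mul (hasFDerivAt_fst (𝕜 := ℝ) (p := x))) hne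
    refine h.congr_fderiv ?_
    obtain ⟨A, b⟩ := x
    simp only [Pi.mul_apply] at *
    generalize qEnergy q (A, b) = E
    set s := √A
    have hA : A = s ^ 2 := (Real.sq_sqrt h1.le).symm
    ext <;> simp
    · rw [hA]
      field_simp
      ring
    · rw [hA]
      field_simp
      ring
  der₂ := by
    have h3 := Real.sqrt_pos.2 h1
    have hS := hasFDerivAt_sqrt_add h1 1
    simp only [one_mul] at hS
    have h := HasFDerivAt.div_real ((hasFDerivAt_qEnergy q h1 h2).const_mul (2 * q)) hS h2.ne'
    refine h.congr_fderiv ?_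
    obtain ⟨A, b⟩ := x
    simp only at *
    generalize qEnergy q (A, b) = E
    set s := √A
    have hA : A = s ^ 2 := (Real.sq_sqrt h1.le).symm
    ext <;> simp
    · rw [hA]
      field_simp
      ring
    · field_simp

end Jets
end FinslerProj

/-! ### The sprays of the two metrics -/

namespace FinslerProj
variable {n : ℕ} {M : Type*} [TopologicalSpace M] [ChartedSpace (EuclideanSpace ℝ (Fin n)) M]
  [IsManifold (𝓡 n) ∞ M]

section Formulas

variable {a : RiemMetric n M} {β : OneForm n M} {e : OpenPartialHomeomorph M (Coord n)}
  {u : Coord n}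

theorem gForm_nonneg (e : OpenPartialHomeomorph M (Coord n)) (u v : Coord n) :
    0 ≤ gForm a e u v v := by
  rw [gForm_eq]
  rcases eq_or_ne (tvec e u v) 0 with h | h
  · rw [h, map_zero]
  · exact (a.pos _ _ h).le

theorem energy_qMetric (q : ℝ) :
    energy (qMetric q a β) e = fun p => qEnergy q (quadEnergy a e p, linEnergy β e p) := by
  ext p
  simp only [energy, inChart, qMetric, qEnergy, quadEnergy, linEnergy]
  have h1 := inChart_rnorm a e p.1 p.2
  have h2 := inChart_form β e p.1 p.2
  simp only [inChart] at h1 h2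
  rw [h1, h2]

theorem energy_kropina :
    energy (kropina a β) e = fun p => (quadEnergy a e p / linEnergy β e p) ^ 2 := by
  ext p
  simp only [energy, inChart, kropina, quadEnergy, linEnergy]
  have h1 := inChart_rnorm a e p.1 p.2
  have h2 := inChart_form β e p.1 p.2
  simp only [inChart] at h1 h2
  rw [h1, h2, Real.sq_sqrt (gForm_nonneg e p.1 p.2)]

theorem gForm_sub_smul (he : e ∈ charts n M) (hu : u ∈ e.target) (y : Coord n) (c : ℝ) :
    gForm a e u (bVec a β e u + c • y) (bVec a β e u + c • y) =
      bSq a β e u + 2 * c * bForm β e u y + c ^ 2 * gForm a e u y y := by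
  simp only [gForm_add_left, gForm_add_right, gForm_smul_left, gForm_smul_right,
    gForm_bVec a β he hu, gForm_comm a e u y (bVec a β e u), bForm_bVec]
  ring

theorem bForm_sq_le (he : e ∈ charts n M) (hu : u ∈ e.target) (y : Coord n) :
    bForm β e u y ^ 2 ≤ bSq a β e u * gForm a e u y y := by
  rcases eq_or_ne y 0 with rfl | hy
  · simp [bForm_zero, gForm_zero_right]
  have hA := gForm_pos a he hu hy
  have h := gForm_sub_smul (a := a) (β := β) he hu y (-(bForm β e u y / gForm a e u y y))
  have h0 := gForm_nonneg (a := a) e u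
    (bVec a β e u + (-(bForm β e u y / gForm a e u y y)) • y)
  rw [h] at h0
  have h1 : (bSq a β e u + 2 * -(bForm β e u y / gForm a e u y y) * bForm β e u y +
      (-(bForm β e u y / gForm a e u y y)) ^ 2 * gForm a e u y y) * gForm a e u y y =
      bSq a β e u * gForm a e u y y - bForm β e u y ^ 2 := by
    field_simp
    ring
  nlinarith [mul_nonneg h0 hA.le]

theorem bSq_nonneg (he : e ∈ charts n M) (hu : u ∈ e.target) : 0 ≤ bSq a β e u := by
  rw [← bForm_bVec, ← gForm_bVec a β he hu]
  exact gForm_nonneg e u _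

theorem bSq_pos (he : e ∈ charts n M) (hu : u ∈ e.target) (hb : β (e.symm u) ≠ 0) :
    0 < bSq a β e u := by
  rw [← bForm_bVec, ← gForm_bVec a β he hu]
  refine gForm_pos a he hu fun h => hb ?_
  ext v
  obtain ⟨y, rfl⟩ := tvec_surjective he hu v
  have h1 := form_tvec β e u y
  change _ = bForm β e u y at h1
  rw [h1, ← gForm_bVec a β he hu, h]
  simp [gForm]

theorem IsQMetric.add_pos {q : ℝ} (hF : IsQMetric q a β) (he : e ∈ charts n M)
    (hu : u ∈ e.target) {y : Coord n} (hy : y ≠ 0) :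
    0 < √(gForm a e u y y) + bForm β e u y := by
  have hA := gForm_pos a he hu hy
  have hs := Real.sqrt_pos.2 hA
  have h1 := bForm_sq_le (a := a) (β := β) he hu y
  have h2 := hF.norm_lt_one e he u hu
  have h3 := Real.sq_sqrt hA.le
  have h4 : bForm β e u y ^ 2 < √(gForm a e u y y) ^ 2 := by
    rw [h3]
    nlinarith
  have := (abs_lt.1 (abs_lt_of_sq_lt_sq h4 hs.le)).1
  linarith

/-- `α + (1-q) β`. -/
def denD (q : ℝ) (a : RiemMetric n M) (β : OneForm n M) (e : OpenPartialHomeomorph M (Coord n))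
    (u y : Coord n) : ℝ := √(gForm a e u y y) + (1 - q) * bForm β e u y

/-- `(1-q²) β² + (2-q) αβ + (1+(q²-q)b²) α²`. -/
def denE (q : ℝ) (a : RiemMetric n M) (β : OneForm n M) (e : OpenPartialHomeomorph M (Coord n))
    (u y : Coord n) : ℝ :=
  (1 - q ^ 2) * bForm β e u y ^ 2 + (2 - q) * √(gForm a e u y y) * bForm β e u y +
    (1 + (q ^ 2 - q) * bSq a β e u) * gForm a e u y y

theorem IsQMetric.quadratic_pos {q : ℝ} (hF : IsQMetric q a β) (he : e ∈ charts n M)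
    (hu : u ∈ e.target) {y : Coord n} (hy : y ≠ 0) {v : Coord n} (hv : v ≠ 0) :
    0 < v.ofLp ⬝ᵥ (fundTensor (qMetric q a β) e u y *ᵥ v.ofLp) := by
  have := (hF.finsler.convex e he u hu y hy).dotProduct_mulVec_pos (x := v.ofLp)
    (fun h => hv (by ext i; exact congrFun h i))
  simpa using this

/-- Strong convexity is tested on a nonzero vector orthogonal to `y` and annihilated by `β`; on it
only the `f₁` term survives, and `f₁` is a positive multiple of `denD`. Such a vector exists because
two linear conditions cannot exhaust dimension three. -/
theorem IsQMetric.denD_pos {q : ℝ} (hF : IsQMetric q a β) (hn : 3 ≤ n) (he : e ∈ charts n M)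
    (hu : u ∈ e.target) {y : Coord n} (hy : y ≠ 0) : 0 < denD q a β e u y := by
  have hA := gForm_pos a he hu hy
  have hS := hF.add_pos he hu hy
  let T : Coord n →ₗ[ℝ] ℝ × ℝ :=
    { toFun := fun v => (gForm a e u y v, bForm β e u v)
      map_add' := fun v w => by simp [gForm_add_right, bForm_add]
      map_smul' := fun c v => by simp [gForm_smul_right, bForm_smul] }
  have hT : LinearMap.ker T ≠ ⊥ := LinearMap.ker_ne_bot_of_finrank_lt (by simp; omega)
  obtain ⟨v, hv, hv0⟩ := (Submodule.ne_bot_iff _).1 hT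
  have h1 : gForm a e u y v = 0 := congrArg Prod.fst (LinearMap.mem_ker.1 hv)
  have h2 : bForm β e u v = 0 := congrArg Prod.snd (LinearMap.mem_ker.1 hv)
  have h3 := hF.quadratic_pos he hu hy hv0
  rw [(isTwoJet_qEnergy q (x := (gForm a e u y y, bForm β e u y)) hA hS).fundTensor_quadratic
    he hu (energy_qMetric q), h1, h2] at h3
  have hE := qEnergy_pos q (x := (gForm a e u y y, bForm β e u y)) hA hS
  have hv' := gForm_pos a he hu hv0
  simp only [mul_zero, add_zero, ne_eq, OfNat.ofNat_ne_zero, not_false_eq_true, zero_pow] at h3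
  have h4 := (mul_pos_iff_of_pos_right hv').1 h3
  rw [div_pos_iff_of_pos_right (mul_pos hS hA)] at h4
  exact (mul_pos_iff_of_pos_left hE).1 h4

/-- Strong convexity is tested in the plane of `y` and `b`, on the vector that is orthogonal to `y`
for the fundamental tensor; the value there is a positive multiple of `denE`. If `b` is parallel to
`y`, `denE` factors instead. -/
theorem IsQMetric.denE_pos {q : ℝ} (hF : IsQMetric q a β) (hn : 3 ≤ n) (he : e ∈ charts n M)
    (hu : u ∈ e.target) {y : Coord n} (hy : y ≠ 0) : 0 < denE q a β e u y := by
  have hA := gForm_pos a he hu hy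
  have hS := hF.add_pos he hu hy
  have hD := hF.denD_pos hn he hu hy
  have hE := qEnergy_pos q (x := (gForm a e u y y, bForm β e u y)) hA hS
  have hs := Real.sqrt_pos.2 hA
  have hsq := Real.sq_sqrt hA.le
  set A := gForm a e u y y with hAd
  set b := bForm β e u y with hbd
  set c := bSq a β e u with hcd
  set f := qEnergy q (A, b) with hfd
  set s := √A with hsd
  have hA2 : A = s ^ 2 := hsq.symm
  set B := c - b ^ 2 / A with hB
  -- `B` is the squared length of the component of `bⁱ` orthogonal to `y`.
  have hdE : denE q a β e u y = (s + b) * denD q a β e u y + q * (q - 1) * A * B := by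
    simp only [denE, denD, ← hAd, ← hbd, ← hcd, ← hsd, hB]
    rw [hA2]
    field_simp
    ring
  have hcs := bForm_sq_le (a := a) (β := β) he hu y
  have hB0 : 0 ≤ B := by
    rw [hB, sub_nonneg, div_le_iff₀ hA]
    exact hcs
  rcases hB0.eq_or_lt with h | hBpos
  · rw [hdE, ← h, mul_zero, add_zero]
    exact mul_pos hS hD
  -- With `v = b_⊥ + κ y`, the fundamental tensor gives `g(y, v) = f₂ B / 2 + κ f`, where `f₂ = 2 q
  -- f / (s + b)`; this `κ` makes it zero.
  set κ := -(2 * q * f / (s + b)) * B / (2 * f) with hκ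
  set v := bVec a β e u + (κ - b / A) • y with hv
  have hyv : gForm a e u y v = κ * A := by
    rw [hv, gForm_add_right, gForm_smul_right, gForm_comm, gForm_bVec a β he hu, ← hAd, ← hbd]
    field_simp
    ring
  have hbv : bForm β e u v = B + κ * b := by
    rw [hv, bForm_add, bForm_smul, bForm_bVec, ← hcd, ← hbd, hB]
    ring
  have hvv : gForm a e u v v = B + κ ^ 2 * A := by
    rw [hv, gForm_sub_smul he hu, ← hAd, ← hbd, ← hcd, hB]
    field_simp
    ring
  have hv0 : v ≠ 0 := by
    intro h
    rw [h, gForm_zero_right] at hvv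
    nlinarith [sq_nonneg κ]
  have h3 := hF.quadratic_pos he hu hy hv0
  rw [(isTwoJet_qEnergy q (x := (gForm a e u y y, bForm β e u y)) hA hS).fundTensor_quadratic
    he hu (energy_qMetric q), hyv, hbv, hvv] at h3
  simp only [← hAd, ← hbd, ← hfd, ← hsd] at h3
  have h5 : f * (s + (1 - q) * b) / ((s + b) * A) * (B + κ ^ 2 * A) +
      2 * (-b * (q * f * (s + 2 * (1 - q) * b) / (A * (s + b) ^ 2)) / (2 * A)) * (κ * A) ^ 2 +
      2 * (q * f * (s + 2 * (1 - q) * b) / (A * (s + b) ^ 2)) * (κ * A) * (B + κ * b) +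
      1 / 2 * (2 * q * (2 * q - 1) * f / (s + b) ^ 2) * (B + κ * b) ^ 2 =
      f * B / ((s + b) ^ 2 * A) * denE q a β e u y := by
    rw [hdE, denD, ← hAd, ← hsd, ← hbd, hκ, hA2]
    have hsb : s + b ≠ 0 := hS.ne'
    field_simp
    ring
  rw [h5] at h3
  exact (mul_pos_iff_of_pos_left (by positivity)).1 h3

/-- The coefficient of `y` in the spray of `(α + β)^q / α^(q-1)`. -/
def qProj (q : ℝ) (a : RiemMetric n M) (β : OneForm n M) (e : OpenPartialHomeomorph M (Coord n))
    (u y : Coord n) : ℝ :=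
  q * (rForm a β e u y y - 2 * (q * gForm a e u y y / denD q a β e u y) *
    sForm a β e u (bVec a β e u) y) * (√(gForm a e u y y) + 2 * (1 - q) * bForm β e u y) /
    (2 * denE q a β e u y)

/-- The coefficient of `b` in the spray of `(α + β)^q / α^(q-1)`. -/
def qNormal (q : ℝ) (a : RiemMetric n M) (β : OneForm n M)
    (e : OpenPartialHomeomorph M (Coord n)) (u y : Coord n) : ℝ :=
  q * (q - 1) * gForm a e u y y *
    (rForm a β e u y y - 2 * (q * gForm a e u y y / denD q a β e u y) *
      sForm a β e u (bVec a β e u) y) / (2 * denE q a β e u y)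

/-- The ansatz equations are linear in `t` and `p`, with determinant proportional to `denE`;
positivity of `denD` and `denE` makes the solution legitimate. -/
theorem IsQMetric.sprayVec_eq {q : ℝ} (hF : IsQMetric q a β) (hn : 3 ≤ n) (he : e ∈ charts n M)
    (hu : u ∈ e.target) {y : Coord n} (hy : y ≠ 0) :
    sprayVec (qMetric q a β) e u y = sprayVec (rnorm a) e u y +
      ((q * gForm a e u y y / denD q a β e u y) • sMap a β e u y +
        qNormal q a β e u y • bVec a β e u + qProj q a β e u y • y) := by
  have hA := gForm_pos a he hu hy
  have hS := hF.add_pos he hu hy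
  have hD := hF.denD_pos hn he hu hy
  have hE := hF.denE_pos hn he hu hy
  have hf := qEnergy_pos q (x := (gForm a e u y y, bForm β e u y)) hA hS
  have hs := Real.sqrt_pos.2 hA
  have hsq := Real.sq_sqrt hA.le
  have hdet : IsUnit (fundTensor (qMetric q a β) e u y).det :=
    (hF.finsler.convex e he u hu y hy).det_pos.ne'.isUnit
  refine (isTwoJet_qEnergy q (x := (gForm a e u y y, bForm β e u y)) hA hS).sprayVec_eq he hu
    (energy_qMetric q) hdet ?_ rfl rfl ?_ ?_
  · simp only [denD] at *
    set A := gForm a e u y y with hAd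
    set s := √A
    have hA2 : A = s ^ 2 := hsq.symm
    have hD' : s + bForm β e u y * (1 - q) ≠ 0 := by
      rw [mul_comm]
      exact hD.ne'
    field_simp
  all_goals
    simp only [qProj, qNormal]
    generalize rForm a β e u y y - 2 * (q * gForm a e u y y / denD q a β e u y) *
      sForm a β e u (bVec a β e u) y = R
    have hE' := hE.ne'
    have hdE : denE q a β e u y = (1 - q ^ 2) * bForm β e u y ^ 2 +
      (2 - q) * √(gForm a e u y y) * bForm β e u y +
      (1 + (q ^ 2 - q) * bSq a β e u) * gForm a e u y y := rfl
    set A := gForm a e u y y with hAd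
    set b := bForm β e u y with hbd
    set c := bSq a β e u with hcd
    set f := qEnergy q (A, b) with hfd
    set s := √A
    have hA2 : A = s ^ 2 := hsq.symm
    set E := denE q a β e u y
    have hsb : s + b ≠ 0 := hS.ne'
    rw [hA2] at hdE ⊢
    field_simp
    rw [hdE]
    ring

/-- A kernel vector would annihilate the quadratic form of the fundamental tensor, but this form is
positive on the cone by Cauchy–Schwarz. -/
theorem isUnit_det_kropina (he : e ∈ charts n M) (hu : u ∈ e.target) {y : Coord n}
    (hy : 0 < bForm β e u y) : IsUnit (fundTensor (kropina a β) e u y).det := by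
  have hy0 : y ≠ 0 := by
    rintro rfl
    rw [bForm_zero] at hy
    exact lt_irrefl _ hy
  have hA := gForm_pos a he hu hy0
  rw [isUnit_iff_ne_zero]
  intro hdet
  obtain ⟨w, hw, hw0⟩ := Matrix.exists_mulVec_eq_zero_iff.2 hdet
  set v : Coord n := WithLp.toLp 2 w with hv
  have hv0 : v ≠ 0 := fun h => hw (congrArg WithLp.ofLp h)
  have h1 := (isTwoJet_kropina (x := (gForm a e u y y, bForm β e u y)) hy.ne').fundTensor_quadratic
    he hu (energy_kropina) v
  have hw1 : v.ofLp ⬝ᵥ (fundTensor (kropina a β) e u y *ᵥ v.ofLp) = 0 := by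
    change w ⬝ᵥ (fundTensor (kropina a β) e u y *ᵥ w) = 0
    rw [hw0, dotProduct_zero]
  rw [hw1] at h1
  have hvv := gForm_pos a he hu hv0
  have hcs : gForm a e u y v ^ 2 ≤ gForm a e u v v * gForm a e u y y := by
    have h := gForm_nonneg (a := a) e u (v + (-(gForm a e u y v / gForm a e u y y)) • y)
    simp only [gForm_add_left, gForm_add_right, gForm_smul_left, gForm_smul_right,
      gForm_comm a e u v y] at h
    have h2 : (gForm a e u v v + -(gForm a e u y v / gForm a e u y y) * gForm a e u y v +
      -(gForm a e u y v / gForm a e u y y) * (gForm a e u y v +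
        -(gForm a e u y v / gForm a e u y y) * gForm a e u y y)) * gForm a e u y y =
        gForm a e u v v * gForm a e u y y - gForm a e u y v ^ 2 := by
      field_simp
      ring
    have h3 := mul_nonneg h hA.le
    nlinarith
  simp only at h1
  set A := gForm a e u y y
  set b := bForm β e u y
  set V := gForm a e u v v
  set Y := gForm a e u y v
  set σ := A / b * bForm β e u v with hσ
  have h2 : 2 * A * V + 4 * Y ^ 2 - 8 * Y * σ + 3 * σ ^ 2 = 0 := by
    have : 2 * A * V + 4 * Y ^ 2 - 8 * Y * σ + 3 * σ ^ 2 = b ^ 2 *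
      (2 * A / b ^ 2 * V + 2 * (2 / b ^ 2) * Y ^ 2 + 2 * (-4 * A / b ^ 3) * Y * bForm β e u v +
        1 / 2 * (6 * A ^ 2 / b ^ 4) * bForm β e u v ^ 2) := by
      rw [hσ]
      field_simp
      ring
    rw [this, ← h1, mul_zero]
  have h3 : 0 < A * V := mul_pos hA hvv
  -- Three times the form is `6 A V - 4 Y² + (3 σ - 4 Y)²`, and `Y² ≤ A V`.
  nlinarith [sq_nonneg (3 * σ - 4 * Y), sq_nonneg Y]

/-- The coefficient of `y` in the spray of the Kropina metric. -/
def kProj (a : RiemMetric n M) (β : OneForm n M) (e : OpenPartialHomeomorph M (Coord n))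
    (u y : Coord n) : ℝ :=
  -(rForm a β e u y y * bForm β e u y / gForm a e u y y + sForm a β e u (bVec a β e u) y) /
    bSq a β e u

theorem sprayVec_kropina (he : e ∈ charts n M) (hu : u ∈ e.target) {y : Coord n}
    (hy : 0 < bForm β e u y) :
    sprayVec (kropina a β) e u y = sprayVec (rnorm a) e u y +
      ((-(gForm a e u y y) / (2 * bForm β e u y)) • sMap a β e u y +
        ((rForm a β e u y y + gForm a e u y y / bForm β e u y *
          sForm a β e u (bVec a β e u) y) / (2 * bSq a β e u)) • bVec a β e u +
        kProj a β e u y • y) := by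
  have hy0 : y ≠ 0 := by
    rintro rfl
    rw [bForm_zero] at hy
    exact lt_irrefl _ hy
  have hA := gForm_pos a he hu hy0
  -- Cauchy–Schwarz: `β` is nonzero at `y`.
  have hc : 0 < bSq a β e u := by
    have := bForm_sq_le (a := a) (β := β) he hu y
    by_contra h
    nlinarith [sq_pos_of_pos hy]
  have hy' := hy.ne'
  have hA' := hA.ne'
  have hc' := hc.ne'
  refine (isTwoJet_kropina (x := (gForm a e u y y, bForm β e u y)) hy.ne').sprayVec_eq he hu
    energy_kropina (isUnit_det_kropina he hu hy) ?_ rfl rfl ?_ ?_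
  · simp only
    field_simp
  all_goals
    simp only [kProj]
    field_simp
    ring

end Formulas
end FinslerProj

/-! ### Parallel vectors and algebraic lemmas -/

namespace FinslerProj

section Parallel

variable {n : ℕ}

/-- The vectors `X` and `y` are linearly dependent. -/
def Par (X y : Coord n) : Prop := ∀ i j, X i * y j = X j * y i

theorem Par.add {X X' y : Coord n} (h : Par X y) (h' : Par X' y) : Par (X + X') y := by
  intro i j
  have h1 := h i j
  have h2 := h' i j
  simp only [PiLp.add_apply]
  linarith

theorem Par.smul {X y : Coord n} (h : Par X y) (c : ℝ) : Par (c • X) y := by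
  intro i j
  have h1 := h i j
  simp only [PiLp.smul_apply, smul_eq_mul]
  linear_combination c * h1

theorem Par.neg {X y : Coord n} (h : Par X y) : Par (-X) y := by
  simpa using h.smul (-1)

theorem Par.sub {X X' y : Coord n} (h : Par X y) (h' : Par X' y) : Par (X - X') y := by
  simpa [sub_eq_add_neg] using h.add h'.neg

theorem par_smul_self (c : ℝ) (y : Coord n) : Par (c • y) y := by
  intro i j
  simp only [PiLp.smul_apply, smul_eq_mul]
  ring

theorem Par.neg_right {X y : Coord n} (h : Par X (-y)) : Par X y := by
  intro i j
  have := h i j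
  simp only [PiLp.neg_apply] at this
  linarith

theorem Par.exists_smul {X y : Coord n} (h : Par X y) (hy : y ≠ 0) : ∃ c : ℝ, X = c • y := by
  have : ∃ j, y j ≠ 0 := by
    by_contra hc
    push Not at hc
    exact hy (by ext j; exact hc j)
  obtain ⟨j, hj⟩ := this
  refine ⟨X j / y j, ?_⟩
  ext i
  have := h i j
  simp only [PiLp.smul_apply, smul_eq_mul]
  field_simp
  linarith

theorem Par.of_smul {X y : Coord n} {c : ℝ} (hc : c ≠ 0) (h : Par (c • X) y) : Par X y := by
  simpa [smul_smul, inv_mul_cancel₀ hc] using h.smul c⁻¹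

/-- Dependence is the vanishing of the 2×2 minors, a closed condition. Stating it without a factor
allows limits in which the factor itself may blow up. -/
theorem Par.of_tendsto {ι : Type*} {l : Filter ι} [l.NeBot] {X Y : ι → Coord n}
    {X₀ Y₀ : Coord n} (hX : Filter.Tendsto X l (nhds X₀)) (hY : Filter.Tendsto Y l (nhds Y₀))
    (h : ∀ᶠ t in l, Par (X t) (Y t)) : Par X₀ Y₀ := by
  intro i j
  have hp : ∀ k, Continuous fun x : Coord n => x k := fun k =>
    (EuclideanSpace.proj k : Coord n →L[ℝ] ℝ).continuous
  have h1 := (((hp i).tendsto _).comp hX).mul (((hp j).tendsto _).comp hY)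
  have h2 := (((hp j).tendsto _).comp hX).mul (((hp i).tendsto _).comp hY)
  refine tendsto_nhds_unique h1 (h2.congr' ?_)
  filter_upwards [h] with t ht
  exact (ht i j).symm

/-- A symmetric bilinear map `T` with `T(y, y)` parallel to `y` is determined by its trace. -/
theorem bilinear_eq_trace_of_par {T : Coord n → Coord n → Coord n}
    (hadd : ∀ y y' z, T (y + y') z = T y z + T y' z)
    (hsmul : ∀ (c : ℝ) y z, T (c • y) z = c • T y z) (hsymm : ∀ y z, T y z = T z y)
    (h : ∀ y, Par (T y y) y) (y : Coord n) :
    ((n : ℝ) + 1) • T y y = (2 * ∑ m, T y (stdVec m) m) • y := by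
  have hadd' : ∀ y z z', T y (z + z') = T y z + T y z' := fun y z z' => by
    rw [hsymm, hadd, hsymm z, hsymm z']
  have hsmul' : ∀ (c : ℝ) y z, T y (c • z) = c • T y z := fun c y z => by
    rw [hsymm, hsmul, hsymm]
  -- Polarisation: the part of the cubic identity that is odd in `z`, with the pure `z` term
  -- removed.
  have hpol : ∀ z i j, 2 * T y z i * y j + T y y i * z j = 2 * T y z j * y i + T y y j * z i := by
    intro z i j
    have h1 := h (y + z) i j
    have h2 := h (y + (-1 : ℝ) • z) i j
    have h3 := h z i j
    simp only [hadd, hadd', hsmul, hsmul', hsymm z y, PiLp.add_apply, PiLp.smul_apply,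
      smul_eq_mul] at h1 h2
    linarith
  have hsum : ∀ i, ∑ j, T y (stdVec j) i * y j = T y y i := by
    intro i
    conv_rhs => rw [hsymm, ← sum_smul_stdVec y]
    let S : Coord n →ₗ[ℝ] Coord n :=
      { toFun := fun z => T z y
        map_add' := fun a b => hadd a b y
        map_smul' := fun c a => hsmul c a y }
    have : T (∑ i, y i • stdVec i) (∑ i, y i • stdVec i) = S (∑ i, y i • stdVec i) := by
      simp only [sum_smul_stdVec]
      rfl
    rw [this, map_sum, WithLp.ofLp_sum, Finset.sum_apply]
    refine Finset.sum_congr rfl fun j _ => ?_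
    rw [map_smul, PiLp.smul_apply, smul_eq_mul, hsymm]
    exact mul_comm _ _
  ext i
  -- Contraction of the polarised identity over `z = e_j`. The left side gives `(n + 2) T(y, y)ⁱ`,
  -- the right side the trace term plus one `T(y, y)ⁱ`, whence the factor `n + 1`.
  have h1 : ∑ j, (2 * T y (stdVec j) i * y j + T y y i * (stdVec j : Coord n) j) =
      ∑ j, (2 * T y (stdVec j) j * y i + T y y j * (stdVec j : Coord n) i) :=
    Finset.sum_congr rfl fun j _ => hpol (stdVec j) i j
  have hs1 : ∀ j : Fin n, (stdVec j : Coord n) j = 1 := fun j => by simp [stdVec]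
  have hs2 : ∑ j, T y y j * (stdVec j : Coord n) i = T y y i := by
    simp [stdVec]
  rw [Finset.sum_add_distrib, Finset.sum_add_distrib, hs2] at h1
  simp only [hs1, mul_one, Finset.sum_const, Finset.card_univ, Fintype.card_fin, nsmul_eq_mul,
    mul_assoc, ← Finset.mul_sum, hsum] at h1
  rw [← Finset.sum_mul] at h1
  simp only [PiLp.smul_apply, smul_eq_mul]
  linarith

end Parallel

/-! ### Polynomial identities in one variable containing a square root -/

section ScalarLemmas

theorem quintic_coeff_eq_zero {c₀ c₁ c₂ c₃ c₄ c₅ : ℝ}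
    (h : ∀ t : ℝ, c₀ + c₁ * t + c₂ * t ^ 2 + c₃ * t ^ 3 + c₄ * t ^ 4 + c₅ * t ^ 5 = 0) :
    c₀ = 0 ∧ c₁ = 0 ∧ c₂ = 0 ∧ c₃ = 0 ∧ c₄ = 0 ∧ c₅ = 0 := by
  have h0 := h 0
  have h1 := h 1
  have h2 := h (-1)
  have h3 := h 2
  have h4 := h (-2)
  have h5 := h 3
  norm_num at h0 h1 h2 h3 h4 h5
  refine ⟨?_, ?_, ?_, ?_, ?_, ?_⟩ <;> linarith

open Polynomial in
-- Infinite descent, as for the irrationality of the root of a prime: `A` divides `P`, then `Q`, and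
-- cancelling gives a solution of smaller degree.
theorem eq_zero_of_sq_eq_irreducible_mul_sq {A : ℝ[X]} (hA : Irreducible A) :
    ∀ (d : ℕ) (P Q : ℝ[X]), Q.natDegree < d → P ^ 2 = A * Q ^ 2 → Q = 0 := by
  have hp : Prime A := hA.prime
  intro d
  induction d with
  | zero => intro P Q h; omega
  | succ d ih =>
    intro P Q hQ h
    by_contra hne
    obtain ⟨S, rfl⟩ := hp.dvd_of_dvd_pow (Dvd.intro _ h.symm)
    have h1 : Q ^ 2 = A * S ^ 2 := mul_left_cancel₀ hA.ne_zero (by rw [← h]; ring)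
    obtain ⟨T, rfl⟩ := hp.dvd_of_dvd_pow (Dvd.intro _ h1.symm)
    have h2 : S ^ 2 = A * T ^ 2 := mul_left_cancel₀ hA.ne_zero (by rw [← h1]; ring)
    have hT : T ≠ 0 := right_ne_zero_of_mul hne
    have hdeg : 0 < A.natDegree := hA.natDegree_pos
    rw [natDegree_mul hA.ne_zero hT] at hQ
    exact hT (ih S T (by omega) h2)

open Polynomial in
-- The radicand is a quadratic without real roots, hence irreducible, and so its root is not a
-- rational function.
theorem eq_zero_of_add_sqrt_mul {B W : ℝ} (hB : 0 < B) (hW : 0 < W) {P Q : ℝ[X]}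
    (h : ∀ t : ℝ, P.eval t + √(B + W * t ^ 2) * Q.eval t = 0) : Q = 0 := by
  have hA : Irreducible (C B + C W * X ^ 2 : ℝ[X]) := by
    have hd : (C B + C W * X ^ 2 : ℝ[X]).natDegree = 2 := by
      rw [show (C B + C W * X ^ 2 : ℝ[X]) = C W * X ^ 2 + C 0 * X + C B by simp; ring]
      exact natDegree_quadratic hW.ne'
    refine irreducible_of_degree_le_three_of_not_isRoot (by rw [hd]; decide) fun x hx => ?_
    simp only [IsRoot.def, eval_add, eval_C, eval_mul, eval_pow, eval_X] at hx
    nlinarith [mul_nonneg hW.le (sq_nonneg x)]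
  refine eq_zero_of_sq_eq_irreducible_mul_sq hA (Q.natDegree + 1) P Q (Nat.lt_succ_self _) ?_
  refine Polynomial.funext fun t => ?_
  have h1 : P.eval t = -(√(B + W * t ^ 2) * Q.eval t) := by linarith [h t]
  have h2 : 0 ≤ B + W * t ^ 2 := by positivity
  simp only [eval_pow, eval_mul, eval_add, eval_C, eval_X, h1, neg_sq, mul_pow, Real.sq_sqrt h2]

open Polynomial in
theorem cubic_eq_zero_of_add_sqrt_mul {B W : ℝ} (hB : 0 < B) (hW : 0 < W) {P : ℝ[X]}
    {n₀ n₁ n₂ n₃ : ℝ}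
    (h : ∀ t : ℝ, P.eval t + √(B + W * t ^ 2) * (n₀ + n₁ * t + n₂ * t ^ 2 + n₃ * t ^ 3) = 0)
    (t : ℝ) : n₀ + n₁ * t + n₂ * t ^ 2 + n₃ * t ^ 3 = 0 := by
  have := eq_zero_of_add_sqrt_mul hB hW (P := P)
    (Q := C n₀ + C n₁ * X + C n₂ * X ^ 2 + C n₃ * X ^ 3) (by simpa using h)
  simpa using congrArg (eval t) this

open Polynomial in
/-- The restriction of the projective equation to a line `b + t w` with `w` orthogonal to `b`,
where `B = |b|²`, `W = |w|²`. -/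
theorem quadratic_of_line {q B W η n₀ n₁ n₂ n₃ r₀ r₁ r₂ : ℝ} (hq0 : q ≠ 0) (hq1 : q ≠ 1)
    (hB : 0 < B) (hB1 : B < 1) (hW : 0 < W) (hη : η ≠ 0)
    (h : ∀ t : ℝ, q * (q - 1) * (B + W * t ^ 2) * (r₀ + 2 * r₁ * t + r₂ * t ^ 2) * (t * W * B) +
      2 * ((1 - q ^ 2) * B ^ 2 + (2 - q) * √(B + W * t ^ 2) * (η * B) +
        (1 + (q ^ 2 - q) * B) * (B + W * t ^ 2)) * (n₀ + n₁ * t + n₂ * t ^ 2 + n₃ * t ^ 3) = 0) :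
    r₁ = 0 ∧ (q ≠ 2 → r₀ = 0 ∧ r₂ = 0) ∧ (q = 2 → r₂ * (B * (1 - B)) = r₀ * ((1 + 2 * B) * W)) := by
  rcases eq_or_ne q 2 with rfl | hq2
  -- At `q = 2` the root has coefficient zero and the bracket becomes `B (1 - B) + (1 + 2B) W t²`.
  -- This quadratic is coprime to `t (B + W t²)`, so it divides `r₀ + 2 r₁ t + r₂ t²`. The
  -- conclusions state this proportionality, obtained by eliminating the `nᵢ` from the six
  -- coefficients.
  · obtain ⟨c0, c1, c2, c3, c4, c5⟩ := quintic_coeff_eq_zero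
      (c₀ := n₀ * (B * (1 - B)))
      (c₁ := W * B * B * r₀ + n₁ * (B * (1 - B)))
      (c₂ := 2 * W * B * B * r₁ + n₂ * (B * (1 - B)) + n₀ * ((1 + 2 * B) * W))
      (c₃ := W * B * (B * r₂ + W * r₀) + n₃ * (B * (1 - B)) + n₁ * ((1 + 2 * B) * W))
      (c₄ := 2 * W * B * W * r₁ + n₂ * ((1 + 2 * B) * W))
      (c₅ := W * B * W * r₂ + n₃ * ((1 + 2 * B) * W))
      (fun t => by linear_combination (1 / 2) * h t)
    have hE0 : B * (1 - B) ≠ 0 := (mul_pos hB (by linarith)).ne'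
    have hn0 : n₀ = 0 := (mul_eq_zero.1 c0).resolve_right hE0
    -- The factor `3 B²` is the elimination determinant of `B + W t²` and the bracket: `B (1 + 2B) -
    -- B (1 - B)`.
    have hk : 2 * W * B * W * (3 * B ^ 2) ≠ 0 := by positivity
    refine ⟨?_, fun h => absurd rfl h, fun _ => ?_⟩
    · refine (mul_eq_zero.1 ?_).resolve_left hk
      rw [hn0] at c2
      linear_combination ((1 + 2 * B) * W) * c2 - (B * (1 - B)) * c4
    · have hk' : W * B * W * (3 * B ^ 2) ≠ 0 := by positivity
      refine sub_eq_zero.1 ((mul_eq_zero.1 ?_).resolve_left hk')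
      linear_combination (B * (1 - B)) * ((1 + 2 * B) * W) * c3 -
        (B * (1 - B)) ^ 2 * c5 - ((1 + 2 * B) * W) ^ 2 * c1
  -- For `q ≠ 2` the coefficient of the root is a nonzero multiple of the cubic, which therefore
  -- vanishes identically and leaves the `r` term alone.
  · have hN := cubic_eq_zero_of_add_sqrt_mul hB hW
      (P := C (q * (q - 1)) * (C B + C W * X ^ 2) * (C r₀ + C (2 * r₁) * X + C r₂ * X ^ 2) *
        (X * C W * C B) + C 2 * (C ((1 - q ^ 2) * B ^ 2) + C (1 + (q ^ 2 - q) * B) *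
        (C B + C W * X ^ 2)) * (C n₀ + C n₁ * X + C n₂ * X ^ 2 + C n₃ * X ^ 3))
      (n₀ := 2 * (2 - q) * (η * B) * n₀) (n₁ := 2 * (2 - q) * (η * B) * n₁)
      (n₂ := 2 * (2 - q) * (η * B) * n₂) (n₃ := 2 * (2 - q) * (η * B) * n₃) (fun t => by
        simp only [eval_add, eval_mul, eval_C, eval_X, eval_pow]
        linear_combination h t)
    have hc : 2 * (2 - q) * (η * B) ≠ 0 :=
      mul_ne_zero (mul_ne_zero two_ne_zero (sub_ne_zero.2 hq2.symm)) (mul_ne_zero hη hB.ne')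
    have hr : ∀ t : ℝ, t ≠ 0 → r₀ + 2 * r₁ * t + r₂ * t ^ 2 = 0 := by
      intro t ht
      have h1 : n₀ + n₁ * t + n₂ * t ^ 2 + n₃ * t ^ 3 = 0 := by
        refine (mul_eq_zero.1 ?_).resolve_left hc
        linear_combination hN t
      have h2 := h t
      rw [h1, mul_zero, add_zero] at h2
      have h3 : B + W * t ^ 2 ≠ 0 := by positivity
      refine (mul_eq_zero.1 ((mul_eq_zero.1 h2).resolve_right
        (mul_ne_zero (mul_ne_zero ht hW.ne') hB.ne'))).resolve_left ?_
      exact mul_ne_zero (mul_ne_zero hq0 (sub_ne_zero.2 hq1)) h3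
    have h1 := hr 1 one_ne_zero
    have h2 := hr (-1) (by norm_num)
    have h3 := hr 2 two_ne_zero
    norm_num at h1 h2 h3
    exact ⟨by linarith, fun _ => ⟨by linarith, by linarith⟩, fun h => absurd h hq2⟩

end ScalarLemmas
end FinslerProj

/-! ### Structure of the skew part of the covariant derivative -/

namespace FinslerProj
variable {n : ℕ} {M : Type*} [TopologicalSpace M] [ChartedSpace (EuclideanSpace ℝ (Fin n)) M]
  [IsManifold (𝓡 n) ∞ M]

section Structure

variable {a : RiemMetric n M} {β : OneForm n M} {e : OpenPartialHomeomorph M (Coord n)}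
  {u : Coord n}

theorem bilin_add_left (C : Fin n → Fin n → ℝ) (x y z : Coord n) :
    ∑ i, ∑ j, C i j * (x + y) i * z j =
      (∑ i, ∑ j, C i j * x i * z j) + ∑ i, ∑ j, C i j * y i * z j := by
  simp only [PiLp.add_apply, mul_add, add_mul, Finset.sum_add_distrib]

theorem bilin_smul_left (C : Fin n → Fin n → ℝ) (c : ℝ) (y z : Coord n) :
    ∑ i, ∑ j, C i j * (c • y) i * z j = c * ∑ i, ∑ j, C i j * y i * z j := by
  simp only [PiLp.smul_apply, smul_eq_mul, Finset.mul_sum]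
  exact Finset.sum_congr rfl fun i _ => Finset.sum_congr rfl fun j _ => by ring

theorem bilin_add_right (C : Fin n → Fin n → ℝ) (x y z : Coord n) :
    ∑ i, ∑ j, C i j * x i * (y + z) j =
      (∑ i, ∑ j, C i j * x i * y j) + ∑ i, ∑ j, C i j * x i * z j := by
  simp only [PiLp.add_apply, mul_add, Finset.sum_add_distrib]

theorem bilin_smul_right (C : Fin n → Fin n → ℝ) (c : ℝ) (y z : Coord n) :
    ∑ i, ∑ j, C i j * y i * (c • z) j = c * ∑ i, ∑ j, C i j * y i * z j := by
  simp only [PiLp.smul_apply, smul_eq_mul, Finset.mul_sum]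
  exact Finset.sum_congr rfl fun i _ => Finset.sum_congr rfl fun j _ => by ring

theorem continuous_bilin (C : Fin n → Fin n → ℝ) :
    Continuous fun p : Coord n × Coord n => ∑ i, ∑ j, C i j * p.1 i * p.2 j := by
  have h1 : ∀ k, Continuous fun x : Coord n => x k := fun k =>
    (EuclideanSpace.proj k : Coord n →L[ℝ] ℝ).continuous
  refine continuous_finsetSum _ fun i _ => continuous_finsetSum _ fun j _ => ?_
  exact (continuous_const.mul ((h1 i).comp continuous_fst)).mul ((h1 j).comp continuous_snd)

theorem rForm_add_left (x y z : Coord n) :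
    rForm a β e u (x + y) z = rForm a β e u x z + rForm a β e u y z := bilin_add_left _ x y z
theorem rForm_smul_left (c : ℝ) (y z : Coord n) :
    rForm a β e u (c • y) z = c * rForm a β e u y z := bilin_smul_left _ c y z
theorem rForm_add_right (x y z : Coord n) :
    rForm a β e u x (y + z) = rForm a β e u x y + rForm a β e u x z := bilin_add_right _ x y z
theorem rForm_smul_right (c : ℝ) (y z : Coord n) :
    rForm a β e u y (c • z) = c * rForm a β e u y z := bilin_smul_right _ c y z
theorem sForm_add_right (x y z : Coord n) :
    sForm a β e u x (y + z) = sForm a β e u x y + sForm a β e u x z := bilin_add_right _ x y z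
theorem sForm_smul_right (c : ℝ) (y z : Coord n) :
    sForm a β e u y (c • z) = c * sForm a β e u y z := bilin_smul_right _ c y z

theorem sForm_self (y : Coord n) : sForm a β e u y y = 0 := by
  have := sForm_neg_swap a β (e := e) (u := u) y y
  linarith

theorem christoffelVec_add_left (x y z : Coord n) : christoffelVec a e u (x + y) z =
    christoffelVec a e u x z + christoffelVec a e u y z := by
  ext k
  exact bilin_add_left _ x y z

theorem christoffelVec_smul_left (c : ℝ) (y z : Coord n) :
    christoffelVec a e u (c • y) z = c • christoffelVec a e u y z := by
  ext k
  exact bilin_smul_left _ c y z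

theorem continuous_gForm : Continuous fun y : Coord n => gForm a e u y y :=
  (continuous_bilin (aComp a e u)).comp (continuous_id.prodMk continuous_id)

theorem continuous_rForm : Continuous fun y : Coord n => rForm a β e u y y :=
  (continuous_bilin (rTen a β e u)).comp (continuous_id.prodMk continuous_id)

theorem continuous_sForm (x : Coord n) : Continuous fun y : Coord n => sForm a β e u x y :=
  (continuous_bilin (sTen a β e u)).comp (continuous_const.prodMk continuous_id)

theorem continuous_coord (k : Fin n) : Continuous fun x : Coord n => x k :=
  (EuclideanSpace.proj k : Coord n →L[ℝ] ℝ).continuous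

theorem continuous_bForm : Continuous fun y : Coord n => bForm β e u y :=
  continuous_finsetSum _ fun i _ => continuous_const.mul (continuous_coord i)

theorem continuous_toCoord {X : Type*} [TopologicalSpace X] {f : X → Fin n → ℝ}
    (h : ∀ i, Continuous fun x => f x i) : Continuous fun x => (WithLp.toLp 2 (f x) : Coord n) :=
  (PiLp.continuous_toLp 2 _).comp (continuous_pi h)

theorem continuous_christoffelVec : Continuous fun y : Coord n => christoffelVec a e u y y :=
  continuous_toCoord fun _ => (continuous_bilin _).comp (continuous_id.prodMk continuous_id)

theorem continuous_sMap : Continuous fun y : Coord n => sMap a β e u y := by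
  refine continuous_toCoord fun i => ?_
  change Continuous fun y : Coord n => ∑ j, (aComp a e u)⁻¹ i j * ∑ k, sTen a β e u j k * y k
  refine continuous_finsetSum _ fun j _ => continuous_const.mul ?_
  exact continuous_finsetSum _ fun k _ => continuous_const.mul (continuous_coord k)

theorem continuous_sprayVec_rnorm (he : e ∈ charts n M) (hu : u ∈ e.target) :
    Continuous fun y : Coord n => sprayVec (rnorm a) e u y := by
  simp only [sprayVec_rnorm a he hu]
  exact continuous_christoffelVec.const_smul (1 / 2 : ℝ)

theorem sprayVec_rnorm_neg (he : e ∈ charts n M) (hu : u ∈ e.target) (y : Coord n) :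
    sprayVec (rnorm a) e u (-y) = sprayVec (rnorm a) e u y := by
  rw [sprayVec_rnorm a he hu, sprayVec_rnorm a he hu, ← neg_one_smul ℝ y,
    christoffelVec_smul_left, christoffelVec_symm, christoffelVec_smul_left, smul_smul]
  norm_num

theorem sMap_smul (he : e ∈ charts n M) (hu : u ∈ e.target) (c : ℝ) (y : Coord n) :
    sMap a β e u (c • y) = c • sMap a β e u y :=
  eq_of_gForm_eq a he hu fun z => by
    rw [gForm_smul_left, gForm_sMap a β he hu, gForm_sMap a β he hu, sForm_smul_right]

theorem sMap_add (he : e ∈ charts n M) (hu : u ∈ e.target) (x y : Coord n) :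
    sMap a β e u (x + y) = sMap a β e u x + sMap a β e u y :=
  eq_of_gForm_eq a he hu fun z => by
    simp only [gForm_add_left, gForm_sMap a β he hu, sForm_add_right]

/-- A multiple of `y` that is orthogonal to `y` is zero; skew-symmetry of `s_ij` supplies the
orthogonality when parallelism is to become an equality. -/
theorem Par.eq_zero_of_gForm (he : e ∈ charts n M) (hu : u ∈ e.target) {X y : Coord n}
    (h : Par X y) (hy : y ≠ 0) (h0 : gForm a e u X y = 0) : X = 0 := by
  obtain ⟨c, rfl⟩ := h.exists_smul hy
  rw [gForm_smul_left] at h0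
  rw [(mul_eq_zero.1 h0).resolve_right (gForm_pos a he hu hy).ne', zero_smul]

/-- The component of `y` orthogonal to `b`. -/
theorem bForm_sub_proj (hb : bSq a β e u ≠ 0) (y : Coord n) :
    bForm β e u (y + (-(bForm β e u y / bSq a β e u)) • bVec a β e u) = 0 := by
  rw [bForm_add, bForm_smul, bForm_bVec]
  field_simp
  ring

/-- For `w` in the kernel of `β` the parallel vector is orthogonal to `w`, since `s(w, w) = 0` and
`b ⟂ w`, so it vanishes. Any `y` splits into such a `w` and a multiple of `b`, where the value is
`-sⁱ`. -/
theorem sMap_eq_of_par (he : e ∈ charts n M) (hu : u ∈ e.target) (hb : bSq a β e u ≠ 0)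
    (h : ∀ w, w ≠ 0 → bForm β e u w = 0 →
      Par (sMap a β e u w - (sForm a β e u (bVec a β e u) w / bSq a β e u) • bVec a β e u) w)
    (y : Coord n) : sMap a β e u y = (1 / bSq a β e u) •
      (sForm a β e u (bVec a β e u) y • bVec a β e u - bForm β e u y • sVec a β e u) := by
  have h1 : ∀ w, bForm β e u w = 0 → sMap a β e u w =
      (sForm a β e u (bVec a β e u) w / bSq a β e u) • bVec a β e u := by
    intro w hw
    rcases eq_or_ne w 0 with rfl | hw0
    · have h0 := sMap_smul (a := a) (β := β) he hu 0 0
      simp only [zero_smul] at h0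
      have h2 : sForm a β e u (bVec a β e u) 0 = 0 := by
        rw [← zero_smul ℝ (0 : Coord n), sForm_smul_right, zero_mul]
      rw [h0, h2, zero_div, zero_smul]
    · refine sub_eq_zero.1 ((h w hw0 hw).eq_zero_of_gForm (a := a) he hu hw0 ?_)
      rw [sub_eq_add_neg, ← neg_smul, gForm_add_left, gForm_smul_left, gForm_sMap a β he hu,
        gForm_bVec a β he hu, sForm_self, hw]
      ring
  set c := bSq a β e u
  set k := bForm β e u y / c with hk
  set w := y + (-k) • bVec a β e u with hw
  have hw0 : bForm β e u w = 0 := bForm_sub_proj hb y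
  have hy : y = w + k • bVec a β e u := by rw [hw]; module
  have hsb : sMap a β e u (bVec a β e u) = -sVec a β e u :=
    eq_of_gForm_eq a he hu fun z => by
      rw [gForm_sMap a β he hu, ← neg_one_smul ℝ, gForm_smul_left, gForm_sVec a β he hu,
        sForm_neg_swap]
      ring
  have hsw : sForm a β e u (bVec a β e u) w = sForm a β e u (bVec a β e u) y := by
    rw [hw, sForm_add_right, sForm_smul_right, sForm_self]
    ring
  have : sMap a β e u y = sMap a β e u w + k • sMap a β e u (bVec a β e u) := by
    rw [← sMap_smul he hu, ← sMap_add he hu, ← hy]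
  rw [this, h1 w hw0, hsb, hsw, hk]
  module

/-- The coefficients `(α² sⁱ + r₀₀ bⁱ) / (2 b²)`. -/
def kQuad (a : RiemMetric n M) (β : OneForm n M) (e : OpenPartialHomeomorph M (Coord n))
    (u y z : Coord n) : Coord n :=
  (1 / (2 * bSq a β e u)) • (gForm a e u y z • sVec a β e u + rForm a β e u y z • bVec a β e u)

theorem sprayVec_kropina_eq_kQuad (he : e ∈ charts n M) (hu : u ∈ e.target)
    (h : ∀ y, sMap a β e u y = (1 / bSq a β e u) •
      (sForm a β e u (bVec a β e u) y • bVec a β e u - bForm β e u y • sVec a β e u))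
    {y : Coord n} (hy : 0 < bForm β e u y) :
    sprayVec (kropina a β) e u y = sprayVec (rnorm a) e u y + kQuad a β e u y y +
      kProj a β e u y • y := by
  rw [sprayVec_kropina he hu hy, h, kQuad]
  have hy' := hy.ne'
  match_scalars <;> field_simp <;> ring

theorem tendsto_line (w v : Coord n) : Filter.Tendsto (fun ε : ℝ => w + ε • v)
    (nhdsWithin 0 (Set.Ioi 0)) (nhds w) := by
  have : Continuous fun ε : ℝ => w + ε • v := by fun_prop
  have h := this.tendsto 0
  simp only [zero_smul, add_zero] at h
  exact h.mono_left nhdsWithin_le_nhds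

/-- If the Kropina spray agrees, modulo `y`, with a field which is not too singular along the
boundary of the cone, then `s_ij` has the form characterising Douglas Kropina metrics. -/
theorem sMap_eq_of_boundary (he : e ∈ charts n M) (hu : u ∈ e.target) (hb : 0 < bSq a β e u)
    {X : Coord n → Coord n}
    (hX : ∀ y, 0 < bForm β e u y → Par (sprayVec (kropina a β) e u y - X y) y)
    (hlim : ∀ w, w ≠ 0 → bForm β e u w = 0 →
      Filter.Tendsto (fun ε : ℝ => ε • X (w + ε • bVec a β e u)) (nhdsWithin 0 (Set.Ioi 0))
        (nhds 0)) (y : Coord n) :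
    sMap a β e u y = (1 / bSq a β e u) •
      (sForm a β e u (bVec a β e u) y • bVec a β e u - bForm β e u y • sVec a β e u) := by
  refine sMap_eq_of_par he hu hb.ne' (fun w hw0 hw => ?_) y
  set c := bSq a β e u with hc
  set b := bVec a β e u with hbv
  have hA := gForm_pos a he hu hw0
  have hline := tendsto_line w b
  have hlineb : ∀ ε : ℝ, bForm β e u (w + ε • b) = ε * c := by
    intro ε
    rw [bForm_add, bForm_smul, hw, bForm_bVec, zero_add]
  -- The Kropina spray minus `X` at `w + ε b`, multiplied by `ε` and without its multiple of the
  -- position. Since `β = ε b²` on this line, the `1/β` pole becomes a finite limit, equal to the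
  -- residue at `w`.
  let Y : ℝ → Coord n := fun ε =>
    ε • (sprayVec (rnorm a) e u (w + ε • b) +
      (rForm a β e u (w + ε • b) (w + ε • b) / (2 * c)) • b) +
    (-(gForm a e u (w + ε • b) (w + ε • b)) / (2 * c)) •
      (sMap a β e u (w + ε • b) - (sForm a β e u b (w + ε • b) / c) • b) -
    ε • X (w + ε • b)
  have hε : Filter.Tendsto (fun ε : ℝ => ε) (nhdsWithin 0 (Set.Ioi 0)) (nhds 0) :=
    Filter.tendsto_id.mono_left nhdsWithin_le_nhds
  have hY : Filter.Tendsto Y (nhdsWithin 0 (Set.Ioi 0)) (nhds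
      ((-(gForm a e u w w) / (2 * c)) • (sMap a β e u w - (sForm a β e u b w / c) • b))) := by
    have h1 := ((continuous_sprayVec_rnorm (a := a) he hu).tendsto w).comp hline
    have h2 := ((continuous_rForm (a := a) (β := β) (e := e) (u := u)).tendsto w).comp hline
    have h3 := ((continuous_gForm (a := a) (e := e) (u := u)).tendsto w).comp hline
    have h4 := ((continuous_sMap (a := a) (β := β) (e := e) (u := u)).tendsto w).comp hline
    have h5 := ((continuous_sForm (a := a) (β := β) (e := e) (u := u) b).tendsto w).comp hline
    have := ((hε.smul (h1.add ((h2.div_const (2 * c)).smul_const b))).add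
      ((h3.neg.div_const (2 * c)).smul (h4.sub ((h5.div_const c).smul_const b)))).sub
      (hlim w hw0 hw)
    simpa [Y] using this
  have hpar : ∀ᶠ ε in nhdsWithin (0 : ℝ) (Set.Ioi 0), Par (Y ε) (w + ε • b) := by
    filter_upwards [self_mem_nhdsWithin] with ε hε
    have hεpos : (0 : ℝ) < ε := hε
    have hpos : 0 < bForm β e u (w + ε • b) := by
      rw [hlineb]
      exact mul_pos hεpos hb
    have h1 := ((hX _ hpos).smul ε).sub (par_smul_self (ε * kProj a β e u (w + ε • b))
      (w + ε • b))
    rw [sprayVec_kropina he hu hpos, hlineb] at h1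
    convert h1 using 1
    simp only [Y, ← hc, ← hbv]
    match_scalars <;> field_simp <;> ring
  exact (Par.of_tendsto hY hline hpar).of_smul (div_ne_zero (neg_ne_zero.2 hA.ne') (by positivity))

/-- The skew part vanishes if the spray of `(α + β)^q / α^(q-1)` is even modulo `y` along a
hyperplane contained in the kernel of `β`. -/
theorem IsQMetric.sForm_eq_zero {q : ℝ} (hF : IsQMetric q a β) (hn : 3 ≤ n)
    (he : e ∈ charts n M) (hu : u ∈ e.target) (hq : q ≠ 0) {a' : RiemMetric n M}
    {β' : OneForm n M} (hb : bSq a' β' e u ≠ 0)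
    (hker : ∀ w, bForm β' e u w = 0 → bForm β e u w = 0)
    (h : ∀ w, w ≠ 0 → bForm β' e u w = 0 →
      Par (sprayVec (qMetric q a β) e u w - sprayVec (qMetric q a β) e u (-w)) w)
    (y z : Coord n) : sForm a β e u y z = 0 := by
  have key : ∀ w x, bForm β' e u w = 0 → sForm a β e u x w = 0 := by
    intro w x hw
    rcases eq_or_ne w 0 with rfl | hw0
    · rw [← zero_smul ℝ (0 : Coord n), sForm_smul_right, zero_mul]
    have hβ := hker w hw
    have hA := gForm_pos a he hu hw0
    have hs := Real.sqrt_pos.2 hA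
    have hsq := Real.sq_sqrt hA.le
    have hE := hF.denE_pos hn he hu hw0
    have hn1 : ∀ z, gForm a e u (-w) (-w) = gForm a e u w w ∧
        rForm a β e u (-w) (-w) = rForm a β e u w w ∧ bForm β e u (-w) = 0 ∧
        sForm a β e u z (-w) = -sForm a β e u z w ∧ sMap a β e u (-w) = - sMap a β e u w := by
      intro z
      rw [← neg_one_smul ℝ w]
      simp only [gForm_smul_left, gForm_smul_right, rForm_smul_left, rForm_smul_right,
        sForm_smul_right, bForm_smul, hβ, sMap_smul he hu]
      refine ⟨by ring, by ring, by ring, by ring, by module⟩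
    obtain ⟨e1, e2, e3, e4, e5⟩ := hn1 (bVec a β e u)
    have hEE : denE q a β e u w = (1 + (q ^ 2 - q) * bSq a β e u) * gForm a e u w w := by
      rw [denE, hβ]
      ring
    have hκ : 0 < 1 + (q ^ 2 - q) * bSq a β e u := by
      rw [hEE] at hE
      exact (mul_pos_iff_of_pos_right hA).1 hE
    have h1 := h w hw0 hw
    rw [hF.sprayVec_eq hn he hu hw0, hF.sprayVec_eq hn he hu (neg_ne_zero.2 hw0),
      sprayVec_rnorm_neg he hu] at h1
    simp only [qNormal, denD, denE, e1, e2, e3, e4, e5, hβ, mul_zero, add_zero, zero_add, ne_eq,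
      OfNat.ofNat_ne_zero, not_false_eq_true, zero_pow] at h1
    set A := gForm a e u w w
    set s := √A
    set κ := 1 + (q ^ 2 - q) * bSq a β e u with hκd
    set s0 := sForm a β e u (bVec a β e u) w with hs0
    have hA2 : A = s ^ 2 := hsq.symm
    have hκ' := hκ.ne'
    -- On `β = 0` one has `denD = s` and `denE = κ A`, so twice the odd part is `2 q s` times this
    -- vector, modulo `w`.
    have hZ : Par (sMap a β e u w + (-(q * (q - 1) * s0 / κ)) • bVec a β e u) w := by
      refine Par.of_smul (c := 2 * q * s) (mul_ne_zero (mul_ne_zero two_ne_zero hq) hs.ne') ?_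
      have h2 := (h1.sub (par_smul_self (qProj q a β e u w + qProj q a β e u (-w)) w))
      convert h2 using 1
      rw [hA2]
      match_scalars <;> field_simp <;> ring
    have hZ0 := hZ.eq_zero_of_gForm (a := a) he hu hw0 (by
      rw [gForm_add_left, gForm_smul_left, gForm_sMap a β he hu, gForm_bVec a β he hu, sForm_self,
        hβ]
      ring)
    -- Pairing with `b` gives `s0 (1 - (q² - q) b² / κ) = s0 / κ`.
    have hs00 : s0 = 0 := by
      have h3 := congrArg (gForm a e u (bVec a β e u)) hZ0
      rw [gForm_zero_right, gForm_add_right, gForm_smul_right, gForm_comm,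
        gForm_sMap a β he hu, gForm_bVec a β he hu, bForm_bVec, ← hs0] at h3
      field_simp at h3
      have h4 : s0 * 1 = 0 := by
        rw [hκd] at h3
        linear_combination h3
      simpa using h4
    rw [hs00] at hZ0
    have h5 : sMap a β e u w = 0 := by simpa using hZ0
    rw [← gForm_sMap a β he hu, h5, gForm_comm, gForm_zero_right]
  have hy := bForm_sub_proj (a := a') (β := β') hb y
  have hz := bForm_sub_proj (a := a') (β := β') hb z
  have h1 := key _ y hz
  have h2 := key _ (bVec a' β' e u) hy
  rw [sForm_add_right, sForm_smul_right] at h1 h2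
  rw [sForm_self] at h2
  have h3 := sForm_neg_swap a β (e := e) (u := u) y (bVec a' β' e u)
  have h4 : sForm a β e u (bVec a' β' e u) y = 0 := by linarith
  rw [h3, h4] at h1
  linarith

end Structure
end FinslerProj

/-! ### Structure of the symmetric part of the covariant derivative -/

namespace FinslerProj
variable {n : ℕ} {M : Type*} [TopologicalSpace M] [ChartedSpace (EuclideanSpace ℝ (Fin n)) M]
  [IsManifold (𝓡 n) ∞ M]

section NormalPart

variable {a : RiemMetric n M} {β : OneForm n M} {e : OpenPartialHomeomorph M (Coord n)}
  {u : Coord n}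

theorem exists_ne_zero_bForm_eq_zero (hn : 2 ≤ n) : ∃ w : Coord n, w ≠ 0 ∧ bForm β e u w = 0 := by
  let T : Coord n →ₗ[ℝ] ℝ :=
    { toFun := fun v => bForm β e u v
      map_add' := fun v w => bForm_add β e u v w
      map_smul' := fun c v => bForm_smul β e u c v }
  have hT : LinearMap.ker T ≠ ⊥ := LinearMap.ker_ne_bot_of_finrank_lt (by simp; omega)
  obtain ⟨v, hv, hv0⟩ := (Submodule.ne_bot_iff _).1 hT
  exact ⟨v, hv0, LinearMap.mem_ker.1 hv⟩

theorem Par.gForm_eq_zero {X y v : Coord n} (h : Par X y) (hy : y ≠ 0)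
    (hv : gForm a e u y v = 0) : gForm a e u X v = 0 := by
  obtain ⟨c, rfl⟩ := h.exists_smul hy
  rw [gForm_smul_left, hv, mul_zero]

/-- In the plane of `b` and `w`, parallelism to `y` becomes one scalar equation after pairing with a
vector orthogonal to `y`. Clearing `denE` yields the hypothesis of `quadratic_of_line`; the sign `η`
places `y` on the side where parallelism is known. -/
theorem IsQMetric.rForm_line {q : ℝ} (hF : IsQMetric q a β) (hn : 3 ≤ n)
    (he : e ∈ charts n M) (hu : u ∈ e.target) (hq0 : q ≠ 0) (hq1 : q ≠ 1)
    (hs : ∀ y z, sForm a β e u y z = 0) (hB : 0 < bSq a β e u) {η : ℝ} (hη : η ^ 2 = 1)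
    {T : Coord n → Coord n → Coord n}
    (hadd : ∀ y y' z, T (y + y') z = T y z + T y' z)
    (hsmul : ∀ (c : ℝ) y z, T (c • y) z = c • T y z) (hsymm : ∀ y z, T y z = T z y)
    (hR : ∀ w (t : ℝ), bForm β e u w = 0 → Par (qNormal q a β e u (η • (bVec a β e u + t • w)) •
      bVec a β e u + T (η • (bVec a β e u + t • w)) (η • (bVec a β e u + t • w)))
      (η • (bVec a β e u + t • w)))
    {w : Coord n} (hw0 : w ≠ 0) (hw : bForm β e u w = 0) :
    rForm a β e u (bVec a β e u) w = 0 ∧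
      (q ≠ 2 → rForm a β e u (bVec a β e u) (bVec a β e u) = 0 ∧ rForm a β e u w w = 0) ∧
      (q = 2 → rForm a β e u w w * (bSq a β e u * (1 - bSq a β e u)) =
        rForm a β e u (bVec a β e u) (bVec a β e u) *
          ((1 + 2 * bSq a β e u) * gForm a e u w w)) := by
  have hη0 : η ≠ 0 := by
    rintro rfl
    norm_num at hη
  have hadd' : ∀ y z z', T y (z + z') = T y z + T y z' := fun y z z' => by
    rw [hsymm, hadd, hsymm z, hsymm z']
  have hsmul' : ∀ (c : ℝ) y z, T y (c • z) = c • T y z := fun c y z => by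
    rw [hsymm, hsmul, hsymm]
  set b := bVec a β e u with hb
  set B := bSq a β e u with hBd
  set W := gForm a e u w w with hWd
  have hW : 0 < W := gForm_pos a he hu hw0
  have hbw : gForm a e u b w = 0 := by rw [gForm_bVec a β he hu, hw]
  have hwb : gForm a e u w b = 0 := by rw [gForm_comm, hbw]
  have hbb : gForm a e u b b = B := by rw [gForm_bVec a β he hu, bForm_bVec]
  have hB1 : B < 1 := hF.norm_lt_one e he u hu
  -- The `nᵢ` are the coefficients in `t` of the pairing of `T(b + t w, b + t w)` with `t W b - B
  -- w`, which is orthogonal to `b + t w`.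
  refine quadratic_of_line (η := η) (n₀ := -B * gForm a e u (T b b) w)
    (n₁ := W * bForm β e u (T b b) - 2 * B * gForm a e u (T b w) w)
    (n₂ := 2 * W * bForm β e u (T b w) - B * gForm a e u (T w w) w)
    (n₃ := W * bForm β e u (T w w)) hq0 hq1 hB hB1 hW hη0 fun t => ?_
  set y := η • (b + t • w) with hy
  have hA : gForm a e u y y = B + W * t ^ 2 := by
    simp only [hy, gForm_smul_left, gForm_smul_right, gForm_add_left, gForm_add_right, hbw, hwb,
      hbb, ← hWd]
    linear_combination (B + W * t ^ 2) * hη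
  have hβy : bForm β e u y = η * B := by
    rw [hy, bForm_smul, bForm_add, bForm_smul, hw, bForm_bVec]
    ring
  have hr : rForm a β e u y y = rForm a β e u b b + 2 * rForm a β e u b w * t +
      rForm a β e u w w * t ^ 2 := by
    simp only [hy, rForm_smul_left, rForm_smul_right, rForm_add_left, rForm_add_right,
      rForm_comm a β w b]
    linear_combination (rForm a β e u b b + 2 * rForm a β e u b w * t +
      rForm a β e u w w * t ^ 2) * hη
  have hy0 : y ≠ 0 := by
    intro h
    rw [h, gForm_zero_right] at hA
    nlinarith [mul_nonneg hW.le (sq_nonneg t)]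
  have hv : gForm a e u y ((t * W) • b + (-B) • w) = 0 := by
    simp only [hy, gForm_smul_left, gForm_smul_right, gForm_add_left, gForm_add_right, hbw, hwb,
      hbb, ← hWd]
    ring
  have h1 := (hR w t hw).gForm_eq_zero (a := a) (e := e) (u := u) hy0 hv
  have hE := hF.denE_pos hn he hu hy0
  have hTy : T y y = T b b + (2 * t) • T b w + t ^ 2 • T w w := by
    have h : T y y = η ^ 2 • (T b b + (2 * t) • T b w + t ^ 2 • T w w) := by
      simp only [hy, hadd, hadd', hsmul, hsmul', hsymm w b]
      module
    rw [h, hη, one_smul]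
  have hqn : qNormal q a β e u y * (2 * denE q a β e u y) =
      q * (q - 1) * (B + W * t ^ 2) * rForm a β e u y y := by
    rw [qNormal, hs, hA, mul_zero, sub_zero, div_mul_cancel₀ _ (by positivity)]
  rw [denE, hβy, hA, hr, ← hBd] at hqn
  have hgb : ∀ z, gForm a e u z b = bForm β e u z := fun z => by
    rw [gForm_comm, gForm_bVec a β he hu]
  rw [← hy, hTy] at h1
  generalize qNormal q a β e u y = N at h1 hqn
  simp only [gForm_add_left, gForm_add_right, gForm_smul_left, gForm_smul_right, hbw,
    hgb] at h1
  have hβb : bForm β e u b = B := bForm_bVec a β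
  simp only [bForm_add, bForm_smul, hβb] at h1
  linear_combination 2 * ((1 - q ^ 2) * (η * B) ^ 2 + (2 - q) * √(B + W * t ^ 2) * (η * B) +
    (1 + (q ^ 2 - q) * B) * (B + W * t ^ 2)) * h1 - (t * W * B) * hqn -
    2 * (1 - q ^ 2) * B ^ 2 * (-B * gForm a e u (T b b) w +
      (W * bForm β e u (T b b) - 2 * B * gForm a e u (T b w) w) * t +
      (2 * W * bForm β e u (T b w) - B * gForm a e u (T w w) w) * t ^ 2 +
      W * bForm β e u (T w w) * t ^ 3) * hη

/-- The line analysis determines `r_ij` on `b`, on its orthogonal complement and across the two.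
Hence `r₀₀` is zero, or for `q = 2` a multiple of `denE`, and the `bⁱ` coefficient is quadratic. The
second conclusion expresses `c β` through `r_ij bⁱ`, so that its trace can later be integrated. -/
theorem IsQMetric.exists_quadratic {q : ℝ} (hF : IsQMetric q a β) (hn : 3 ≤ n)
    (he : e ∈ charts n M) (hu : u ∈ e.target) (hq1 : q ≠ 1)
    (hs : q = 0 ∨ ∀ y z, sForm a β e u y z = 0) {β' : OneForm n M} {μ : ℝ}
    (hμ : ∀ y, bForm β e u y = μ * bForm β' e u y)
    {T : Coord n → Coord n → Coord n}
    (hadd : ∀ y y' z, T (y + y') z = T y z + T y' z)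
    (hsmul : ∀ (c : ℝ) y z, T (c • y) z = c • T y z) (hsymm : ∀ y z, T y z = T z y)
    (hT : ∀ y, 0 < bForm β' e u y → Par (qNormal q a β e u y • bVec a β e u + T y y) y) :
    ∃ c : ℝ, (∀ y, y ≠ 0 →
        qNormal q a β e u y • bVec a β e u = (c * gForm a e u y y) • bVec a β e u) ∧
      ∀ z, c * bForm β e u z * (1 - bSq a β e u) =
        (if q = 2 then 1 else 0) * rForm a β e u (bVec a β e u) z := by
  have hr0 : ∀ z, rForm a β e u 0 z = 0 := fun z => by
    simpa using rForm_smul_left (a := a) (β := β) (e := e) (u := u) 0 0 z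
  rcases (bSq_nonneg (a := a) (β := β) he hu).eq_or_lt with hB | hB
  · have hb : bVec a β e u = 0 := by
      by_contra hb
      have := gForm_pos a he hu hb
      rw [gForm_bVec a β he hu, bForm_bVec, ← hB] at this
      exact this.false
    have hz : ∀ z, bForm β e u z = 0 := fun z => by
      rw [← gForm_bVec a β he hu, hb, gForm_comm, gForm_zero_right]
    exact ⟨0, fun y _ => by rw [hb, smul_zero, smul_zero], fun z => by rw [hb, hz, hr0]; ring⟩
  have hB1 : bSq a β e u < 1 := hF.norm_lt_one e he u hu
  by_cases hq0 : q = 0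
  · subst hq0
    exact ⟨0, fun y _ => by simp [qNormal], fun z => by simp⟩
  replace hs := hs.resolve_left hq0
  have hβb : bForm β e u (bVec a β e u) = bSq a β e u := bForm_bVec a β
  have hμ0 : μ ≠ 0 := by
    rintro rfl
    rw [hμ, zero_mul] at hβb
    exact hB.ne hβb
  have hb' : bForm β' e u (bVec a β e u) ≠ 0 := by
    intro h
    rw [hμ, h, mul_zero] at hβb
    exact hB.ne hβb
  -- `β'` is constant along `b + t w`, so one sign puts the whole line into the cone.
  obtain ⟨η, hη, hη'⟩ : ∃ η : ℝ, η ^ 2 = 1 ∧ 0 < η * bForm β' e u (bVec a β e u) := by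
    rcases hb'.lt_or_gt with h | h
    · exact ⟨-1, by norm_num, by linarith⟩
    · exact ⟨1, by norm_num, by linarith⟩
  have key := fun w hw0 hw => hF.rForm_line (w := w) hn he hu hq0 hq1 hs hB hη hadd hsmul hsymm
    (fun w t hw => hT _ (by
      rw [hμ] at hw
      rw [bForm_smul, bForm_add, bForm_smul, (mul_eq_zero.1 hw).resolve_left hμ0, mul_zero,
        add_zero]
      exact hη')) hw0 hw
  have hker : ∀ z, bForm β e u (z - (bForm β e u z / bSq a β e u) • bVec a β e u) = 0 :=
    fun z => by
      rw [sub_eq_add_neg, ← neg_smul, bForm_add, bForm_smul, hβb]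
      field_simp
      ring
  have hbw : ∀ w, bForm β e u w = 0 → rForm a β e u (bVec a β e u) w = 0 := fun w hw => by
    by_cases hw0 : w = 0
    · rw [hw0, rForm_comm, hr0]
    · exact (key w hw0 hw).1
  have hbz : ∀ z, rForm a β e u (bVec a β e u) z = bForm β e u z / bSq a β e u *
      rForm a β e u (bVec a β e u) (bVec a β e u) := fun z => by
    have h := hbw _ (hker z)
    rw [sub_eq_add_neg, ← neg_smul, rForm_add_right, rForm_smul_right] at h
    linarith
  have hdec : ∀ y, ∃ w, bForm β e u w = 0 ∧
      y = (bForm β e u y / bSq a β e u) • bVec a β e u + w := fun y => ⟨_, hker y, by abel⟩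
  have hyy : ∀ y, ∃ w, bForm β e u w = 0 ∧
      gForm a e u y y = bForm β e u y ^ 2 / bSq a β e u + gForm a e u w w ∧
      rForm a β e u y y = (bForm β e u y / bSq a β e u) ^ 2 *
        rForm a β e u (bVec a β e u) (bVec a β e u) + rForm a β e u w w := fun y => by
    obtain ⟨w, hw, hy⟩ := hdec y
    have h1 : gForm a e u (bVec a β e u) w = 0 := by rw [gForm_bVec a β he hu, hw]
    have h2 : gForm a e u w (bVec a β e u) = 0 := by rw [gForm_comm, h1]
    have h3 : rForm a β e u w (bVec a β e u) = 0 := by rw [rForm_comm, hbw w hw]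
    refine ⟨w, hw, ?_, ?_⟩
    · conv_lhs => rw [hy]
      simp only [gForm_add_left, gForm_add_right, gForm_smul_left, gForm_smul_right, h1, h2,
        gForm_bVec a β he hu (bVec a β e u), hβb]
      field_simp
      ring
    · conv_lhs => rw [hy]
      simp only [rForm_add_left, rForm_add_right, rForm_smul_left, rForm_smul_right, h3,
        hbw w hw]
      ring
  obtain ⟨w₀, hw₀, hw₀'⟩ := exists_ne_zero_bForm_eq_zero (β := β) (e := e) (u := u) (by omega)
  by_cases hq2 : q = 2
  · subst hq2
    have h1B : 1 - bSq a β e u ≠ 0 := by linarith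
    -- At `q = 2` the value of `denE` at `y = b` is `b² (1 - b²)`, so this is the constant ratio of
    -- `r₀₀` to `denE`; the factor `q (q - 1) / 2` equals one.
    refine ⟨rForm a β e u (bVec a β e u) (bVec a β e u) /
      (bSq a β e u * (1 - bSq a β e u)), fun y hy => ?_, fun z => ?_⟩
    · congr 1
      have hE := hF.denE_pos hn he hu hy
      rw [qNormal, hs, mul_zero, sub_zero, div_eq_iff (by positivity)]
      obtain ⟨w, hw, hA, hr⟩ := hyy y
      have hww : rForm a β e u w w * (bSq a β e u * (1 - bSq a β e u)) =
          rForm a β e u (bVec a β e u) (bVec a β e u) *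
            ((1 + 2 * bSq a β e u) * gForm a e u w w) := by
        by_cases hw0 : w = 0
        · rw [hw0, hr0, gForm_zero_right]; ring
        · exact (key w hw0 hw).2.2 rfl
      rw [denE, hr]
      have hww' : rForm a β e u w w = rForm a β e u (bVec a β e u) (bVec a β e u) *
            ((1 + 2 * bSq a β e u) * gForm a e u w w) / (bSq a β e u * (1 - bSq a β e u)) := by
        rw [eq_div_iff (by positivity), hww]
      have hw' : gForm a e u w w = gForm a e u y y - bForm β e u y ^ 2 / bSq a β e u := by
        linarith
      rw [hww', hw']
      field_simp
      ring
    · rw [if_pos rfl, hbz z]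
      field_simp
  · refine ⟨0, fun y hy => ?_, fun z => ?_⟩
    · have hbb := ((key w₀ hw₀ hw₀').2.1 hq2).1
      obtain ⟨w, hw, -, hr⟩ := hyy y
      have hww : rForm a β e u w w = 0 := by
        by_cases hw0 : w = 0
        · rw [hw0, hr0]
        · exact ((key w hw0 hw).2.1 hq2).2
      rw [qNormal, hs, hr, hbb, hww]
      simp
    · rw [if_neg hq2]
      simp

end NormalPart
end FinslerProj

/-! ### The pointwise consequences of projective relatedness -/

namespace FinslerProj
variable {n : ℕ} {M : Type*} [TopologicalSpace M] [ChartedSpace (EuclideanSpace ℝ (Fin n)) M]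
  [IsManifold (𝓡 n) ∞ M]

/-! ### Smoothness of the sprays in the fibre variable -/

section VerticalSmoothness

variable {a : RiemMetric n M} {β : OneForm n M} {e : OpenPartialHomeomorph M (Coord n)}
  {u : Coord n}

theorem contDiff_coord (i : Fin n) : ContDiff ℝ ∞ fun y : Coord n => y i :=
  (EuclideanSpace.proj i : Coord n →L[ℝ] ℝ).contDiff

theorem contDiff_bilin (c : Fin n → Fin n → ℝ) :
    ContDiff ℝ ∞ fun y : Coord n => ∑ i, ∑ j, c i j * y i * y j :=
  ContDiff.sum fun i _ => ContDiff.sum fun j _ =>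
    (contDiff_const.mul (contDiff_coord i)).mul (contDiff_coord j)

theorem contDiff_toCoord {f : Coord n → Fin n → ℝ} (h : ∀ i, ContDiff ℝ ∞ fun x => f x i) :
    ContDiff ℝ ∞ fun x => (WithLp.toLp 2 (f x) : Coord n) :=
  contDiff_euclidean.2 h

theorem contDiff_gForm : ContDiff ℝ ∞ fun y : Coord n => gForm a e u y y := contDiff_bilin _

theorem contDiff_rForm : ContDiff ℝ ∞ fun y : Coord n => rForm a β e u y y := contDiff_bilin _

theorem contDiff_bForm : ContDiff ℝ ∞ fun y : Coord n => bForm β e u y :=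
  ContDiff.sum fun i _ => contDiff_const.mul (contDiff_coord i)

theorem contDiff_sForm (x : Coord n) : ContDiff ℝ ∞ fun y : Coord n => sForm a β e u x y :=
  ContDiff.sum fun _ _ => ContDiff.sum fun j _ => contDiff_const.mul (contDiff_coord j)

theorem contDiff_christoffelVec : ContDiff ℝ ∞ fun y : Coord n => christoffelVec a e u y y :=
  contDiff_toCoord fun _ => contDiff_bilin _

theorem contDiff_sMap : ContDiff ℝ ∞ fun y : Coord n => sMap a β e u y := by
  refine contDiff_toCoord fun i => ?_
  change ContDiff ℝ ∞ fun y : Coord n =>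
    ∑ j, (aComp a e u)⁻¹ i j * ∑ k, sTen a β e u j k * y k
  exact ContDiff.sum fun j _ => contDiff_const.mul
    (ContDiff.sum fun k _ => contDiff_const.mul (contDiff_coord k))

theorem contDiff_sprayVec_rnorm (he : e ∈ charts n M) (hu : u ∈ e.target) :
    ContDiff ℝ ∞ fun y : Coord n => sprayVec (rnorm a) e u y := by
  simp only [sprayVec_rnorm a he hu]
  exact contDiff_christoffelVec.const_smul (1 / 2 : ℝ)

theorem contDiff_kQuad : ContDiff ℝ ∞ fun y : Coord n => kQuad a β e u y y :=
  ((contDiff_gForm.smul contDiff_const).add (contDiff_rForm.smul contDiff_const)).const_smul _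

theorem contDiffAt_denD (q : ℝ) (he : e ∈ charts n M) (hu : u ∈ e.target) {y : Coord n}
    (hy : y ≠ 0) : ContDiffAt ℝ ∞ (denD q a β e u) y :=
  (contDiff_gForm.contDiffAt.sqrt (gForm_pos a he hu hy).ne').add
    (contDiff_const.mul contDiff_bForm).contDiffAt

theorem contDiffAt_denE (q : ℝ) (he : e ∈ charts n M) (hu : u ∈ e.target) {y : Coord n}
    (hy : y ≠ 0) : ContDiffAt ℝ ∞ (denE q a β e u) y :=
  ((contDiff_const.mul (contDiff_bForm.pow 2)).contDiffAt.add
    ((contDiffAt_const.mul (contDiff_gForm.contDiffAt.sqrt (gForm_pos a he hu hy).ne')).mul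
      contDiff_bForm.contDiffAt)).add (contDiff_const.mul contDiff_gForm).contDiffAt

theorem IsQMetric.contDiffAt_qProj {q : ℝ} (hF : IsQMetric q a β) (hn : 3 ≤ n)
    (he : e ∈ charts n M) (hu : u ∈ e.target) {y : Coord n} (hy : y ≠ 0) :
    ContDiffAt ℝ ∞ (qProj q a β e u) y := by
  have hD := contDiffAt_denD (a := a) (β := β) q he hu hy
  have hE := contDiffAt_denE (a := a) (β := β) q he hu hy
  have hs := (contDiff_gForm (a := a) (e := e) (u := u)).contDiffAt.sqrt
    (gForm_pos a he hu hy).ne'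
  refine ContDiffAt.div ?_ (contDiffAt_const.mul hE)
    (mul_pos two_pos (hF.denE_pos hn he hu hy)).ne'
  refine (contDiffAt_const.mul (contDiff_rForm.contDiffAt.sub ((contDiffAt_const.mul
    ((contDiff_const.mul contDiff_gForm).contDiffAt.div hD (hF.denD_pos hn he hu hy).ne')).mul
    (contDiff_sForm _).contDiffAt))).mul ?_
  exact hs.add (contDiff_const.mul contDiff_bForm).contDiffAt

theorem IsQMetric.contDiffAt_qNormal {q : ℝ} (hF : IsQMetric q a β) (hn : 3 ≤ n)
    (he : e ∈ charts n M) (hu : u ∈ e.target) {y : Coord n} (hy : y ≠ 0) :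
    ContDiffAt ℝ ∞ (qNormal q a β e u) y := by
  have hD := contDiffAt_denD (a := a) (β := β) q he hu hy
  have hE := contDiffAt_denE (a := a) (β := β) q he hu hy
  refine ContDiffAt.div ?_ (contDiffAt_const.mul hE)
    (mul_pos two_pos (hF.denE_pos hn he hu hy)).ne'
  exact (contDiff_const.mul contDiff_gForm).contDiffAt.mul (contDiff_rForm.contDiffAt.sub
    ((contDiffAt_const.mul ((contDiff_const.mul contDiff_gForm).contDiffAt.div hD
    (hF.denD_pos hn he hu hy).ne')).mul (contDiff_sForm _).contDiffAt))

theorem IsQMetric.contDiffAt_sprayVec {q : ℝ} (hF : IsQMetric q a β) (hn : 3 ≤ n)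
    (he : e ∈ charts n M) (hu : u ∈ e.target) {y : Coord n} (hy : y ≠ 0) :
    ContDiffAt ℝ ∞ (sprayVec (qMetric q a β) e u) y := by
  have hD := contDiffAt_denD (a := a) (β := β) q he hu hy
  have h : sprayVec (qMetric q a β) e u =ᶠ[nhds y] fun y => sprayVec (rnorm a) e u y +
      ((q * gForm a e u y y / denD q a β e u y) • sMap a β e u y +
        qNormal q a β e u y • bVec a β e u + qProj q a β e u y • y) := by
    filter_upwards [isOpen_compl_singleton.mem_nhds hy] with z hz
    exact hF.sprayVec_eq hn he hu hz
  refine ContDiffAt.congr_of_eventuallyEq ?_ h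
  refine (contDiff_sprayVec_rnorm he hu).contDiffAt.add (((?_ : ContDiffAt ℝ ∞ _ y).add
    ((hF.contDiffAt_qNormal hn he hu hy).smul contDiffAt_const)).add
    ((hF.contDiffAt_qProj hn he hu hy).smul contDiffAt_id))
  exact ((contDiff_const.mul contDiff_gForm).contDiffAt.div hD
    (hF.denD_pos hn he hu hy).ne').smul contDiff_sMap.contDiffAt

theorem ne_zero_of_bForm_pos {y : Coord n} (hy : 0 < bForm β e u y) : y ≠ 0 := by
  rintro rfl
  rw [bForm_zero] at hy
  exact lt_irrefl _ hy

theorem eventually_bForm_pos {y : Coord n} (hy : 0 < bForm β e u y) :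
    ∀ᶠ z in nhds y, 0 < bForm β e u z :=
  (continuous_bForm.tendsto y).eventually (lt_mem_nhds hy)

theorem contDiffAt_kProj (he : e ∈ charts n M) (hu : u ∈ e.target) {y : Coord n} (hy : y ≠ 0) :
    ContDiffAt ℝ ∞ (kProj a β e u) y :=
  ((((contDiff_rForm.mul contDiff_bForm).contDiffAt.div contDiff_gForm.contDiffAt
    (gForm_pos a he hu hy).ne').add (contDiff_sForm _).contDiffAt).neg).div_const _

theorem contDiffAt_sprayVec_kropina (he : e ∈ charts n M) (hu : u ∈ e.target) {y : Coord n}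
    (hy : 0 < bForm β e u y) : ContDiffAt ℝ ∞ (sprayVec (kropina a β) e u) y := by
  refine ContDiffAt.congr_of_eventuallyEq ?_
    ((eventually_bForm_pos hy).mono fun z hz => sprayVec_kropina (a := a) he hu hz)
  refine (contDiff_sprayVec_rnorm he hu).contDiffAt.add ((ContDiffAt.add ?_ ?_).add
    ((contDiffAt_kProj he hu (ne_zero_of_bForm_pos hy)).smul contDiffAt_id))
  · exact (contDiff_gForm.neg.contDiffAt.div (contDiff_const.mul contDiff_bForm).contDiffAt
      (by positivity)).smul contDiff_sMap.contDiffAt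
  · exact ((contDiff_rForm.contDiffAt.add ((contDiff_gForm.contDiffAt.div
      contDiff_bForm.contDiffAt hy.ne').mul (contDiff_sForm _).contDiffAt)).div_const _).smul
      contDiffAt_const

theorem sMap_eq_zero (he : e ∈ charts n M) (hu : u ∈ e.target)
    (hs : ∀ y z, sForm a β e u y z = 0) (y : Coord n) : sMap a β e u y = 0 :=
  eq_of_gForm_eq a he hu fun z => by
    rw [gForm_sMap a β he hu, hs, gForm_comm, gForm_zero_right]

theorem IsQMetric.sprayVec_eq_of_sForm {q : ℝ} (hF : IsQMetric q a β) (hn : 3 ≤ n)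
    (he : e ∈ charts n M) (hu : u ∈ e.target) (hs : q = 0 ∨ ∀ y z, sForm a β e u y z = 0)
    {y : Coord n} (hy : y ≠ 0) :
    sprayVec (qMetric q a β) e u y = sprayVec (rnorm a) e u y +
      qNormal q a β e u y • bVec a β e u + qProj q a β e u y • y := by
  rw [hF.sprayVec_eq hn he hu hy]
  have : (q * gForm a e u y y / denD q a β e u y) • sMap a β e u y = 0 := by
    rcases hs with rfl | hs
    · simp
    · rw [sMap_eq_zero he hu hs, smul_zero]
  rw [this, zero_add, add_assoc]

end VerticalSmoothness

/-! ### Consequences of projective relatedness in a single tangent space -/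

section Pointwise

variable {a a' : RiemMetric n M} {β β' : OneForm n M} {e : OpenPartialHomeomorph M (Coord n)}
  {u : Coord n}

theorem par_of_boundary (hb : 0 < bSq a' β' e u) {Z : Coord n → Coord n} {w : Coord n}
    (hZ : ContinuousAt Z w) (h : ∀ y, 0 < bForm β' e u y → Par (Z y) y)
    (hw : bForm β' e u w = 0) : Par (Z w) w := by
  have hl := tendsto_line w (bVec a' β' e u)
  refine Par.of_tendsto (hZ.tendsto.comp hl) hl ?_
  filter_upwards [self_mem_nhdsWithin] with ε hε
  refine h _ ?_
  rw [bForm_add, bForm_smul, hw, bForm_bVec, zero_add]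
  exact mul_pos hε hb

/-- The bilinear map whose quadratic form is `G_α - G_α' - (α'² s'ⁱ + r'₀₀ b'ⁱ) / (2 b'²)`. -/
def diffMap (a a' : RiemMetric n M) (β' : OneForm n M) (e : OpenPartialHomeomorph M (Coord n))
    (u y z : Coord n) : Coord n :=
  (1 / 2 : ℝ) • christoffelVec a e u y z - (1 / 2 : ℝ) • christoffelVec a' e u y z -
    kQuad a' β' e u y z

theorem diffMap_symm (y z : Coord n) : diffMap a a' β' e u y z = diffMap a a' β' e u z y := by
  simp only [diffMap, kQuad]
  rw [christoffelVec_symm a y, christoffelVec_symm a' y, gForm_comm a' e u y, rForm_comm a' β' y]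

theorem diffMap_add_left (x y z : Coord n) :
    diffMap a a' β' e u (x + y) z = diffMap a a' β' e u x z + diffMap a a' β' e u y z := by
  simp only [diffMap, kQuad, christoffelVec_add_left, gForm_add_left, rForm_add_left]
  module

theorem diffMap_smul_left (c : ℝ) (y z : Coord n) :
    diffMap a a' β' e u (c • y) z = c • diffMap a a' β' e u y z := by
  simp only [diffMap, kQuad, christoffelVec_smul_left, gForm_smul_left, rForm_smul_left]
  module

theorem continuous_diffMap : Continuous fun y : Coord n => diffMap a a' β' e u y y :=
  (((contDiff_christoffelVec.const_smul (1 / 2 : ℝ)).sub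
    (contDiff_christoffelVec.const_smul (1 / 2 : ℝ))).sub contDiff_kQuad).continuous

theorem diffMap_self (he : e ∈ charts n M) (hu : u ∈ e.target) (y : Coord n) :
    diffMap a a' β' e u y y = sprayVec (rnorm a) e u y - sprayVec (rnorm a') e u y -
      kQuad a' β' e u y y := by
  rw [sprayVec_rnorm a he hu, sprayVec_rnorm a' he hu, diffMap]

/-- The condition on `s'_ij` characterising Kropina metrics of Douglas type. -/
def KropinaCondition (a : RiemMetric n M) (β : OneForm n M)
    (e : OpenPartialHomeomorph M (Coord n)) (u : Coord n) : Prop :=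
  ∀ y, sMap a β e u y = (1 / bSq a β e u) •
    (sForm a β e u (bVec a β e u) y • bVec a β e u - bForm β e u y • sVec a β e u)

/-- The spray of `F` is continuous at every nonzero vector, so it is an admissible field in
`sMap_eq_of_boundary`. -/
theorem IsQMetric.kropinaCondition_of_par {q : ℝ} (hF : IsQMetric q a β) (hn : 3 ≤ n)
    (he : e ∈ charts n M) (hu : u ∈ e.target) (hb : 0 < bSq a' β' e u)
    (h : ∀ y, 0 < bForm β' e u y →
      Par (sprayVec (qMetric q a β) e u y - sprayVec (kropina a' β') e u y) y) :
    KropinaCondition a' β' e u := by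
  refine sMap_eq_of_boundary he hu hb (X := sprayVec (qMetric q a β) e u)
    (fun y hy => by simpa using (h y hy).neg) fun w hw _ => ?_
  have h1 : Filter.Tendsto (fun ε : ℝ => ε) (nhdsWithin 0 (Set.Ioi 0)) (nhds 0) :=
    Filter.tendsto_id.mono_left nhdsWithin_le_nhds
  simpa using h1.smul ((hF.contDiffAt_sprayVec hn he hu hw).continuousAt.tendsto.comp
    (tendsto_line w (bVec a' β' e u)))

theorem kQuad_neg (y : Coord n) : kQuad a β e u (-y) (-y) = kQuad a β e u y y := by
  simp only [kQuad, ← neg_one_smul ℝ y, gForm_smul_left, gForm_smul_right, rForm_smul_left,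
    rForm_smul_right]
  module

/-- Modulo `y` the spray of `F` equals an even quadratic map on the cone, hence by continuity on its
boundary hyperplane. That hyperplane is symmetric, so `w` and `-w` can be compared there. -/
theorem IsQMetric.sForm_eq_zero_of_par {q : ℝ} (hF : IsQMetric q a β) (hn : 3 ≤ n)
    (he : e ∈ charts n M) (hu : u ∈ e.target) (hb : 0 < bSq a' β' e u) {μ : ℝ}
    (hμ : ∀ y, bForm β e u y = μ * bForm β' e u y)
    (h : ∀ y, 0 < bForm β' e u y →
      Par (sprayVec (qMetric q a β) e u y - sprayVec (kropina a' β') e u y) y) :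
    q = 0 ∨ ∀ y z, sForm a β e u y z = 0 := by
  refine or_iff_not_imp_left.2 fun hq => ?_
  have hK := hF.kropinaCondition_of_par hn he hu hb h
  refine hF.sForm_eq_zero hn he hu hq hb.ne' (fun w hw => by rw [hμ, hw, mul_zero])
    fun w hw0 hw => ?_
  have key : ∀ w, w ≠ 0 → bForm β' e u w = 0 → Par (sprayVec (qMetric q a β) e u w -
      (sprayVec (rnorm a') e u w + kQuad a' β' e u w w)) w := fun w hw0 hw => by
    refine par_of_boundary (Z := fun w => sprayVec (qMetric q a β) e u w -
      (sprayVec (rnorm a') e u w + kQuad a' β' e u w w)) hb ?_ (fun y hy => ?_) hw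
    · exact ((hF.contDiffAt_sprayVec hn he hu hw0).sub
        ((contDiff_sprayVec_rnorm he hu).add contDiff_kQuad).contDiffAt).continuousAt
    · have := (h y hy).add (par_smul_self (kProj a' β' e u y) y)
      rw [sprayVec_kropina_eq_kQuad he hu hK hy] at this
      convert this using 1
      module
  have h1 := key w hw0 hw
  have h2 := (key (-w) (neg_ne_zero.2 hw0) (by
    rw [← neg_one_smul ℝ, bForm_smul, hw, mul_zero])).neg_right
  rw [sprayVec_rnorm_neg he hu, kQuad_neg] at h2
  convert h1.sub h2 using 1
  module

/-- After the `bⁱ` term has become quadratic, the whole difference is a quadratic map parallel to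
`y` on a half-space. Evenness and continuity extend this to all `y`, and the trace lemma applies. -/
theorem IsQMetric.exists_of_par {q : ℝ} (hF : IsQMetric q a β) (hn : 3 ≤ n) (hq : q ≠ 1)
    (he : e ∈ charts n M) (hu : u ∈ e.target) (hb : 0 < bSq a' β' e u) {μ : ℝ}
    (hμ : ∀ y, bForm β e u y = μ * bForm β' e u y)
    (h : ∀ y, 0 < bForm β' e u y →
      Par (sprayVec (qMetric q a β) e u y - sprayVec (kropina a' β') e u y) y) :
    ∃ c : ℝ, (∀ y, y ≠ 0 →
        qNormal q a β e u y • bVec a β e u = (c * gForm a e u y y) • bVec a β e u) ∧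
      (∀ z, c * bForm β e u z * (1 - bSq a β e u) =
        (if q = 2 then 1 else 0) * rForm a β e u (bVec a β e u) z) ∧
      ∀ y, ((n : ℝ) + 1) • (diffMap a a' β' e u y y + (c * gForm a e u y y) • bVec a β e u) =
        (2 * ∑ m, (diffMap a a' β' e u y (stdVec m) +
          (c * gForm a e u y (stdVec m)) • bVec a β e u) m) • y := by
  have hs := hF.sForm_eq_zero_of_par hn he hu hb hμ h
  have hK := hF.kropinaCondition_of_par hn he hu hb h
  have hT : ∀ y, 0 < bForm β' e u y →
      Par (qNormal q a β e u y • bVec a β e u + diffMap a a' β' e u y y) y := fun y hy => by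
    have := (h y hy).add (par_smul_self (kProj a' β' e u y - qProj q a β e u y) y)
    rw [sprayVec_kropina_eq_kQuad he hu hK hy,
      hF.sprayVec_eq_of_sForm hn he hu hs (ne_zero_of_bForm_pos hy)] at this
    rw [diffMap_self he hu]
    convert this using 1
    module
  obtain ⟨c, hc, hc'⟩ := hF.exists_quadratic hn he hu hq hs hμ diffMap_add_left
    diffMap_smul_left diffMap_symm hT
  refine ⟨c, hc, hc', bilinear_eq_trace_of_par
    (T := fun y z => diffMap a a' β' e u y z + (c * gForm a e u y z) • bVec a β e u)
    (fun x y z => ?_) (fun k y z => ?_) (fun y z => ?_) ?_⟩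
  · simp only [diffMap_add_left, gForm_add_left]
    module
  · simp only [diffMap_smul_left, gForm_smul_left]
    module
  · simp only [diffMap_symm y z, gForm_comm a e u y z]
  · have hpos : ∀ y, 0 < bForm β' e u y →
        Par (diffMap a a' β' e u y y + (c * gForm a e u y y) • bVec a β e u) y := fun y hy => by
      rw [← hc y (ne_zero_of_bForm_pos hy), add_comm]
      exact hT y hy
    intro y
    rcases lt_trichotomy (bForm β' e u y) 0 with hy | hy | hy
    · have h1 := (hpos (-y) (by rw [← neg_one_smul ℝ, bForm_smul]; linarith)).neg_right
      simp only [← neg_one_smul ℝ y, diffMap_smul_left, diffMap_symm y, gForm_smul_left,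
        gForm_smul_right] at h1
      convert h1 using 1
      module
    · refine par_of_boundary (Z := fun y => diffMap a a' β' e u y y +
        (c * gForm a e u y y) • bVec a β e u) hb ?_ hpos hy
      exact (continuous_diffMap.add ((continuous_const.mul continuous_gForm).smul
        continuous_const)).continuousAt
    · exact hpos y hy

end Pointwise
end FinslerProj

/-! ### Vanishing of the Douglas tensor -/

namespace FinslerProj
variable {n : ℕ} {M : Type*} [TopologicalSpace M] [ChartedSpace (EuclideanSpace ℝ (Fin n)) M]

section Quadratic

/-- The function `f` is a quadratic form. -/
def IsQuad (f : Coord n → ℝ) : Prop :=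
  ∃ c : Fin n → Fin n → ℝ, ∀ z, f z = ∑ j, ∑ k, c j k * z j * z k

theorem IsQuad.add {f g : Coord n → ℝ} (hf : IsQuad f) (hg : IsQuad g) :
    IsQuad fun z => f z + g z := by
  obtain ⟨c, hc⟩ := hf
  obtain ⟨d, hd⟩ := hg
  refine ⟨fun j k => c j k + d j k, fun z => ?_⟩
  simp only [hc, hd, add_mul, Finset.sum_add_distrib]

theorem IsQuad.const_mul {f : Coord n → ℝ} (hf : IsQuad f) (r : ℝ) :
    IsQuad fun z => r * f z := by
  obtain ⟨c, hc⟩ := hf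
  refine ⟨fun j k => r * c j k, fun z => ?_⟩
  simp only [hc, Finset.mul_sum, mul_assoc]

theorem isQuad_linear_mul_coord (d : Fin n → ℝ) (i : Fin n) :
    IsQuad fun z => (∑ k, d k * z k) * z i := by
  refine ⟨fun j k => if k = i then d j else 0, fun z => ?_⟩
  simp [ite_mul, Finset.sum_mul]

theorem pd_eq_of_hasFDerivAt {f : Coord n → ℝ} {f' : Coord n →L[ℝ] ℝ} {y : Coord n}
    (h : HasFDerivAt f f' y) (k : Fin n) : pd k f y = f' (stdVec k) := by
  rw [pd, h.fderiv]

theorem pd_coord (i k : Fin n) (y : Coord n) :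
    pd k (fun z : Coord n => z i) y = (stdVec k : Coord n) i :=
  pd_eq_of_hasFDerivAt (EuclideanSpace.proj i : Coord n →L[ℝ] ℝ).hasFDerivAt k

theorem pd_add {f g : Coord n → ℝ} {y : Coord n} (hf : DifferentiableAt ℝ f y)
    (hg : DifferentiableAt ℝ g y) (k : Fin n) :
    pd k (fun z => f z + g z) y = pd k f y + pd k g y :=
  pd_eq_of_hasFDerivAt (hf.hasFDerivAt.add hg.hasFDerivAt) k

theorem pd_mul {f g : Coord n → ℝ} {y : Coord n} (hf : DifferentiableAt ℝ f y)
    (hg : DifferentiableAt ℝ g y) (k : Fin n) :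
    pd k (fun z => f z * g z) y = f y * pd k g y + pd k f y * g y := by
  refine (pd_eq_of_hasFDerivAt (hf.hasFDerivAt.mul hg.hasFDerivAt) k).trans ?_
  simp [pd, mul_comm (g y)]

theorem pd_linear (d : Fin n → ℝ) (k : Fin n) (y : Coord n) :
    pd k (fun z : Coord n => ∑ i, d i * z i) y = d k := by
  refine (pd_eq_of_hasFDerivAt (HasFDerivAt.fun_sum (u := Finset.univ) fun i _ =>
    ((EuclideanSpace.proj i : Coord n →L[ℝ] ℝ).hasFDerivAt.const_mul (d i))) k).trans ?_
  simp [stdVec]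

theorem pd_quad (c : Fin n → Fin n → ℝ) (l : Fin n) (y : Coord n) :
    pd l (fun z : Coord n => ∑ j, ∑ k, c j k * z j * z k) y = ∑ k, (c l k + c k l) * y k := by
  have hp : ∀ i, HasFDerivAt (fun z : Coord n => z i) (EuclideanSpace.proj i : Coord n →L[ℝ] ℝ) y :=
    fun i => (EuclideanSpace.proj i : Coord n →L[ℝ] ℝ).hasFDerivAt
  refine (pd_eq_of_hasFDerivAt (HasFDerivAt.fun_sum (u := Finset.univ) fun j _ =>
    HasFDerivAt.fun_sum (u := Finset.univ) fun k _ =>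
      ((hp j).const_mul (c j k)).mul (hp k)) l).trans ?_
  simp [stdVec, Finset.sum_add_distrib, add_mul, mul_comm (c l _), add_comm]

theorem pd_eventuallyEq {f g : Coord n → ℝ} {y : Coord n} (h : f =ᶠ[nhds y] g) (k : Fin n) :
    pd k f =ᶠ[nhds y] pd k g :=
  h.eventuallyEq_nhds.mono fun _ hz => pd_congr hz k

theorem IsQuad.pd_pd_pd {f g : Coord n → ℝ} {y : Coord n} (hg : IsQuad g) (h : f =ᶠ[nhds y] g)
    (j k l : Fin n) : pd j (pd k (pd l f)) y = 0 := by
  obtain ⟨c, hc⟩ := hg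
  rw [pd_congr (pd_eventuallyEq (pd_eventuallyEq h l) k)]
  have h1 : pd l g = fun z => ∑ k, (c l k + c k l) * z k := by
    rw [funext hc]
    exact funext fun z => pd_quad c l z
  have h2 : pd k (pd l g) = fun _ => c l k + c k l := by
    rw [h1]
    exact funext fun z => pd_linear _ k z
  rw [h2]
  simp [pd]

theorem fderiv_self_of_homogeneous {f : Coord n → ℝ} {y : Coord n}
    (hf : DifferentiableAt ℝ f y) (h : ∀ t : ℝ, 0 < t → f (t • y) = t * f y) :
    fderiv ℝ f y y = f y := by
  have h1 : HasDerivAt (fun t : ℝ => t • y) y 1 := by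
    simpa using (hasDerivAt_id (1 : ℝ)).smul_const y
  have h2 : HasFDerivAt f (fderiv ℝ f y) ((fun t : ℝ => t • y) 1) := by
    simpa using hf.hasFDerivAt
  have h3 := h2.comp_hasDerivAt (1 : ℝ) h1
  have h4 : HasDerivAt (fun t : ℝ => t * f y) (f y) 1 := by
    simpa using (hasDerivAt_id (1 : ℝ)).mul_const (f y)
  refine h3.unique (h4.congr_of_eventuallyEq ?_)
  filter_upwards [lt_mem_nhds (one_pos : (0 : ℝ) < 1)] with t ht
  exact h t ht

/-- The projectively invariant part `Gⁱ - (1/(n+1)) (∂Gᵐ/∂yᵐ) yⁱ` of the spray. -/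
def projSpray (F : ∀ x : M, TangentSpace (𝓡 n) x → ℝ) (e : OpenPartialHomeomorph M (Coord n))
    (u y : Coord n) : Coord n :=
  WithLp.toLp 2 fun i => spray F e u y i
    - (1 / ((n : ℝ) + 1)) * (∑ m, pd m (fun w => spray F e u w m) y) * y i

/-- If `p` is homogeneous of degree one, the divergence of `p y` is `(n + 1) p`. The trace
correction therefore removes `p y` exactly and leaves a quadratic form, whose third derivatives
vanish. Only Euler's identity for `p` is needed, which keeps the hypothesis local. -/
theorem douglas_eq_zero_of_eventually {F : ∀ x : M, TangentSpace (𝓡 n) x → ℝ}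
    {e : OpenPartialHomeomorph M (Coord n)} {u y : Coord n} {Q : Coord n → Coord n}
    {p : Coord n → ℝ} (hQ : ∀ i, IsQuad fun z => Q z i)
    (hp : ∀ᶠ z in nhds y, DifferentiableAt ℝ p z ∧ fderiv ℝ p z z = p z)
    (h : ∀ᶠ z in nhds y, sprayVec F e u z = Q z + p z • z) (i j k l : Fin n) :
    douglas F e u y i j k l = 0 := by
  choose c hc using hQ
  have hQd : ∀ i z, DifferentiableAt ℝ (fun z => Q z i) z := fun i z => by
    rw [funext (hc i)]
    exact ((contDiff_bilin (c i)).differentiable (by simp)).differentiableAt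
  set d : Fin n → ℝ := fun k => ∑ m, (c m m k + c m k m) with hd
  have key : ∀ᶠ z in nhds y, projSpray F e u z i =
      Q z i + (-(1 / ((n : ℝ) + 1))) * ((∑ k, d k * z k) * z i) := by
    filter_upwards [hp, h.eventually_nhds, h] with z hpz hz hz'
    have h1 : ∀ m, pd m (fun w => spray F e u w m) z =
        (∑ k, (c m m k + c m k m) * z k) + (p z + pd m p z * z m) := fun m => by
      have h2 : (fun w => spray F e u w m) =ᶠ[nhds z] fun w => Q w m + p w * w m := by
        filter_upwards [hz] with w hw
        exact congrArg (fun v : Coord n => v m) hw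
      rw [pd_congr h2, pd_add (hQd m z) (hpz.1.fun_mul
        ((contDiff_coord m).differentiable (by simp)).differentiableAt), pd_mul hpz.1
        ((contDiff_coord m).differentiable (by simp)).differentiableAt, pd_coord,
        funext (hc m), pd_quad]
      simp [stdVec]
    have h3 : ∑ m, pd m (fun w => spray F e u w m) z =
        (∑ k, d k * z k) + ((n : ℝ) + 1) * p z := by
      simp only [h1, Finset.sum_add_distrib]
      have h4 : ∑ m, pd m p z * z m = p z := by
        rw [← fderiv_apply_eq_sum, hpz.2]
      rw [h4, Finset.sum_comm]
      simp only [hd, Finset.sum_mul, Finset.sum_const, Finset.card_univ, Fintype.card_fin,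
        nsmul_eq_mul]
      ring
    have h5 : spray F e u z i = Q z i + p z * z i := congrArg (fun v : Coord n => v i) hz'
    change spray F e u z i - (1 / ((n : ℝ) + 1)) * (∑ m, pd m (fun w => spray F e u w m) z) * z i
      = _
    rw [h3, h5]
    have hn : (n : ℝ) + 1 ≠ 0 := by positivity
    field_simp
    ring
  exact IsQuad.pd_pd_pd (IsQuad.add ⟨c i, hc i⟩ ((isQuad_linear_mul_coord d i).const_mul _))
    key j k l

end Quadratic

/-! ### Vanishing third derivatives along lines -/

section Lines

theorem exists_quadratic_of_hasDerivAt {I : Set ℝ} (hI : IsOpen I) (hI' : IsPreconnected I)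
    {g g₁ g₂ : ℝ → ℝ} (hg : ∀ t ∈ I, HasDerivAt g (g₁ t) t)
    (hg₁ : ∀ t ∈ I, HasDerivAt g₁ (g₂ t) t) (hg₂ : ∀ t ∈ I, HasDerivAt g₂ 0 t) :
    ∃ A B C, ∀ t ∈ I, g t = A + B * t + C * t ^ 2 := by
  have key : ∀ f : ℝ → ℝ, (∀ t ∈ I, HasDerivAt f 0 t) → ∃ d, ∀ t ∈ I, f t = d := fun f hf =>
    hI.exists_is_const_of_deriv_eq_zero hI'
      (fun t ht => (hf t ht).differentiableAt.differentiableWithinAt) fun t ht => (hf t ht).deriv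
  obtain ⟨c, hc⟩ := key g₂ hg₂
  obtain ⟨b, hb⟩ := key (fun t => g₁ t - c * t) fun t ht => by
    have := (hg₁ t ht).sub ((hasDerivAt_id t).const_mul c)
    rw [hc t ht, mul_one, sub_self] at this
    exact this
  obtain ⟨a, ha⟩ := key (fun t => g t - (b * t + c / 2 * t ^ 2)) fun t ht => by
    have := (hg t ht).sub (((hasDerivAt_id t).const_mul b).add
      (((hasDerivAt_id t).pow 2).const_mul (c / 2)))
    refine HasDerivAt.congr_deriv this ?_
    have := hb t ht
    simp only [id]
    push_cast
    linear_combination this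
  exact ⟨a, b, c / 2, fun t ht => by linear_combination ha t ht⟩

theorem contDiffAt_pd {f : Coord n → ℝ} {y : Coord n} (hf : ContDiffAt ℝ ∞ f y) (k : Fin n) :
    ContDiffAt ℝ ∞ (pd k f) y :=
  (hf.fderiv_right (m := ∞) (by simp)).clm_apply contDiffAt_const

theorem hasDerivAt_line {f : Coord n → ℝ} {y w : Coord n} {t : ℝ}
    (hf : DifferentiableAt ℝ f (y + t • w)) :
    HasDerivAt (fun t : ℝ => f (y + t • w)) (∑ k, pd k f (y + t • w) * w k) t := by
  have h1 : HasDerivAt (fun t : ℝ => y + t • w) w t := by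
    simpa using ((hasDerivAt_id t).smul_const w).const_add y
  rw [← fderiv_apply_eq_sum]
  exact hf.hasFDerivAt.comp_hasDerivAt t h1

theorem exists_quadratic_on_line {f : Coord n → ℝ} {y w : Coord n} {I : Set ℝ} (hI : IsOpen I)
    (hI' : IsPreconnected I) (hf : ∀ t ∈ I, ContDiffAt ℝ ∞ f (y + t • w))
    (h : ∀ t ∈ I, ∀ j k l, pd j (pd k (pd l f)) (y + t • w) = 0) :
    ∃ A B C, ∀ t ∈ I, f (y + t • w) = A + B * t + C * t ^ 2 := by
  refine exists_quadratic_of_hasDerivAt hI hI' (g₁ := fun t => ∑ l, pd l f (y + t • w) * w l)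
    (g₂ := fun t => ∑ l, (∑ k, pd k (pd l f) (y + t • w) * w k) * w l)
    (fun t ht => hasDerivAt_line ((hf t ht).differentiableAt (by simp)))
    (fun t ht => HasDerivAt.fun_sum fun l _ => (hasDerivAt_line
      ((contDiffAt_pd (hf t ht) l).differentiableAt (by simp))).mul_const (w l))
    fun t ht => ?_
  have := HasDerivAt.fun_sum (u := Finset.univ) (x := t) fun (l : Fin n) _ =>
    (HasDerivAt.fun_sum (u := Finset.univ) fun (k : Fin n) _ => (hasDerivAt_line (t := t)
      ((contDiffAt_pd (contDiffAt_pd (hf t ht) l) k).differentiableAt (by simp))).mul_const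
        (w k)).mul_const (w l)
  refine this.congr_deriv ?_
  simp [h t ht]

end Lines
end FinslerProj

/-! ### Douglas metrics in the two classes -/

namespace FinslerProj
variable {n : ℕ} {M : Type*} [TopologicalSpace M] [ChartedSpace (EuclideanSpace ℝ (Fin n)) M]
  [IsManifold (𝓡 n) ∞ M]

section DouglasMetrics

variable {a : RiemMetric n M} {β : OneForm n M} {e : OpenPartialHomeomorph M (Coord n)}
  {u : Coord n}

theorem sqrt_gForm_smul {t : ℝ} (ht : 0 < t)
    (y : Coord n) : √(gForm a e u (t • y) (t • y)) = t * √(gForm a e u y y) := by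
  rw [gForm_smul_left, gForm_smul_right, ← mul_assoc, ← sq, Real.sqrt_mul (sq_nonneg t),
    Real.sqrt_sq ht.le]

theorem denD_smul (q : ℝ) {t : ℝ} (ht : 0 < t)
    (y : Coord n) : denD q a β e u (t • y) = t * denD q a β e u y := by
  rw [denD, denD, sqrt_gForm_smul ht, bForm_smul]
  ring

theorem denE_smul (q : ℝ) {t : ℝ} (ht : 0 < t)
    (y : Coord n) : denE q a β e u (t • y) = t ^ 2 * denE q a β e u y := by
  rw [denE, denE, sqrt_gForm_smul ht, bForm_smul, gForm_smul_left, gForm_smul_right]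
  ring

theorem IsQMetric.qProj_smul {q : ℝ} (hF : IsQMetric q a β) (hn : 3 ≤ n) (he : e ∈ charts n M)
    (hu : u ∈ e.target) {t : ℝ} (ht : 0 < t) {y : Coord n} (hy : y ≠ 0) :
    qProj q a β e u (t • y) = t * qProj q a β e u y := by
  have hD := (hF.denD_pos hn he hu hy).ne'
  have hE := (hF.denE_pos hn he hu hy).ne'
  rw [qProj, qProj, denD_smul q ht, denE_smul q ht, sqrt_gForm_smul ht,
    bForm_smul, gForm_smul_left, gForm_smul_right, rForm_smul_left, rForm_smul_right,
    sForm_smul_right]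
  field_simp

theorem IsQMetric.qNormal_smul {q : ℝ} (hF : IsQMetric q a β) (hn : 3 ≤ n) (he : e ∈ charts n M)
    (hu : u ∈ e.target) {t : ℝ} (ht : 0 < t) {y : Coord n} (hy : y ≠ 0) :
    qNormal q a β e u (t • y) = t ^ 2 * qNormal q a β e u y := by
  have hD := (hF.denD_pos hn he hu hy).ne'
  have hE := (hF.denE_pos hn he hu hy).ne'
  rw [qNormal, qNormal, denD_smul q ht, denE_smul q ht, gForm_smul_left,
    gForm_smul_right, rForm_smul_left, rForm_smul_right, sForm_smul_right]
  field_simp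

theorem kProj_smul {t : ℝ} (ht : 0 < t) (y : Coord n) :
    kProj a β e u (t • y) = t * kProj a β e u y := by
  have h : t * (t * rForm a β e u y y) * (t * bForm β e u y) / (t * (t * gForm a e u y y)) =
      t * (rForm a β e u y y * bForm β e u y / gForm a e u y y) := by
    rw [show t * (t * rForm a β e u y y) * (t * bForm β e u y) =
      (t * t) * (t * (rForm a β e u y y * bForm β e u y)) by ring, ← mul_assoc t t,
      mul_div_mul_left _ _ (by positivity), mul_div_assoc]
  rw [kProj, kProj, gForm_smul_left, gForm_smul_right, rForm_smul_left, rForm_smul_right,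
    bForm_smul, sForm_smul_right, h]
  ring

theorem IsQMetric.sprayVec_smul {q : ℝ} (hF : IsQMetric q a β) (hn : 3 ≤ n)
    (he : e ∈ charts n M) (hu : u ∈ e.target) {t : ℝ} (ht : 0 < t) {y : Coord n} (hy : y ≠ 0) :
    sprayVec (qMetric q a β) e u (t • y) = t ^ 2 • sprayVec (qMetric q a β) e u y := by
  have hD := (hF.denD_pos hn he hu hy).ne'
  rw [hF.sprayVec_eq hn he hu hy, hF.sprayVec_eq hn he hu (smul_ne_zero ht.ne' hy),
    sprayVec_rnorm a he hu, sprayVec_rnorm a he hu, christoffelVec_smul_left,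
    christoffelVec_symm, christoffelVec_smul_left, hF.qProj_smul hn he hu ht hy,
    hF.qNormal_smul hn he hu ht hy, denD_smul q ht, gForm_smul_left, gForm_smul_right,
    sMap_smul he hu]
  match_scalars <;> field_simp

theorem isQuad_gForm_mul (r : ℝ) : IsQuad fun y : Coord n => gForm a e u y y * r := by
  simpa only [mul_comm] using
    IsQuad.const_mul (f := fun y : Coord n => gForm a e u y y) ⟨_, fun _ => rfl⟩ r

theorem isQuad_rForm_mul (r : ℝ) : IsQuad fun y : Coord n => rForm a β e u y y * r := by
  simpa only [mul_comm] using
    IsQuad.const_mul (f := fun y : Coord n => rForm a β e u y y) ⟨_, fun _ => rfl⟩ r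

theorem isQuad_sprayVec_rnorm (he : e ∈ charts n M) (hu : u ∈ e.target) (i : Fin n) :
    IsQuad fun y : Coord n => sprayVec (rnorm a) e u y i := by
  simp only [sprayVec_rnorm a he hu]
  exact IsQuad.const_mul (f := fun y : Coord n => christoffelVec a e u y y i)
    ⟨fun j k => christoffel a e u i j k, fun _ => rfl⟩ _

theorem isQuad_kQuad (i : Fin n) : IsQuad fun y : Coord n => kQuad a β e u y y i :=
  ((isQuad_gForm_mul _).add (isQuad_rForm_mul _)).const_mul _

theorem IsQMetric.douglas_eq_zero {q : ℝ} (hF : IsQMetric q a β) (hn : 3 ≤ n)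
    (he : e ∈ charts n M) (hu : u ∈ e.target) (hs : q = 0 ∨ ∀ y z, sForm a β e u y z = 0)
    {c : ℝ} (hc : ∀ y, y ≠ 0 →
      qNormal q a β e u y • bVec a β e u = (c * gForm a e u y y) • bVec a β e u)
    {y : Coord n} (hy : y ≠ 0) (i j k l : Fin n) :
    douglas (qMetric q a β) e u y i j k l = 0 := by
  have hy' := isOpen_compl_singleton.mem_nhds hy
  refine douglas_eq_zero_of_eventually (p := qProj q a β e u)
    (Q := fun y => sprayVec (rnorm a) e u y + (c * gForm a e u y y) • bVec a β e u)
    (fun i => (isQuad_sprayVec_rnorm he hu i).add ?_) ?_ ?_ i j k l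
  · have := (isQuad_gForm_mul (a := a) (e := e) (u := u) (bVec a β e u i)).const_mul c
    simp only [← mul_assoc] at this
    exact this
  · filter_upwards [hy'] with z hz
    have hd := (hF.contDiffAt_qProj hn he hu hz).differentiableAt (by simp)
    exact ⟨hd, fderiv_self_of_homogeneous hd fun t ht => hF.qProj_smul hn he hu ht hz⟩
  · filter_upwards [hy'] with z hz
    rw [hF.sprayVec_eq_of_sForm hn he hu hs hz, hc z hz]

theorem douglas_kropina_eq_zero (he : e ∈ charts n M) (hu : u ∈ e.target)
    (hK : KropinaCondition a β e u) {y : Coord n} (hy : 0 < bForm β e u y)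
    (i j k l : Fin n) : douglas (kropina a β) e u y i j k l = 0 := by
  refine douglas_eq_zero_of_eventually (p := kProj a β e u)
    (Q := fun y => sprayVec (rnorm a) e u y + kQuad a β e u y y)
    (fun i => (isQuad_sprayVec_rnorm he hu i).add (isQuad_kQuad i)) ?_ ?_ i j k l
  · filter_upwards [eventually_bForm_pos hy] with z hz
    have hd := (contDiffAt_kProj (a := a) (β := β) he hu (ne_zero_of_bForm_pos hz)).differentiableAt
      (by simp)
    exact ⟨hd, fderiv_self_of_homogeneous hd fun t ht => kProj_smul ht z⟩
  · filter_upwards [eventually_bForm_pos hy] with z hz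
    exact sprayVec_kropina_eq_kQuad he hu hK hz

theorem contDiffAt_spray {F : ∀ x : M, TangentSpace (𝓡 n) x → ℝ} {y : Coord n}
    (h : ContDiffAt ℝ ∞ (sprayVec F e u) y) (i : Fin n) :
    ContDiffAt ℝ ∞ (fun z => spray F e u z i) y :=
  (contDiff_coord i).contDiffAt.comp y h

theorem contDiffAt_projSpray {F : ∀ x : M, TangentSpace (𝓡 n) x → ℝ} {y : Coord n}
    (h : ContDiffAt ℝ ∞ (sprayVec F e u) y) (i : Fin n) :
    ContDiffAt ℝ ∞ (fun z => projSpray F e u z i) y :=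
  (contDiffAt_spray h i).sub ((contDiffAt_const.mul (ContDiffAt.sum fun m _ =>
    contDiffAt_pd (contDiffAt_spray h m) m)).mul (contDiff_coord i).contDiffAt)

theorem par_sprayVec_sub_projSpray (F : ∀ x : M, TangentSpace (𝓡 n) x → ℝ) (y : Coord n) :
    Par (sprayVec F e u y - projSpray F e u y) y := by
  have : sprayVec F e u y - projSpray F e u y =
      ((1 / ((n : ℝ) + 1)) * (∑ m, pd m (fun w => spray F e u w m) y)) • y := by
    ext i
    simp [sprayVec, projSpray]
  rw [this]
  exact par_smul_self _ _

/-- On the ray `w + ε b`, `ε > 0`, vanishing of the Douglas tensor makes the projective part a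
polynomial in `ε`. It thus stays bounded as `ε → 0`, although the spray itself could have a pole,
and the residue argument applies. -/
theorem kropinaCondition_of_douglas (he : e ∈ charts n M) (hu : u ∈ e.target)
    (hb : 0 < bSq a β e u)
    (h : ∀ y, 0 < bForm β e u y → ∀ i j k l, douglas (kropina a β) e u y i j k l = 0) :
    KropinaCondition a β e u := by
  refine sMap_eq_of_boundary he hu hb (X := projSpray (kropina a β) e u)
    (fun y _ => par_sprayVec_sub_projSpray _ y) fun w hw0 hw => ?_
  have hpos : ∀ ε ∈ Set.Ioi (0 : ℝ), 0 < bForm β e u (w + ε • bVec a β e u) := fun ε hε => by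
    rw [bForm_add, bForm_smul, hw, bForm_bVec, zero_add]
    exact mul_pos hε hb
  choose A B C hABC using fun i => exists_quadratic_on_line
    (f := fun z => projSpray (kropina a β) e u z i) isOpen_Ioi isPreconnected_Ioi
    (fun ε hε => contDiffAt_projSpray (contDiffAt_sprayVec_kropina (a := a) he hu (hpos ε hε)) i)
    (fun ε hε j k l => h _ (hpos ε hε) i j k l)
  have h1 : Continuous fun ε : ℝ =>
      (WithLp.toLp 2 fun i => ε * (A i + B i * ε + C i * ε ^ 2) : Coord n) :=
    continuous_toCoord fun i => by fun_prop
  have h2 := h1.tendsto 0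
  have h3 : (WithLp.toLp 2 fun i => (0 : ℝ) * (A i + B i * 0 + C i * 0 ^ 2) : Coord n) = 0 := by
    ext i
    simp
  rw [h3] at h2
  refine (h2.mono_left nhdsWithin_le_nhds).congr' ?_
  filter_upwards [self_mem_nhdsWithin] with ε hε
  ext i
  exact congrArg (ε * ·) (hABC i ε hε).symm

/-- On the whole line `v + t w` the projective part is one quadratic polynomial in `t`. By
homogeneity its leading coefficient `C` controls the spray modulo position at both ends, so `G(w)`
and `G(-w)` both agree with `C` modulo `w`. The line must avoid the origin, where the spray is
singular. -/
theorem IsQMetric.par_sub_neg_of_douglas {q : ℝ} (hF : IsQMetric q a β) (hn : 3 ≤ n)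
    (he : e ∈ charts n M) (hu : u ∈ e.target)
    (h : ∀ y, y ≠ 0 → ∀ i j k l, douglas (qMetric q a β) e u y i j k l = 0)
    {w v : Coord n} (hv : ∀ t : ℝ, v + t • w ≠ 0) (hw : w ≠ 0) :
    Par (sprayVec (qMetric q a β) e u w - sprayVec (qMetric q a β) e u (-w)) w := by
  choose A B C hABC using fun i => exists_quadratic_on_line
    (f := fun z => projSpray (qMetric q a β) e u z i) isOpen_univ isPreconnected_univ
    (fun ε _ => contDiffAt_projSpray (hF.contDiffAt_sprayVec hn he hu (hv ε)) i)
    (fun ε _ j k l => h _ (hv ε) i j k l)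
  set G := sprayVec (qMetric q a β) e u with hG
  have hK : ∀ i j (t : ℝ), G (v + t • w) i * (v + t • w) j - G (v + t • w) j * (v + t • w) i =
      (A i + B i * t + C i * t ^ 2) * (v j + t * w j) -
        (A j + B j * t + C j * t ^ 2) * (v i + t * w i) := fun i j t => by
    have := par_sprayVec_sub_projSpray (e := e) (u := u) (qMetric q a β) (v + t • w) i j
    have hi := hABC i t trivial
    have hj := hABC j t trivial
    simp only [PiLp.sub_apply] at this
    rw [hi, hj, ← hG] at this
    simp only [PiLp.add_apply, PiLp.smul_apply, smul_eq_mul] at this ⊢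
    linarith
  have key : ∀ (σ : ℝ), σ ^ 2 = 1 → ∀ i j, G (σ • w) i * (σ • w) j - G (σ • w) j * (σ • w) i =
      σ * (C i * w j - C j * w i) := fun σ hσ i j => by
    have hσ0 : σ ≠ 0 := by
      rintro rfl
      norm_num at hσ
    have hw' : σ • w ≠ 0 := smul_ne_zero hσ0 hw
    have hl := tendsto_line (σ • w) v
    have hG' := (hF.contDiffAt_sprayVec hn he hu hw').continuousAt.tendsto.comp hl
    have hp : ∀ k, Continuous fun x : Coord n => x k := continuous_coord
    have h1 := ((((hp i).tendsto _).comp hG').mul (((hp j).tendsto _).comp hl)).sub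
      ((((hp j).tendsto _).comp hG').mul (((hp i).tendsto _).comp hl))
    have h2 : Continuous fun ε : ℝ =>
        (A i * ε ^ 2 + B i * σ * ε + C i) * (ε * v j + σ * w j) -
        (A j * ε ^ 2 + B j * σ * ε + C j) * (ε * v i + σ * w i) := by fun_prop
    have h3 := (h2.tendsto 0).mono_left (nhdsWithin_le_nhds (s := Set.Ioi 0))
    refine (tendsto_nhds_unique h1 (h3.congr' ?_)).trans (by ring)
    filter_upwards [self_mem_nhdsWithin] with ε hε
    have hε0 : (0 : ℝ) < ε := hε
    -- Rescaling carries `t = σ / ε → ±∞` to the approach to `σ w`; the minors are homogeneous of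
    -- degree three.
    have h4 : σ • w + ε • v = ε • (v + (σ / ε) • w) := by
      rw [smul_add, smul_smul, mul_div_cancel₀ _ hε0.ne', add_comm]
    have h5 := hK i j (σ / ε)
    simp only [Function.comp_apply]
    rw [h4, hF.sprayVec_smul hn he hu hε0 (hv _), ← hG]
    simp only [PiLp.smul_apply, smul_eq_mul]
    have h6 : ∀ x y z t : ℝ, ε ^ 2 * x * (ε * y) - ε ^ 2 * z * (ε * t) =
      ε ^ 3 * (x * y - z * t) := fun x y z t => by ring
    rw [h6, h5]
    field_simp
    rw [hσ]
    ring
  intro i j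
  have h1 := key 1 (by norm_num) i j
  have h2 := key (-1) (by norm_num) i j
  rw [one_smul] at h1
  rw [neg_one_smul] at h2
  simp only [PiLp.sub_apply, PiLp.neg_apply] at h2 ⊢
  linarith

theorem exists_line_ne_zero (hn : 2 ≤ n) (w : Coord n) :
    ∃ v : Coord n, ∀ t : ℝ, v + t • w ≠ 0 := by
  by_contra! hc
  have h1 : Submodule.span ℝ {w} = ⊤ := by
    refine eq_top_iff.2 fun v _ => Submodule.mem_span_singleton.2 ?_
    obtain ⟨t, ht⟩ := hc v
    exact ⟨-t, by rw [neg_smul]; exact (eq_neg_of_add_eq_zero_left ht).symm⟩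
  have h2 := finrank_span_le_card (R := ℝ) ({w} : Set (Coord n))
  rw [h1, finrank_top] at h2
  simp at h2
  omega

end DouglasMetrics
end FinslerProj

/-! ### The potential of the 1-form `θ` -/

namespace FinslerProj
variable {n : ℕ} {M : Type*} [TopologicalSpace M] [ChartedSpace (EuclideanSpace ℝ (Fin n)) M]
  [IsManifold (𝓡 n) ∞ M]

section Determinant

theorem contDiffAt_det {A : Coord n → Matrix (Fin n) (Fin n) ℝ} {u : Coord n}
    (h : ∀ i j, ContDiffAt ℝ ∞ (fun v => A v i j) u) : ContDiffAt ℝ ∞ (fun v => (A v).det) u := by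
  simp only [Matrix.det_apply]
  exact ContDiffAt.sum fun σ _ => (contDiffAt_prod fun i _ => h _ _).const_smul _

theorem contDiffAt_inv_apply {A : Coord n → Matrix (Fin n) (Fin n) ℝ} {u : Coord n}
    (h : ∀ i j, ContDiffAt ℝ ∞ (fun v => A v i j) u) (hA : (A u).det ≠ 0) (i j : Fin n) :
    ContDiffAt ℝ ∞ (fun v => (A v)⁻¹ i j) u := by
  simp only [Matrix.inv_def, Matrix.smul_apply, smul_eq_mul, Ring.inverse_eq_inv,
    Matrix.adjugate_apply]
  refine ((contDiffAt_det h).inv hA).mul (contDiffAt_det fun k l => ?_)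
  simp only [Matrix.updateRow_apply]
  split_ifs
  · exact contDiffAt_const
  · exact h k l

/-- Jacobi's formula: after factoring out `A`, the linear coefficient of `det (1 + t C)` is the
trace of `C`. -/
theorem hasDerivAt_det_add_smul {A : Matrix (Fin n) (Fin n) ℝ} (hA : A.det ≠ 0)
    (B : Matrix (Fin n) (Fin n) ℝ) :
    HasDerivAt (fun t : ℝ => (A + t • B).det) (A.det * (A⁻¹ * B).trace) 0 := by
  have h1 : ∀ t : ℝ, (A + t • B).det = A.det * (1 + t • (A⁻¹ * B)).det := fun t => by
    rw [← Matrix.det_mul, mul_add, mul_one, Matrix.mul_smul, ← mul_assoc,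
      Matrix.mul_nonsing_inv _ hA.isUnit, one_mul]
  simp only [h1]
  refine HasDerivAt.const_mul _ ?_
  set C := A⁻¹ * B
  set p := (1 + (Polynomial.X : Polynomial ℝ) • C.map Polynomial.C).det.divX.divX with hp
  have h2 : ∀ t : ℝ, (1 + t • C).det = 1 + C.trace * t + p.eval t * t ^ 2 := fun t =>
    Matrix.det_one_add_smul t C
  simp only [h2]
  have h3 := (((hasDerivAt_id (0 : ℝ)).const_mul C.trace).const_add 1).add
    ((p.hasDerivAt 0).mul ((hasDerivAt_id (0 : ℝ)).pow 2))
  refine HasDerivAt.congr_deriv h3 ?_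
  simp

theorem fderiv_det {A : Coord n → Matrix (Fin n) (Fin n) ℝ} {u : Coord n}
    (h : ∀ i j, DifferentiableAt ℝ (fun v => A v i j) u) (hA : (A u).det ≠ 0) (y : Coord n) :
    fderiv ℝ (fun v => (A v).det) u y =
      (A u).det * ∑ i, ∑ j, (A u)⁻¹ i j * fderiv ℝ (fun v => A v j i) u y := by
  let d : (Fin n → Fin n → ℝ) → ℝ := fun B => (Matrix.of B).det
  have hd : ContDiff ℝ 1 d := by
    simp only [d, Matrix.det_apply]
    exact ContDiff.sum fun σ _ => (contDiff_prod fun i _ =>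
      (contDiff_apply_apply ℝ ℝ (σ i) i)).const_smul _
  have hd' := (hd.differentiable one_ne_zero (A u)).hasFDerivAt
  have hAd : HasFDerivAt (fun v => (A v : Fin n → Fin n → ℝ))
      (ContinuousLinearMap.pi fun i => ContinuousLinearMap.pi fun j =>
        fderiv ℝ (fun v => A v i j) u) u :=
    hasFDerivAt_pi.2 fun i => hasFDerivAt_pi.2 fun j => (h i j).hasFDerivAt
  have h1 := (HasFDerivAt.comp (g := d) u hd' hAd).fderiv
  -- The determinant is known to be differentiable, so its differential can be read off from
  -- derivatives along lines.
  have h2 : ∀ B : Fin n → Fin n → ℝ, fderiv ℝ d (A u) B =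
      (A u).det * ((A u)⁻¹ * Matrix.of B).trace := fun B => by
    let A₀ : Fin n → Fin n → ℝ := A u
    have h3 : HasDerivAt (fun t : ℝ => A₀ + t • B) B 0 := by
      simpa using ((hasDerivAt_id (0 : ℝ)).smul_const B).const_add A₀
    have h4 : HasFDerivAt d (fderiv ℝ d A₀) (A₀ + (0 : ℝ) • B) := by
      rw [zero_smul, add_zero]
      exact hd'
    exact (h4.comp_hasDerivAt (0 : ℝ) h3).unique (hasDerivAt_det_add_smul hA (Matrix.of B))
  refine (congrArg (fun T : Coord n →L[ℝ] ℝ => T y) h1).trans ((h2 _).trans ?_)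
  rfl

end Determinant

/-! ### The trace of the spray difference as an exact differential -/

section Potential

variable {a a' : RiemMetric n M} {β β' : OneForm n M} {e : OpenPartialHomeomorph M (Coord n)}
  {u : Coord n}

theorem det_aComp_pos (a : RiemMetric n M) (he : e ∈ charts n M) (hu : u ∈ e.target) :
    0 < (aComp a e u).det := (aComp_posDef a he hu).det_pos

theorem contDiffAt_det_aComp (he : e ∈ charts n M) (hu : u ∈ e.target) :
    ContDiffAt ℝ ∞ (fun v => (aComp a e v).det) u :=
  contDiffAt_det fun i j => contDiffAt_aComp a he hu i j

theorem contDiffAt_bSq (he : e ∈ charts n M) (hu : u ∈ e.target) :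
    ContDiffAt ℝ ∞ (bSq a β e) u :=
  ContDiffAt.sum fun i _ => (ContDiffAt.sum fun j _ =>
    (contDiffAt_inv_apply (fun i j => contDiffAt_aComp a he hu i j)
      (det_aComp_pos a he hu).ne' i j).mul (contDiffAt_bComp β he hu j)).mul
    (contDiffAt_bComp β he hu i)

theorem aComp_inv_symm (i j : Fin n) : (aComp a e u)⁻¹ i j = (aComp a e u)⁻¹ j i := by
  have h : (aComp a e u)ᵀ = aComp a e u := Matrix.ext fun i j => aComp_symm a e u j i
  conv_rhs => rw [← h, ← Matrix.transpose_nonsing_inv, Matrix.transpose_apply]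

/-- The contraction `Γᵐ_im` is half of `aᵐˡ ∂_i a_lm`, because the other two derivative terms cancel
under the symmetry of `aᵐˡ`. -/
theorem trace_christoffelVec (y : Coord n) :
    ∑ m, christoffelVec a e u y (stdVec m) m =
      (1 / 2) * ∑ i, ∑ j, (aComp a e u)⁻¹ i j * fderiv ℝ (fun v => aComp a e v j i) u y := by
  have h1 : ∀ m, christoffelVec a e u y (stdVec m) m = ∑ i, christoffel a e u m i m * y i :=
    fun m => by simp [christoffelVec, stdVec]
  have h2 : ∀ i, ∑ m, ∑ l, (aComp a e u)⁻¹ m l * pd m (fun v => aComp a e v l i) u =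
      ∑ m, ∑ l, (aComp a e u)⁻¹ m l * pd l (fun v => aComp a e v i m) u := fun i => by
    rw [Finset.sum_comm]
    refine Finset.sum_congr rfl fun l _ => Finset.sum_congr rfl fun m _ => ?_
    rw [aComp_inv_symm]
    congr 2
    exact funext fun v => aComp_symm a e v l i
  have h3 : ∀ i, ∑ m, christoffel a e u m i m =
      (1 / 2) * ∑ m, ∑ l, (aComp a e u)⁻¹ m l * pd i (fun v => aComp a e v l m) u := fun i => by
    simp only [christoffel, mul_add, mul_sub, Finset.sum_add_distrib, Finset.sum_sub_distrib,
      ← Finset.mul_sum, h2]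
    ring
  simp only [h1]
  rw [Finset.sum_comm]
  have h4 : ∀ i, ∑ m, christoffel a e u m i m * y i =
      (1 / 2) * (∑ m, ∑ l, (aComp a e u)⁻¹ m l * pd i (fun v => aComp a e v l m) u) * y i :=
    fun i => by rw [← Finset.sum_mul, h3]
  simp only [h4, fderiv_apply_eq_sum, Finset.mul_sum, Finset.sum_mul]
  rw [Finset.sum_comm]
  refine Finset.sum_congr rfl fun m _ => ?_
  rw [Finset.sum_comm]
  exact Finset.sum_congr rfl fun l _ => Finset.sum_congr rfl fun i _ => by ring

theorem fderiv_log_det (he : e ∈ charts n M) (hu : u ∈ e.target) (y : Coord n) :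
    fderiv ℝ (fun v => Real.log (aComp a e v).det) u y =
      2 * ∑ m, christoffelVec a e u y (stdVec m) m := by
  have hd := (det_aComp_pos a he hu).ne'
  rw [fderiv.log ((contDiffAt_det_aComp he hu).differentiableAt (by simp)) hd,
    trace_christoffelVec, smul_apply, smul_eq_mul,
    fderiv_det (fun i j => differentiableAt_aComp a he hu i j) hd]
  field_simp

theorem hasFDerivAt_gForm_base (he : e ∈ charts n M) (hu : u ∈ e.target) (y : Coord n) :
    ∃ T : Coord n →L[ℝ] ℝ, HasFDerivAt (fun v => gForm a e v y y) T u ∧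
      ∀ w, T w = gForm' a e u w y y := by
  refine ⟨_, HasFDerivAt.fun_sum fun i _ => HasFDerivAt.fun_sum fun j _ =>
    ((differentiableAt_aComp a he hu i j).hasFDerivAt.mul_const (y i)).mul_const (y j), ?_⟩
  intro w
  simp only [sum_apply, smul_apply, smul_eq_mul, gForm']
  exact Finset.sum_congr rfl fun i _ => Finset.sum_congr rfl fun j _ => by ring

theorem hasFDerivAt_bForm_base (he : e ∈ charts n M) (hu : u ∈ e.target) (y : Coord n) :
    ∃ T : Coord n →L[ℝ] ℝ, HasFDerivAt (fun v => bForm β e v y) T u ∧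
      ∀ w, T w = bForm' β e u w y := by
  refine ⟨_, HasFDerivAt.fun_sum fun i _ =>
    (differentiableAt_bComp β he hu i).hasFDerivAt.mul_const (y i), ?_⟩
  intro w
  simp only [sum_apply, smul_apply, smul_eq_mul, bForm']
  exact Finset.sum_congr rfl fun i _ => by ring

/-- With `b` frozen at its value at `u`, the function `v ↦ |b - b(v)|²` is nonnegative and vanishes
at `u`, so its differential there is zero. Expanding the square gives the derivative of `b²` without
differentiating the inverse matrix. -/
theorem fderiv_bSq (he : e ∈ charts n M) (hu : u ∈ e.target) (y : Coord n) :
    fderiv ℝ (bSq a β e) u y = 2 * covForm a β e u (bVec a β e u) y := by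
  set b := bVec a β e u with hb
  obtain ⟨T, hT, hT'⟩ := hasFDerivAt_gForm_base (a := a) he hu b
  obtain ⟨S, hS, hS'⟩ := hasFDerivAt_bForm_base (β := β) he hu b
  have hd : DifferentiableAt ℝ (bSq a β e) u := (contDiffAt_bSq he hu).differentiableAt (by simp)
  have h1 : HasFDerivAt (fun v => gForm a e v b b - 2 * bForm β e v b + bSq a β e v)
      (T - (2 : ℝ) • S + fderiv ℝ (bSq a β e) u) u :=
    (hT.sub (hS.const_mul 2)).add hd.hasFDerivAt
  have h0 : gForm a e u b b - 2 * bForm β e u b + bSq a β e u = 0 := by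
    rw [gForm_bVec a β he hu, hb, bForm_bVec]
    ring
  have hmin : IsLocalMin (fun v => gForm a e v b b - 2 * bForm β e v b + bSq a β e v) u := by
    filter_upwards [e.open_target.mem_nhds hu] with v hv
    rw [h0]
    have h2 := gForm_nonneg (a := a) e v (b + (-1 : ℝ) • bVec a β e v)
    simp only [gForm_add_left, gForm_add_right, gForm_smul_left, gForm_smul_right,
      gForm_comm a e v b (bVec a β e v), gForm_bVec a β he hv, bForm_bVec] at h2
    linarith
  have h3 := congrArg (fun T : Coord n →L[ℝ] ℝ => T y) (hmin.hasFDerivAt_eq_zero h1)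
  simp only [add_apply, sub_apply, smul_apply, smul_eq_mul, hT', hS', zero_apply] at h3
  rw [covForm_eq, ← gForm_bVec a β he hu, gForm_comm, ← hb, gForm_christoffelVec a he hu]
  linarith

/-- A function on the chart whose differential is the trace of the difference of the sprays. -/
def potential (a a' : RiemMetric n M) (β β' : OneForm n M) (ε : ℝ)
    (e : OpenPartialHomeomorph M (Coord n)) (u : Coord n) : ℝ :=
  (1 / 2) * Real.log (aComp a e u).det - (1 / 2) * Real.log (aComp a' e u).det -
    (1 / 2) * Real.log (bSq a' β' e u) - ε * Real.log (1 - bSq a β e u)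

theorem contDiffAt_potential (ε : ℝ) (he : e ∈ charts n M) (hu : u ∈ e.target)
    (hb : bSq a β e u < 1) (hb' : 0 < bSq a' β' e u) :
    ContDiffAt ℝ ∞ (potential a a' β β' ε e) u :=
  (((contDiffAt_const.mul ((contDiffAt_det_aComp he hu).log (det_aComp_pos a he hu).ne')).sub
    (contDiffAt_const.mul ((contDiffAt_det_aComp he hu).log (det_aComp_pos a' he hu).ne'))).sub
    (contDiffAt_const.mul ((contDiffAt_bSq he hu).log hb'.ne'))).sub
    (contDiffAt_const.mul ((contDiffAt_const.sub (contDiffAt_bSq he hu)).log (sub_pos.2 hb).ne'))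

theorem fderiv_potential (ε : ℝ) (he : e ∈ charts n M) (hu : u ∈ e.target)
    (hb : bSq a β e u < 1) (hb' : 0 < bSq a' β' e u) (y : Coord n) :
    fderiv ℝ (potential a a' β β' ε e) u y =
      ∑ m, christoffelVec a e u y (stdVec m) m - ∑ m, christoffelVec a' e u y (stdVec m) m -
        covForm a' β' e u (bVec a' β' e u) y / bSq a' β' e u +
        2 * ε * covForm a β e u (bVec a β e u) y / (1 - bSq a β e u) := by
  have h1 := (((contDiffAt_det_aComp he hu).log (det_aComp_pos a he hu).ne').differentiableAt
    (by simp)).hasFDerivAt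
  have h2 := (((contDiffAt_det_aComp he hu).log (det_aComp_pos a' he hu).ne').differentiableAt
    (by simp)).hasFDerivAt
  have h3 := ((contDiffAt_bSq (a := a') (β := β') he hu).differentiableAt
    (by simp)).hasFDerivAt.log hb'.ne'
  have h4 := (((contDiffAt_bSq (a := a) (β := β) he hu).differentiableAt
    (by simp)).hasFDerivAt.const_sub 1).log (sub_pos.2 hb).ne'
  have h5 := ((((h1.const_mul (1 / 2)).sub (h2.const_mul (1 / 2))).sub
    (h3.const_mul (1 / 2))).sub (h4.const_mul ε)).fderiv
  refine (congrArg (fun T : Coord n →L[ℝ] ℝ => T y) h5).trans ?_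
  simp only [sub_apply, smul_apply, smul_eq_mul, neg_apply, fderiv_log_det he hu, fderiv_bSq he hu]
  have := (sub_pos.2 hb).ne'
  have := hb'.ne'
  field_simp
  ring

end Potential
end FinslerProj

/-! ### Independence of the chart -/

namespace FinslerProj
variable {n : ℕ} {M : Type*} [TopologicalSpace M] [ChartedSpace (EuclideanSpace ℝ (Fin n)) M]
  [IsManifold (𝓡 n) ∞ M]

section ChartIndependence

variable {a a' : RiemMetric n M} {β β' : OneForm n M} {e e₀ : OpenPartialHomeomorph M (Coord n)}
  {u : Coord n}

theorem fderiv_transition_injective (he : e ∈ charts n M) (he₀ : e₀ ∈ charts n M)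
    (hu : u ∈ e.target) (hu₀ : e.symm u ∈ e₀.source) :
    Function.Injective (fderiv ℝ (transition e e₀) u) := fun y z hyz => by
  refine tvec_injective he hu ?_
  exact (tvec_transition he he₀ hu hu₀ y).trans
    ((congrArg _ hyz).trans (tvec_transition he he₀ hu hu₀ z).symm)

theorem fderiv_transition_surjective (he : e ∈ charts n M) (he₀ : e₀ ∈ charts n M)
    (hu : u ∈ e.target) (hu₀ : e.symm u ∈ e₀.source) :
    Function.Surjective (fderiv ℝ (transition e e₀) u) :=
  LinearMap.surjective_of_injective (f := (fderiv ℝ (transition e e₀) u).toLinearMap)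
    (fderiv_transition_injective he he₀ hu hu₀)

theorem gForm_transition (he : e ∈ charts n M) (he₀ : e₀ ∈ charts n M)
    (hu : u ∈ e.target) (hu₀ : e.symm u ∈ e₀.source) (y z : Coord n) :
    gForm a e u y z = gForm a e₀ (transition e e₀ u) (fderiv ℝ (transition e e₀) u y)
      (fderiv ℝ (transition e e₀) u z) := by
  rw [gForm_eq, gForm_eq]
  have key : ∀ (x x' : M) (v v' w w' : Coord n), x = x' → v = v' → w = w' →
      a.inner x v w = a.inner x' v' w' := by
    rintro x _ v _ w _ rfl rfl rfl
    rfl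
  exact key _ _ _ _ _ _ (symm_transition hu₀).symm (tvec_transition he he₀ hu hu₀ y)
    (tvec_transition he he₀ hu hu₀ z)

theorem bForm_transition (he : e ∈ charts n M) (he₀ : e₀ ∈ charts n M)
    (hu : u ∈ e.target) (hu₀ : e.symm u ∈ e₀.source) (y : Coord n) :
    bForm β e u y = bForm β e₀ (transition e e₀ u) (fderiv ℝ (transition e e₀) u y) := by
  rw [← inChart_form, ← inChart_form]
  exact apply_transition (fun x v => β x v) he he₀ hu hu₀ y

theorem bSq_transition (he : e ∈ charts n M) (he₀ : e₀ ∈ charts n M)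
    (hu : u ∈ e.target) (hu₀ : e.symm u ∈ e₀.source) :
    bSq a β e u = bSq a β e₀ (transition e e₀ u) := by
  have h : fderiv ℝ (transition e e₀) u (bVec a β e u) = bVec a β e₀ (transition e e₀ u) := by
    refine eq_of_gForm_eq a he₀ (transition_mem hu₀) fun z => ?_
    obtain ⟨z, rfl⟩ := fderiv_transition_surjective he he₀ hu hu₀ z
    rw [← gForm_transition he he₀ hu hu₀, gForm_bVec a β he hu,
      gForm_bVec a β he₀ (transition_mem hu₀), bForm_transition he he₀ hu hu₀]
  rw [← bForm_bVec, ← bForm_bVec, bForm_transition he he₀ hu hu₀, h]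

theorem aComp_transition (he : e ∈ charts n M) (he₀ : e₀ ∈ charts n M)
    (hu : u ∈ e.target) (hu₀ : e.symm u ∈ e₀.source) :
    aComp a e u = (Matrix.of fun i k => (fderiv ℝ (transition e e₀) u (stdVec k)) i)ᵀ *
      aComp a e₀ (transition e e₀ u) *
      Matrix.of fun i k => (fderiv ℝ (transition e e₀) u (stdVec k)) i := by
  ext i j
  rw [← gForm_stdVec, gForm_transition he he₀ hu hu₀]
  simp only [gForm, Matrix.mul_apply, Matrix.transpose_apply, Matrix.of_apply, Finset.sum_mul]
  rw [Finset.sum_comm]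
  exact Finset.sum_congr rfl fun _ _ => Finset.sum_congr rfl fun _ _ => by ring

/-- Both determinants acquire the same squared Jacobian, which cancels in the difference of the
logarithms; the norms are invariant. -/
theorem potential_transition (ε : ℝ) (he : e ∈ charts n M) (he₀ : e₀ ∈ charts n M)
    (hu : u ∈ e.target) (hu₀ : e.symm u ∈ e₀.source) :
    potential a a' β β' ε e u = potential a a' β β' ε e₀ (transition e e₀ u) := by
  set J : Matrix (Fin n) (Fin n) ℝ :=
    Matrix.of fun i k => (fderiv ℝ (transition e e₀) u (stdVec k)) i with hJ
  have h : ∀ a : RiemMetric n M, Real.log (aComp a e u).det =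
      2 * Real.log J.det + Real.log (aComp a e₀ (transition e e₀ u)).det := fun a => by
    have h1 := det_aComp_pos a he hu
    have h2 := det_aComp_pos a he₀ (transition_mem hu₀)
    rw [aComp_transition he he₀ hu hu₀, ← hJ, Matrix.det_mul, Matrix.det_mul,
      Matrix.det_transpose] at h1 ⊢
    have h3 : J.det ≠ 0 := fun h => by
      rw [h] at h1
      simp at h1
    -- `Real.log` is the logarithm of the absolute value, so the sign of the Jacobian is irrelevant.
    rw [Real.log_mul (mul_ne_zero h3 h2.ne') h3, Real.log_mul h3 h2.ne']
    ring
  rw [potential, potential, h a, h a', bSq_transition he he₀ hu hu₀,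
    bSq_transition he he₀ hu hu₀]
  ring

/-- The potential as a function on the manifold. -/
def globalPotential (a a' : RiemMetric n M) (β β' : OneForm n M) (ε : ℝ) (x : M) : ℝ :=
  potential a a' β β' ε (chartAt (EuclideanSpace ℝ (Fin n)) x)
    (chartAt (EuclideanSpace ℝ (Fin n)) x x)

theorem globalPotential_eq (ε : ℝ) (he : e ∈ charts n M) {x : M} (hx : x ∈ e.source) :
    globalPotential a a' β β' ε x = potential a a' β β' ε e (e x) := by
  have h := e.left_inv hx
  have hc : e.symm (e x) ∈ (chartAt (EuclideanSpace ℝ (Fin n)) x).source := by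
    rw [h]
    exact mem_chart_source _ x
  rw [potential_transition ε he (IsManifold.chart_mem_maximalAtlas (I := 𝓡 n) (n := ∞) x)
    (e.map_source hx) hc, transition, h, globalPotential]

theorem contMDiff_globalPotential (ε : ℝ)
    (hb : ∀ e ∈ charts n M, ∀ u ∈ e.target, bSq a β e u < 1)
    (hb' : ∀ e ∈ charts n M, ∀ u ∈ e.target, 0 < bSq a' β' e u) :
    ContMDiff (𝓡 n) 𝓘(ℝ) ∞ (globalPotential a a' β β' ε) := fun x => by
  have he := IsManifold.chart_mem_maximalAtlas (I := 𝓡 n) (n := ∞) x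
  have hx := mem_chart_source (EuclideanSpace ℝ (Fin n)) x
  set e := chartAt (EuclideanSpace ℝ (Fin n)) x
  have hu := e.map_source hx
  have h1 : ContMDiffAt (𝓡 n) 𝓘(ℝ) ∞ (potential a a' β β' ε e) (e x) :=
    contMDiffAt_iff_contDiffAt.2 (contDiffAt_potential ε he hu (hb e he _ hu) (hb' e he _ hu))
  have h2 := h1.comp x (contMDiffAt_of_mem_maximalAtlas he hx)
  refine h2.congr_of_eventuallyEq ?_
  filter_upwards [e.open_source.mem_nhds hx] with z hz
  exact globalPotential_eq ε he hz

/-- The differential of a smooth function, as a smooth 1-form. -/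
def differential (f : M → ℝ) (hf : ContMDiff (𝓡 n) 𝓘(ℝ) ∞ f) : OneForm n M where
  toFun x := mfderiv (𝓡 n) 𝓘(ℝ) f x
  contMDiff_toFun x := by
    refine (contMDiffAt_hom_bundle (IB := 𝓡 n) (F₁ := Coord n)
      (E₁ := fun x : M => TangentSpace (𝓡 n) x) (F₂ := ℝ) (E₂ := Bundle.Trivial M ℝ) _).2
      ⟨contMDiffAt_id, ?_⟩
    have h := (hf x).mfderiv_const (m := ∞) (by simp)
    refine h.congr_of_eventuallyEq (Filter.Eventually.of_forall fun z => ?_)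
    simp [inTangentCoordinates, ContinuousLinearMap.inCoordinates]
    rfl

theorem differential_tvec {f : M → ℝ} (hf : ContMDiff (𝓡 n) 𝓘(ℝ) ∞ f) (he : e ∈ charts n M)
    (hu : u ∈ e.target) (y : Coord n) :
    differential f hf (e.symm u) (tvec e u y) = fderiv ℝ (f ∘ e.symm) u y := by
  have h := mfderiv_comp u ((hf (e.symm u)).mdifferentiableAt (by simp))
    (mdifferentiableAt_symm he hu)
  rw [mfderiv_eq_fderiv] at h
  exact (congrArg (fun T : Coord n →L[ℝ] ℝ => T y) h).symm

theorem differential_globalPotential (ε : ℝ) (hf : ContMDiff (𝓡 n) 𝓘(ℝ) ∞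
    (globalPotential a a' β β' ε)) (he : e ∈ charts n M) (hu : u ∈ e.target) (y : Coord n) :
    differential _ hf (e.symm u) (tvec e u y) = fderiv ℝ (potential a a' β β' ε e) u y := by
  rw [differential_tvec hf he hu]
  have : globalPotential a a' β β' ε ∘ e.symm =ᶠ[nhds u] potential a a' β β' ε e := by
    filter_upwards [e.open_target.mem_nhds hu] with v hv
    rw [Function.comp_apply, globalPotential_eq ε he (e.map_target hv), e.right_inv hv]
  rw [this.fderiv_eq]

end ChartIndependence
end FinslerProj

/-! ### Change of charts for sprays -/

namespace FinslerProj
variable {n : ℕ} {M : Type*} [TopologicalSpace M] [ChartedSpace (EuclideanSpace ℝ (Fin n)) M]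
  [IsManifold (𝓡 n) ∞ M]

section SprayTransition

variable {a : RiemMetric n M} {β : OneForm n M} {e e₀ : OpenPartialHomeomorph M (Coord n)}
  {u : Coord n}

/-- The transformation law of spray coefficients under a change of coordinates. -/
theorem sprayVec_transition {F : ∀ x : M, TangentSpace (𝓡 n) x → ℝ} (he : e ∈ charts n M)
    (he₀ : e₀ ∈ charts n M) (hu : u ∈ e.target) (hu₀ : e.symm u ∈ e₀.source) {y : Coord n}
    (hE : ContDiffAt ℝ ∞ (energy F e) (u, y)) (hdet : IsUnit (fundTensor F e u y).det)
    (hE₀ : ContDiffAt ℝ ∞ (energy F e₀) (transition e e₀ u, fderiv ℝ (transition e e₀) u y))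
    (hdet₀ : IsUnit
      (fundTensor F e₀ (transition e e₀ u) (fderiv ℝ (transition e e₀) u y)).det) :
    sprayVec F e₀ (transition e e₀ u) (fderiv ℝ (transition e e₀) u y) =
      fderiv ℝ (transition e e₀) u (sprayVec F e u y) -
        (1 / 2 : ℝ) • fderiv ℝ (fderiv ℝ (transition e e₀)) u y y := by
  have h1 := (spray_eq_iff (contDiffAt_two_of_infty hE) hdet (sprayVec F e u y)).1 fun _ => rfl
  have hL : energy F e =ᶠ[nhds (u, y)] fun p =>
      energy F e₀ (transition e e₀ p.1, fderiv ℝ (transition e e₀) p.1 p.2) := by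
    filter_upwards [(continuous_fst.tendsto (u, y)).eventually (eventually_transition hu hu₀)]
      with p hp
    exact congrArg (· ^ 2) (apply_transition F he he₀ hp.1 hp.2 p.2)
  ext i
  refine (spray_eq_iff (contDiffAt_two_of_infty hE₀) hdet₀ _).2 (fun z => ?_) i
  obtain ⟨z, rfl⟩ := fderiv_transition_surjective he he₀ hu hu₀ z
  have h2 := eulerLagrange_transform
    ((contDiffAt_transition he he₀ hu hu₀).of_le (WithTop.coe_le_coe.2 le_top))
    (contDiffAt_two_of_infty hE₀) hL ((-2 : ℝ) • sprayVec F e u y) z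
  rw [h1 z, map_smul] at h2
  rw [h2]
  congr 1
  module

theorem contDiffAt_energy_kropina (he : e ∈ charts n M) (hu : u ∈ e.target) {y : Coord n}
    (hy : 0 < bForm β e u y) : ContDiffAt ℝ ∞ (energy (kropina a β) e) (u, y) :=
  (isTwoJet_kropina (x := (gForm a e u y y, bForm β e u y)) hy.ne').contDiffAt_energy he hu
    energy_kropina

theorem IsQMetric.contDiffAt_energy {q : ℝ} (hF : IsQMetric q a β) (he : e ∈ charts n M)
    (hu : u ∈ e.target) {y : Coord n} (hy : y ≠ 0) :
    ContDiffAt ℝ ∞ (energy (qMetric q a β) e) (u, y) :=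
  (isTwoJet_qEnergy q (x := (gForm a e u y y, bForm β e u y)) (gForm_pos a he hu hy)
    (hF.add_pos he hu hy)).contDiffAt_energy he hu (energy_qMetric q)

/-- The inhomogeneous second-derivative term is the same for both sprays, so their difference
transforms as a vector. -/
theorem IsQMetric.sprayVec_sub_transition {q : ℝ} (hF : IsQMetric q a β) {a' : RiemMetric n M}
    {β' : OneForm n M} (he : e ∈ charts n M) (he₀ : e₀ ∈ charts n M) (hu : u ∈ e.target)
    (hu₀ : e.symm u ∈ e₀.source) {y : Coord n} (hy : 0 < bForm β' e u y) :
    sprayVec (qMetric q a β) e₀ (transition e e₀ u) (fderiv ℝ (transition e e₀) u y) -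
        sprayVec (kropina a' β') e₀ (transition e e₀ u) (fderiv ℝ (transition e e₀) u y) =
      fderiv ℝ (transition e e₀) u
        (sprayVec (qMetric q a β) e u y - sprayVec (kropina a' β') e u y) := by
  have hy₀ := hy
  rw [bForm_transition he he₀ hu hu₀] at hy₀
  have hu₀' := transition_mem hu₀
  have h0 := ne_zero_of_bForm_pos hy
  have h0' := ne_zero_of_bForm_pos hy₀
  rw [sprayVec_transition he he₀ hu hu₀ (hF.contDiffAt_energy he hu h0)
    (hF.finsler.convex e he u hu y h0).det_pos.ne'.isUnit (hF.contDiffAt_energy he₀ hu₀' h0')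
    (hF.finsler.convex e₀ he₀ _ hu₀' _ h0').det_pos.ne'.isUnit,
    sprayVec_transition he he₀ hu hu₀ (contDiffAt_energy_kropina he hu hy)
    (isUnit_det_kropina he hu hy) (contDiffAt_energy_kropina he₀ hu₀' hy₀)
    (isUnit_det_kropina he₀ hu₀' hy₀), map_sub]
  abel

theorem mfderiv_tvec (he : e ∈ charts n M) (he₀ : e₀ ∈ charts n M) (hu : u ∈ e.target)
    (hu₀ : e.symm u ∈ e₀.source) (y : Coord n) :
    (mfderiv (𝓡 n) (𝓡 n) e₀ (e.symm u) (tvec e u y) : Coord n) =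
      fderiv ℝ (transition e e₀) u y := by
  have h := mfderiv_comp u ((contMDiffAt_of_mem_maximalAtlas he₀ hu₀).mdifferentiableAt (by simp))
    (mdifferentiableAt_symm he hu)
  have h' : mfderiv (𝓡 n) (𝓡 n) (e₀ ∘ e.symm) u = fderiv ℝ (transition e e₀) u :=
    mfderiv_eq_fderiv
  rw [h'] at h
  exact (congrArg (fun T : Coord n →L[ℝ] Coord n => T y) h).symm

/-- Sprays which differ by a multiple of `y` in every chart are projectively related: the factor
does not depend on the chart. -/
theorem IsQMetric.projectivelyRelated_of_chart {q : ℝ} (hF : IsQMetric q a β)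
    {a' : RiemMetric n M} {β' : OneForm n M}
    {p : OpenPartialHomeomorph M (Coord n) → Coord n → Coord n → ℝ}
    (h : ∀ e ∈ charts n M, ∀ u ∈ e.target, ∀ y, 0 < bForm β' e u y →
      sprayVec (qMetric q a β) e u y - sprayVec (kropina a' β') e u y = p e u y • y) :
    ProjectivelyRelated (qMetric q a β) (kropina a' β') (kropinaCone β') := by
  -- The factor at `x` is computed in the preferred chart at `x`; the vector law for the difference
  -- then identifies it with the factor in any other chart.
  refine ⟨fun x v => p (chartAt (EuclideanSpace ℝ (Fin n)) x)
    (chartAt (EuclideanSpace ℝ (Fin n)) x x)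
    (mfderiv (𝓡 n) (𝓡 n) (chartAt (EuclideanSpace ℝ (Fin n)) x) x v), fun e he u hu y hy i => ?_⟩
  have hy' : 0 < bForm β' e u y := by
    rw [← inChart_form]
    exact hy
  set e₀ := chartAt (EuclideanSpace ℝ (Fin n)) (e.symm u)
  have he₀ : e₀ ∈ charts n M :=
    IsManifold.chart_mem_maximalAtlas (I := 𝓡 n) (n := ∞) (e.symm u)
  have hu₀ : e.symm u ∈ e₀.source := mem_chart_source _ _
  have hy₀ := hy'
  rw [bForm_transition he he₀ hu hu₀] at hy₀
  have h1 := hF.sprayVec_sub_transition (a' := a') he he₀ hu hu₀ hy'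
  rw [h e he u hu y hy', h e₀ he₀ _ (transition_mem hu₀) _ hy₀, map_smul] at h1
  have h2 := smul_left_injective ℝ (ne_zero_of_bForm_pos hy₀) h1
  have h3 := congrArg (fun v : Coord n => v i) (h e he u hu y hy')
  have h4 : spray (qMetric q a β) e u y i - spray (kropina a' β') e u y i = p e u y * y i := h3
  have h5 : mfderiv (𝓡 n) (𝓡 n) e₀ (e.symm u) (tvec e u y) = fderiv ℝ (transition e e₀) u y :=
    mfderiv_tvec he he₀ hu hu₀ y
  have h6 : p e₀ (e₀ (e.symm u)) (mfderiv (𝓡 n) (𝓡 n) e₀ (e.symm u) (tvec e u y)) = p e u y :=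
    (congrArg (p e₀ (e₀ (e.symm u))) h5).trans h2
  change _ = _ + p e₀ (e₀ (e.symm u)) (mfderiv (𝓡 n) (𝓡 n) e₀ (e.symm u) (tvec e u y)) * y i
  rw [h6, ← h4]
  ring

end SprayTransition
end FinslerProj

/-! ### The equivalence -/

namespace FinslerProj
variable {n : ℕ} {M : Type*} [TopologicalSpace M] [ChartedSpace (EuclideanSpace ℝ (Fin n)) M]
  [IsManifold (𝓡 n) ∞ M]

section Equivalence

variable {a a' : RiemMetric n M} {β β' : OneForm n M} {e : OpenPartialHomeomorph M (Coord n)}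
  {u : Coord n}

theorem sum_gForm_stdVec (y v : Coord n) : ∑ m, gForm a e u y (stdVec m) * v m =
    gForm a e u y v := by
  simp only [gForm, stdVec, PiLp.single_apply, mul_ite, mul_one, mul_zero,
    Finset.sum_ite_eq', Finset.mem_univ, if_true, Finset.sum_mul]
  rw [Finset.sum_comm]

theorem sum_rForm_stdVec (y v : Coord n) : ∑ m, rForm a β e u y (stdVec m) * v m =
    rForm a β e u y v := by
  simp only [rForm, stdVec, PiLp.single_apply, mul_ite, mul_one, mul_zero,
    Finset.sum_ite_eq', Finset.mem_univ, if_true, Finset.sum_mul]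
  rw [Finset.sum_comm]

theorem rForm_add_sForm (y z : Coord n) :
    rForm a β e u y z + sForm a β e u y z = covForm a β e u y z := by
  rw [rForm_eq, sForm_eq]
  ring

theorem trace_kQuad (he : e ∈ charts n M) (hu : u ∈ e.target) (y : Coord n) :
    ∑ m, kQuad a β e u y (stdVec m) m =
      covForm a β e u (bVec a β e u) y / (2 * bSq a β e u) := by
  simp only [kQuad, PiLp.smul_apply, PiLp.add_apply, smul_eq_mul, ← Finset.mul_sum,
    Finset.sum_add_distrib, sum_gForm_stdVec, sum_rForm_stdVec]
  rw [gForm_comm, gForm_sVec a β he hu, rForm_comm, ← rForm_add_sForm]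
  ring

/-- Each trace is a logarithmic differential: Christoffel terms give `log det`, `kQuad` gives `log
b'²`, and `hc` turns the `c α² b` term into `log (1 - b²)`. -/
theorem two_mul_trace (he : e ∈ charts n M) (hu : u ∈ e.target) (hb : bSq a β e u < 1)
    (hb' : 0 < bSq a' β' e u) {c ε : ℝ} {y : Coord n}
    (hc : c * bForm β e u y * (1 - bSq a β e u) = ε * covForm a β e u (bVec a β e u) y) :
    2 * ∑ m, (diffMap a a' β' e u y (stdVec m) +
        (c * gForm a e u y (stdVec m)) • bVec a β e u) m =
      fderiv ℝ (potential a a' β β' ε e) u y := by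
  rw [fderiv_potential ε he hu hb hb']
  simp only [diffMap, PiLp.add_apply, PiLp.sub_apply, PiLp.smul_apply, smul_eq_mul,
    Finset.sum_add_distrib, Finset.sum_sub_distrib, ← Finset.mul_sum, mul_assoc,
    sum_gForm_stdVec, trace_kQuad he hu]
  rw [gForm_comm, gForm_bVec a β he hu]
  have h := (sub_pos.2 hb).ne'
  have h' : c * bForm β e u y = ε * covForm a β e u (bVec a β e u) y / (1 - bSq a β e u) := by
    rw [eq_div_iff h, hc]
  rw [h']
  field_simp

theorem qNormal_eq {q : ℝ} (hs : q = 0 ∨ ∀ y z, sForm a β e u y z = 0) (y : Coord n) :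
    qNormal q a β e u y = (1 / 2) * (q * (q - 1) * gForm a e u y y * rForm a β e u y y /
      denE q a β e u y) := by
  rcases hs with rfl | hs
  · simp [qNormal]
  · rw [qNormal, hs, mul_zero, sub_zero, mul_comm 2, ← div_div]
    ring

theorem spray_formula_iff {q : ℝ} (he : e ∈ charts n M) (hu : u ∈ e.target)
    (hs : q = 0 ∨ ∀ y z, sForm a β e u y z = 0) (y : Coord n) (t : ℝ) :
    (∀ i : Fin n, spray (rnorm a) e u y i - spray (rnorm a') e u y i =
        - (1 / 2) *
            (q * (q - 1) * inChart (rnorm a) e u y ^ 2 * r00 a β e u y /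
              ((1 - q ^ 2) * inChart (fun x => β x) e u y ^ 2
                + (2 - q) * inChart (rnorm a) e u y * inChart (fun x => β x) e u y
                + (1 + (q ^ 2 - q) * bSq a β e u) * inChart (rnorm a) e u y ^ 2))
            * bUp a β e u i
        + 1 / (2 * bSq a' β' e u) *
            (inChart (rnorm a') e u y ^ 2 * sUp a' β' e u i
              + r00 a' β' e u y * bUp a' β' e u i)
        + t * y i) ↔
      diffMap a a' β' e u y y + qNormal q a β e u y • bVec a β e u = t • y := by
  rw [qNormal_eq hs, diffMap_self he hu, denE]
  simp only [inChart_rnorm, inChart_form, Real.sq_sqrt (gForm_nonneg e u y), r00_eq]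
  have hk : ∀ i, kQuad a' β' e u y y i = 1 / (2 * bSq a' β' e u) *
      (gForm a' e u y y * sUp a' β' e u i + rForm a' β' e u y y * bUp a' β' e u i) := fun i => rfl
  constructor
  · intro h
    ext i
    have h1 := h i
    rw [← hk] at h1
    simp only [PiLp.add_apply, PiLp.sub_apply, PiLp.smul_apply, smul_eq_mul]
    change spray (rnorm a) e u y i - spray (rnorm a') e u y i - _ + _ * bUp a β e u i = _
    linarith
  · intro h i
    have h1 := congrArg (fun v : Coord n => v i) h
    simp only [PiLp.add_apply, PiLp.sub_apply, PiLp.smul_apply, smul_eq_mul] at h1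
    change spray (rnorm a) e u y i - spray (rnorm a') e u y i - _ + _ * bUp a β e u i = _ at h1
    rw [← hk]
    linarith

/-- The form is fixed beforehand as a differential, so it is smooth and global; the constants `c`,
chosen point by point, enter only through a trace that `two_mul_trace` evaluates. -/
theorem IsQMetric.exists_formula {q : ℝ} (hF : IsQMetric q a β) (hn : 3 ≤ n) (hq : q ≠ 1)
    (hb' : ∀ e ∈ charts n M, ∀ u ∈ e.target, 0 < bSq a' β' e u) :
    ∃ θ : OneForm n M, ∀ e ∈ charts n M, ∀ u ∈ e.target, ∀ (μ : ℝ),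
      (∀ y, bForm β e u y = μ * bForm β' e u y) →
      (∀ y, 0 < bForm β' e u y →
        Par (sprayVec (qMetric q a β) e u y - sprayVec (kropina a' β') e u y) y) →
      ∀ y, y ≠ 0 → diffMap a a' β' e u y y + qNormal q a β e u y • bVec a β e u =
        bForm θ e u y • y := by
  have hf : ContMDiff (𝓡 n) 𝓘(ℝ) ∞ (globalPotential a a' β β' (if q = 2 then 1 else 0)) :=
    contMDiff_globalPotential _ hF.norm_lt_one hb'
  -- The factor `1 / (n + 1)` is the one in the trace lemma.
  refine ⟨(1 / ((n : ℝ) + 1)) • differential _ hf, fun e he u hu μ hμ h y hy => ?_⟩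
  obtain ⟨c, hc, hc', hd⟩ := hF.exists_of_par hn hq he hu (hb' e he u hu) hμ h
  have hs := hF.sForm_eq_zero_of_par hn he hu (hb' e he u hu) hμ h
  have hθ : bForm ((1 / ((n : ℝ) + 1)) • differential _ hf) e u y =
      (1 / ((n : ℝ) + 1)) * fderiv ℝ (potential a a' β β' (if q = 2 then 1 else 0) e) u y := by
    rw [← inChart_form, ← differential_globalPotential _ hf he hu]
    rfl
  have hn1 : (n : ℝ) + 1 ≠ 0 := by positivity
  have ht : ((if q = 2 then 1 else 0) : ℝ) * rForm a β e u (bVec a β e u) y =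
      (if q = 2 then 1 else 0) * covForm a β e u (bVec a β e u) y := by
    rw [← rForm_add_sForm]
    split_ifs with h2
    · rw [hs.resolve_left (by rw [h2]; norm_num), add_zero]
    · ring
  rw [hc y hy, hθ, ← two_mul_trace (c := c) he hu (hF.norm_lt_one e he u hu) (hb' e he u hu)
    ((hc' y).trans ht)]
  refine smul_right_injective (Coord n) hn1 ?_
  simp only
  rw [hd, smul_smul, ← mul_assoc, mul_one_div_cancel hn1, one_mul]

end Equivalence

end FinslerProj

end

theorem theorem1 {n : ℕ} (hn : 3 ≤ n) {M : Type*} [TopologicalSpace M]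
    [ChartedSpace (EuclideanSpace ℝ (Fin n)) M] [IsManifold (𝓡 n) ∞ M]
    (q : ℝ) (hq : q ≠ 1)
    (a a' : FinslerProj.RiemMetric n M) (β β' : FinslerProj.OneForm n M)
    (hβ : ∃ x, β x ≠ 0) (hβ' : ∀ x, β' x ≠ 0)
    (hcol : ∀ x, ∃ μ : ℝ, β x = μ • β' x)
    (hF : FinslerProj.IsQMetric q a β) :
    FinslerProj.ProjectivelyRelated (FinslerProj.qMetric q a β) (FinslerProj.kropina a' β')
        (FinslerProj.kropinaCone β') ↔
      FinslerProj.IsDouglas (FinslerProj.qMetric q a β) FinslerProj.slit ∧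
      FinslerProj.IsDouglas (FinslerProj.kropina a' β') (FinslerProj.kropinaCone β') ∧
      ∃ θ : FinslerProj.OneForm n M,
        ∀ e ∈ FinslerProj.charts n M, ∀ u ∈ e.target, ∀ y : FinslerProj.Coord n, y ≠ 0 →
          ∀ i : Fin n,
            FinslerProj.spray (FinslerProj.rnorm a) e u y i
                - FinslerProj.spray (FinslerProj.rnorm a') e u y i =
              - (1 / 2) *
                  (q * (q - 1) * FinslerProj.inChart (FinslerProj.rnorm a) e u y ^ 2
                      * FinslerProj.r00 a β e u y /
                    ((1 - q ^ 2) * FinslerProj.inChart (fun x => β x) e u y ^ 2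
                      + (2 - q) * FinslerProj.inChart (FinslerProj.rnorm a) e u y
                          * FinslerProj.inChart (fun x => β x) e u y
                      + (1 + (q ^ 2 - q) * FinslerProj.bSq a β e u)
                          * FinslerProj.inChart (FinslerProj.rnorm a) e u y ^ 2))
                  * FinslerProj.bUp a β e u i
              + 1 / (2 * FinslerProj.bSq a' β' e u) *
                  (FinslerProj.inChart (FinslerProj.rnorm a') e u y ^ 2
                      * FinslerProj.sUp a' β' e u i
                    + FinslerProj.r00 a' β' e u y * FinslerProj.bUp a' β' e u i)
              + FinslerProj.inChart (fun x => θ x) e u y * y i := by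
  
  open FinslerProj in
  have hb' : ∀ e ∈ charts n M, ∀ u ∈ e.target, 0 < bSq a' β' e u := fun e he u hu =>
    bSq_pos he hu (hβ' _)
  have hμ : ∀ (e : OpenPartialHomeomorph M (Coord n)) (u : Coord n), ∃ μ : ℝ,
      ∀ y, bForm β e u y = μ * bForm β' e u y := fun e u => by
    obtain ⟨μ, hμ⟩ := hcol (e.symm u)
    refine ⟨μ, fun y => ?_⟩
    rw [← inChart_form, ← inChart_form, inChart, hμ]
    rfl
  have hcone : ∀ (e : OpenPartialHomeomorph M (Coord n)) (u y : Coord n),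
      tvec e u y ∈ kropinaCone β' (e.symm u) ↔ 0 < bForm β' e u y := fun e u y => by
    rw [← inChart_form]
    rfl
  have hslit : ∀ e ∈ charts n M, ∀ u ∈ e.target, ∀ y : Coord n,
      tvec e u y ∈ slit (e.symm u) ↔ y ≠ 0 := fun e he u hu y =>
    (tvec_eq_zero_iff he hu).not
  constructor
  · rintro ⟨P, hP⟩
    have hpar : ∀ e ∈ charts n M, ∀ u ∈ e.target, ∀ y, 0 < bForm β' e u y →
        Par (sprayVec (qMetric q a β) e u y - sprayVec (kropina a' β') e u y) y :=
      fun e he u hu y hy => by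
        have : sprayVec (qMetric q a β) e u y - sprayVec (kropina a' β') e u y =
            P (e.symm u) (tvec e u y) • y := by
          ext i
          have := hP e he u hu y ((hcone e u y).2 hy) i
          change spray _ e u y i - spray _ e u y i = _ * y i
          rw [this]
          ring
        rw [this]
        exact par_smul_self _ _
    refine ⟨fun e he u hu y hy => ?_, fun e he u hu y hy => ?_, ?_⟩
    · obtain ⟨μ, hμ⟩ := hμ e u
      obtain ⟨c, hc, -, -⟩ := hF.exists_of_par hn hq he hu (hb' e he u hu) hμ (hpar e he u hu)
      exact hF.douglas_eq_zero hn he hu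
        (hF.sForm_eq_zero_of_par hn he hu (hb' e he u hu) hμ (hpar e he u hu)) hc
        ((hslit e he u hu y).1 hy)
    · exact douglas_kropina_eq_zero he hu
        (hF.kropinaCondition_of_par hn he hu (hb' e he u hu) (hpar e he u hu))
        ((hcone e u y).1 hy)
    · obtain ⟨θ, hθ⟩ := hF.exists_formula hn hq hb'
      refine ⟨θ, fun e he u hu y hy => ?_⟩
      obtain ⟨μ, hμ⟩ := hμ e u
      have hs := hF.sForm_eq_zero_of_par hn he hu (hb' e he u hu) hμ (hpar e he u hu)
      refine (spray_formula_iff he hu hs y _).2 ?_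
      rw [inChart_form]
      exact hθ e he u hu μ hμ (hpar e he u hu) y hy
  · rintro ⟨hD, hD', θ, hθ⟩
    -- Modulo `y` the two sprays differ by the left side of the formula for `θ`; the factor collects
    -- `θ` and the two projective terms.
    refine hF.projectivelyRelated_of_chart (p := fun e u y =>
      bForm θ e u y + qProj q a β e u y - kProj a' β' e u y) fun e he u hu y hy => ?_
    have hK := kropinaCondition_of_douglas he hu (hb' e he u hu)
      fun y hy => hD' e he u hu y ((hcone e u y).2 hy)
    -- Here evenness modulo `w` comes from the Douglas property of `F` and holds for every nonzero
    -- `w`; the hyperplane `β' = 0` is all that is needed.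
    have hs : q = 0 ∨ ∀ y z, sForm a β e u y z = 0 := by
      obtain ⟨μ, hμ⟩ := hμ e u
      refine or_iff_not_imp_left.2 fun hq0 => hF.sForm_eq_zero hn he hu hq0 (hb' e he u hu).ne'
        (fun w hw => by rw [hμ, hw, mul_zero]) fun w hw _ => ?_
      obtain ⟨v, hv⟩ := exists_line_ne_zero (by omega) w
      exact hF.par_sub_neg_of_douglas hn he hu
        (fun y hy => hD e he u hu y ((hslit e he u hu y).2 hy)) hv hw
    have hy0 := ne_zero_of_bForm_pos hy
    have h := (spray_formula_iff he hu hs y _).1 (hθ e he u hu y hy0)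
    rw [inChart_form, diffMap_self he hu] at h
    rw [hF.sprayVec_eq_of_sForm hn he hu hs hy0, sprayVec_kropina_eq_kQuad he hu hK hy]
    rw [← sub_eq_zero] at h ⊢
    rw [← h]
    module
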